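/- Let $f\ge 1$, let $\Sigma$ be a finite alphabet, $M$ a finite monoid and $h\colon\Sigma^*\to M$ a homomorphism, given explicitly (the elements of $\Sigma$ and $M$ are numbered, the values of $h$ and the multiplication table are hard-wired). All of these are fixed. For a finite $K\subseteq\Sigma^*$ put $\|K\|_+=\sum_{w\in K}\max(1,|w|)$ and $N=\max(1,\|K\|_+)$ (so $N=\|K\|_+$ unless $K=\emptyset$). A *sentence context* of arity $d$ is a word $E=u_0\square_{\sigma(1)}u_1\cdots\square_{\sigma(d)}u_d$ with $\sigma\in S_d$, $u_i\in\Sigma^*$; $E[\vec x]$ is the word obtained by putting $x_i$ into $\square_i$, and $\tau_h(E)=(\sigma;h(u_0),\dots,h(u_d))\in S_d\times M^{d+1}$. A typed tuple $[\vec x:\tau]$ with $\vec x\in(\Sigma^*)^d$, $1\le d\le f$, is *observed* in $K$ if $E[\vec x]\in K$ and $\tau_h(E)=\tau$ for some $E$. The grammar $\hat G(K)$ has a fresh start symbol $\hat S$ of fan-out $1$, the observed typed tuples $[\vec x:\tau]$ as its other nonterminals (with fan-out the arity of $\vec x$), and these rules: 1. (start) $\hat S\to[(w):(\mathrm{id};1,1)]$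 for $w\in K$; 2. (terminal) $[(a):\tau]\to(a)$ for every observed $[(a):\tau]$ with $a\in\Sigma$; 3. (binary) $[\vec z:\tau_h(E)]\to\rho([\vec x:\tau_B],[\vec y:\tau_C])$ whenever $E[\vec z]\in K$, $\vec z$ has arity between $1$ and $f$, $[\vec x:\tau_B]$ and $[\vec y:\tau_C]$ are observed, $\rho=(\alpha_1,\dots,\alpha_e)$ is a tuple of words over terminals and variables $x^i,y^j$ in which every variable occurs exactly once, $\vec z=\rho(\vec x,\vec y)$, and $\tau_B,\tau_C$ are the transported interface types. Here, if $\tau_h(E)=(\sigma;m_0,\dots,m_e)$, then $\tau_B=(\kappa;n_0,\dots,n_d)$ is read off from $m_0\alpha_{\sigma(1)}m_1\cdots\alpha_{\sigma(e)}m_e$ by replacing each terminal $a$ by $h(a)$ and each $y^j$ by $h(y_j)$: $\kappa$ is the left-to-right order of the $x$-variables and $n_0,\dots,n_d$ are the products of the blocks between them; $\tau_C$ is defined in the same way with the roles of $x$ and $y$ exchanged; 4. (substitution, or unit, rules) $[\vec x:\tau]\to[\vec y:\tau]$ whenever $\vec x,\vec y$ have the same arity between $1$ and $f$, $h(x_i)=h(y_i)$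 for all $i$, and $E[\vec x],E[\vec y]\in K$ for one common context $E$ with $\tau_h(E)=\tau$. Running time is measured in elementary steps of a while-language on binary trees (cons, head, tail, test for nil, let, iteration at unit cost); a grammar is output as repetition-free lists of its nonterminals, with fan-outs, and of its rules. **Theorem.** (a) $\hat G(K)$ has $O(N^{2f})$ nonterminals; it has $O(N^{4f+2})$ start, terminal and substitution rules and $O(N^{6f})$ rules altogether, where the implied constants depend only on $f$. (b) For fixed $f$ and fixed explicit $h$ there is a program that, given any repetition-free list of the words of $K$, outputs $\hat G(K)$, with running time and output size bounded by a polynomial in $N$. (c) Let $\hat G(K)^{\mathrm{uf}}$ be obtained from $\hat G(K)$ by unit elimination: add $A\to\theta$ whenever there is a chain of unit rules from $A$ to $B$ and $B\to\theta$ is a terminal or binary rule; then delete all unit rules. Then $\hat G(K)^{\mathrm{uf}}$ is a working binary linear nondeleting multiple context-free grammar (a finite start-separated grammar with start, terminal and linear nondeleting binary rules only, respecting fan-outs), it generates the same language as $\hat G(K)$, and it can also be computed from $K$ with running time and output size polynomial in $N$. -/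

import Mathlib

namespace TupleLearner

/-! ## Tuples, sentence contexts and interface types -/

/-- The positive sample size `‖K‖₊ = ∑_{w ∈ K} max(1, |w|)`. -/
def sampleSize {α : Type*} (K : Finset (List α)) : ℕ :=
  ∑ w ∈ K, max 1 w.length

/-- `I_h(d) = S_d × M^{d+1}`. -/
abbrev Interface (M : Type*) (d : ℕ) : Type _ :=
  Equiv.Perm (Fin d) × (Fin (d + 1) → M)

/-- A sentence context `u₀ □_{σ(1)} u₁ ⋯ □_{σ(d)} u_d` of arity `d`; `perm` sends positions
(from left to right) to hole names. -/
structure SentenceContext (α : Type*) (d : ℕ) where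
  perm : Equiv.Perm (Fin d)
  bdry : Fin (d + 1) → List α

/-- `E[x]`: the word obtained by putting `x i` into the hole named `i`. -/
def SentenceContext.fill {α : Type*} {d : ℕ} (E : SentenceContext α d)
    (x : Fin d → List α) : List α :=
  E.bdry 0 ++ (List.ofFn fun i : Fin d => x (E.perm i) ++ E.bdry i.succ).flatten

/-- The value of the homomorphism `h` on a word. -/
def hval {α M : Type*} [Monoid M] (h : FreeMonoid α →* M) (w : List α) : M :=
  h (FreeMonoid.ofList w)

/-- The sentence-interface type `τ_h(E) = (σ; h(u₀), …, h(u_d))`. -/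
def SentenceContext.type {α M : Type*} [Monoid M] (h : FreeMonoid α →* M) {d : ℕ}
    (E : SentenceContext α d) : Interface M d :=
  (E.perm, fun i => hval h (E.bdry i))

/-- `τ_st = (id₁; 1, 1)`. -/
def startInterface (M : Type*) [Monoid M] : Interface M 1 := (1, fun _ => 1)

/-! ## Rule templates -/

/-- A template `(α₁, …, α_e)`: each component is a word over terminals (`Sum.inl a`), variables
`x^i` (`Sum.inr (Sum.inl i)`) and variables `y^j` (`Sum.inr (Sum.inr j)`). -/
abbrev Template (α : Type*) (e dB dC : ℕ) : Type _ :=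
  Fin e → List (α ⊕ (Fin dB ⊕ Fin dC))

/-- Every variable occurs exactly once in the whole tuple (linear and nondeleting). -/
def Template.Linear {α : Type*} {e dB dC : ℕ} (t : Template α e dB dC) : Prop :=
  ∀ v : Fin dB ⊕ Fin dC, ((List.ofFn t).flatten.filterMap Sum.getRight?).count v = 1

/-- `ρ(u, v)`: simultaneous substitution of `u i` for `x^i` and `v j` for `y^j`. -/
def Template.subst {α : Type*} {e dB dC : ℕ} (t : Template α e dB dC)
    (u : Fin dB → List α) (v : Fin dC → List α) : Fin e → List α :=
  fun i => (t i).flatMap (Sum.elim (fun a => [a]) (Sum.elim u v))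

/-- The word `m₀ β_{σ(1)} m₁ ⋯ β_{σ(e)} m_e` over monoid elements (`Sum.inl`) and visible
variables (`Sum.inr`), for `τ = (σ; m₀, …, m_e)`. -/
def decorate {M : Type*} {e d : ℕ} (τ : Interface M e) (β : Fin e → List (M ⊕ Fin d)) :
    List (M ⊕ Fin d) :=
  Sum.inl (τ.2 0) :: (List.ofFn fun i : Fin e => β (τ.1 i) ++ [Sum.inl (τ.2 i.succ)]).flatten

/-- The decorated `B`-trace: terminals and `y`-variables are replaced by their values in `M`,
`x`-variables stay visible. -/
def traceB {α M : Type*} [Monoid M] (h : FreeMonoid α →* M) {e dB dC : ℕ}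
    (t : Template α e dB dC) (τ : Interface M e) (r : Fin dC → M) : List (M ⊕ Fin dB) :=
  decorate τ fun i => (t i).map
    (Sum.elim (fun a => Sum.inl (hval h [a])) (Sum.elim Sum.inr (fun j => Sum.inl (r j))))

/-- The decorated `C`-trace: terminals and `x`-variables are replaced by their values in `M`,
`y`-variables stay visible. -/
def traceC {α M : Type*} [Monoid M] (h : FreeMonoid α →* M) {e dB dC : ℕ}
    (t : Template α e dB dC) (τ : Interface M e) (q : Fin dB → M) : List (M ⊕ Fin dC) :=
  decorate τ fun i => (t i).map
    (Sum.elim (fun a => Sum.inl (hval h [a])) (Sum.elim (fun j => Sum.inl (q j)) Sum.inr))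

/-- `ι = (κ; n₀, …, n_d)` is read off from a trace: the trace is
`β₀ z^{κ(1)} β₁ ⋯ z^{κ(d)} β_d` with blocks `β_i` of monoid elements, and `n_i` is the product
of `β_i`. In a trace where every variable occurs exactly once such a `ι` exists and is unique,
so for a linear template `ReadsOff (traceB h t τ r) ι` says that `ι` is the transported
child interface. -/
def ReadsOff {M : Type*} [Monoid M] {d : ℕ} (trace : List (M ⊕ Fin d)) (ι : Interface M d) :
    Prop :=
  ∃ β : Fin (d + 1) → List M,
    trace = (β 0).map Sum.inl ++
      (List.ofFn fun i : Fin d => Sum.inr (ι.1 i) :: (β i.succ).map Sum.inl).flatten ∧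
    ∀ i, ι.2 i = (β i).prod

/-! ## Extended grammars -/

/-- Rules of an extended grammar: start rules `S → A`, terminal rules `A → (a)`, binary rules
`A → (α₁, …, α_e)(B, C)` and unit rules `A → B`. -/
inductive Rule (α ν : Type*) where
  | start (A : ν) : Rule α ν
  | term (A : ν) (a : α) : Rule α ν
  | binary {e dB dC : ℕ} (A : ν) (t : Template α e dB dC) (B C : ν) : Rule α ν
  | unit (A B : ν) : Rule α ν

/-- Grammar data: nonterminals, start symbol, fan-out and rules. -/
structure Grammar (α ν : Type*) where
  nts : Set ν
  start : ν
  fanout : ν → ℕ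
  rules : Set (Rule α ν)

namespace Grammar

variable {α ν : Type*}

/-- The conditions on a single rule of a start-separated extended grammar. -/
def WellFormedRule (G : Grammar α ν) : Rule α ν → Prop
  | .start A => A ∈ G.nts ∧ A ≠ G.start ∧ G.fanout A = 1
  | .term A _ => A ∈ G.nts ∧ A ≠ G.start ∧ G.fanout A = 1
  | .binary (e := e) (dB := dB) (dC := dC) A t B C =>
      A ∈ G.nts ∧ B ∈ G.nts ∧ C ∈ G.nts ∧
      A ≠ G.start ∧ B ≠ G.start ∧ C ≠ G.start ∧
      G.fanout A = e ∧ G.fanout B = dB ∧ G.fanout C = dC ∧ t.Linear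
  | .unit A B =>
      A ∈ G.nts ∧ B ∈ G.nts ∧ A ≠ G.start ∧ B ≠ G.start ∧ G.fanout A = G.fanout B

/-- A finite extended grammar: a working binary linear nondeleting MCFG, except that unit rules
between non-start nonterminals of equal fan-out are allowed. -/
structure IsExtended (G : Grammar α ν) : Prop where
  nts_finite : G.nts.Finite
  rules_finite : G.rules.Finite
  start_mem : G.start ∈ G.nts
  start_fanout : G.fanout G.start = 1
  fanout_pos : ∀ A ∈ G.nts, 0 < G.fanout A
  wellFormed : ∀ r ∈ G.rules, G.WellFormedRule r

/-- There are no unit rules. An extended grammar without unit rules is exactly a working binary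
linear nondeleting MCFG. -/
def UnitFree (G : Grammar α ν) : Prop :=
  ∀ A B, Rule.unit A B ∉ G.rules

/-- `G.Derives A w`: the nonterminal `A` derives the tuple `w`. -/
inductive Derives (G : Grammar α ν) : ν → {d : ℕ} → (Fin d → List α) → Prop
  | start {A : ν} {w : Fin 1 → List α} :
      Rule.start A ∈ G.rules → Derives G A w → Derives G G.start w
  | term {A : ν} {a : α} :
      Rule.term A a ∈ G.rules → Derives G A (fun _ : Fin 1 => [a])
  | binary {e dB dC : ℕ} {A B C : ν} {t : Template α e dB dC}
      {u : Fin dB → List α} {v : Fin dC → List α} :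
      Rule.binary A t B C ∈ G.rules → Derives G B u → Derives G C v →
      Derives G A (t.subst u v)
  | unit {d : ℕ} {A B : ν} {w : Fin d → List α} :
      Rule.unit A B ∈ G.rules → Derives G B w → Derives G A w

/-- The string language of `G`. -/
def language (G : Grammar α ν) : Set (List α) :=
  {w | G.Derives G.start (fun _ : Fin 1 => w)}

/-- `A U* B`: there is a (possibly empty) chain of unit rules from `A` to `B`. -/
def UnitReach (G : Grammar α ν) : ν → ν → Prop :=
  Relation.ReflTransGen fun A B => Rule.unit A B ∈ G.rules

/-- The rules after unit elimination: `A → θ` for all `A U* B` and all non-unit `B → θ`.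
Start rules stay as they are, since the start symbol is not involved in unit rules. -/
inductive UnitElimRule (G : Grammar α ν) : Rule α ν → Prop
  | start {A : ν} : Rule.start A ∈ G.rules → UnitElimRule G (.start A)
  | term {A B : ν} {a : α} :
      G.UnitReach A B → Rule.term B a ∈ G.rules → UnitElimRule G (.term A a)
  | binary {e dB dC : ℕ} {A B C D : ν} {t : Template α e dB dC} :
      G.UnitReach A B → Rule.binary B t C D ∈ G.rules → UnitElimRule G (.binary A t C D)

/-- Unit elimination. -/
def unitElim (G : Grammar α ν) : Grammar α ν where
  nts := G.nts
  start := G.start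
  fanout := G.fanout
  rules := {r | G.UnitElimRule r}

end Grammar

/-! ## The learner grammar -/

/-- A typed tuple `[x : τ]`. -/
structure TypedTuple (α M : Type*) where
  arity : ℕ
  comps : Fin arity → List α
  iface : Interface M arity

section Learner

variable {α M : Type*} [Monoid M]

/-- `[x : τ]` is observed in `K`: `1 ≤ d ≤ f` and `E[x] ∈ K` for some concrete sentence context
`E` with `τ_h(E) = τ`. -/
def Observed (f : ℕ) (h : FreeMonoid α →* M) (K : Finset (List α)) (T : TypedTuple α M) : Prop :=
  1 ≤ T.arity ∧ T.arity ≤ f ∧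
    ∃ E : SentenceContext α T.arity, E.fill T.comps ∈ K ∧ E.type h = T.iface

/-- The rules of the learner grammar; `none` is the fresh start symbol and `some [x : τ]` the
nonterminal `[x : τ]`. In the binary clause the segmentations of the components of `z` are given
by the template `t` with `z = t.subst x y`. -/
inductive LearnerRule (f : ℕ) (h : FreeMonoid α →* M) (K : Finset (List α)) :
    Rule α (Option (TypedTuple α M)) → Prop
  | start {w : List α} :
      w ∈ K → LearnerRule f h K (.start (some ⟨1, fun _ => w, startInterface M⟩))
  | term {a : α} {τ : Interface M 1} :
      Observed f h K ⟨1, fun _ => [a], τ⟩ →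
      LearnerRule f h K (.term (some ⟨1, fun _ => [a], τ⟩) a)
  | binary {e dB dC : ℕ} {E : SentenceContext α e} {z : Fin e → List α}
      {x : Fin dB → List α} {y : Fin dC → List α} {τB : Interface M dB} {τC : Interface M dC}
      {t : Template α e dB dC} :
      1 ≤ e → e ≤ f → E.fill z ∈ K →
      Observed f h K ⟨dB, x, τB⟩ → Observed f h K ⟨dC, y, τC⟩ →
      t.Linear → z = t.subst x y →
      ReadsOff (traceB h t (E.type h) fun j => hval h (y j)) τB →
      ReadsOff (traceC h t (E.type h) fun i => hval h (x i)) τC →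
      LearnerRule f h K
        (.binary (some ⟨e, z, E.type h⟩) t (some ⟨dB, x, τB⟩) (some ⟨dC, y, τC⟩))
  | unit {d : ℕ} {x y : Fin d → List α} {E : SentenceContext α d} :
      1 ≤ d → d ≤ f → (∀ i, hval h (x i) = hval h (y i)) →
      E.fill x ∈ K → E.fill y ∈ K →
      LearnerRule f h K (.unit (some ⟨d, x, E.type h⟩) (some ⟨d, y, E.type h⟩))

/-- The learner grammar `Ĝ(K)`. -/
def learner (f : ℕ) (h : FreeMonoid α →* M) (K : Finset (List α)) :
    Grammar α (Option (TypedTuple α M)) where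
  nts := {A | ∀ T, A = some T → Observed f h K T}
  start := none
  fanout := fun A => A.elim 1 TypedTuple.arity
  rules := {r | LearnerRule f h K r}

end Learner

/-! ## A machine model with a step count

A while-language on immutable binary trees (cons cells). Each elementary operation on cells costs
one step; there is no unit-cost comparison of trees other than the test for `nil`. A run of `t`
steps allocates at most `t` cells, so running time in this model and on a Turing machine agree up
to polynomials once the size of the output, written out as a tree, is also bounded. -/

/-- Data values: binary trees. -/
inductive Val where
  | nil : Val
  | cons (a b : Val) : Val

namespace Val

def hd : Val → Val
  | nil => nil
  | cons a _ => a

def tl : Val → Val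
  | nil => nil
  | cons _ b => b

/-- The number of nodes of a value, written out as a tree. -/
def size : Val → ℕ
  | nil => 1
  | cons a b => 1 + a.size + b.size

end Val

/-- Programs. Variables are de Bruijn indices: `letIn a b` binds the value of `a` as variable `0`
of `b`, and `iter b` runs `b` repeatedly on the state held in variable `0`. -/
inductive Prog where
  | var (i : ℕ) : Prog
  | nil : Prog
  | cons (a b : Prog) : Prog
  | hd (a : Prog) : Prog
  | tl (a : Prog) : Prog
  | ite (c a b : Prog) : Prog
  | letIn (a b : Prog) : Prog
  | iter (b : Prog) : Prog

/-- `Eval ρ p v n`: in the environment `ρ` the program `p` halts with value `v` after exactly `n`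
steps. `iter b` replaces its state `s` (variable `0`) by the value of `b` as long as the head of
`s` is not `nil`, and finally returns the tail of the state. -/
inductive Eval : List Val → Prog → Val → ℕ → Prop
  | var {ρ : List Val} {i : ℕ} {v : Val} : ρ[i]? = some v → Eval ρ (.var i) v 1
  | nil {ρ : List Val} : Eval ρ .nil .nil 1
  | cons {ρ : List Val} {a b : Prog} {u v : Val} {m n : ℕ} :
      Eval ρ a u m → Eval ρ b v n → Eval ρ (.cons a b) (.cons u v) (m + n + 1)
  | hd {ρ : List Val} {a : Prog} {u : Val} {m : ℕ} :
      Eval ρ a u m → Eval ρ (.hd a) u.hd (m + 1)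
  | tl {ρ : List Val} {a : Prog} {u : Val} {m : ℕ} :
      Eval ρ a u m → Eval ρ (.tl a) u.tl (m + 1)
  | ite_true {ρ : List Val} {c a b : Prog} {u v : Val} {m n : ℕ} :
      Eval ρ c u m → u ≠ .nil → Eval ρ a v n → Eval ρ (.ite c a b) v (m + n + 1)
  | ite_false {ρ : List Val} {c a b : Prog} {v : Val} {m n : ℕ} :
      Eval ρ c .nil m → Eval ρ b v n → Eval ρ (.ite c a b) v (m + n + 1)
  | letIn {ρ : List Val} {a b : Prog} {u v : Val} {m n : ℕ} :
      Eval ρ a u m → Eval (u :: ρ) b v n → Eval ρ (.letIn a b) v (m + n + 1)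
  | iter_stop {ρ : List Val} {b : Prog} {s : Val} :
      s.hd = .nil → Eval (s :: ρ) (.iter b) s.tl 1
  | iter_step {ρ : List Val} {b : Prog} {s s' v : Val} {m n : ℕ} :
      s.hd ≠ .nil → Eval (s :: ρ) b s' m → Eval (s' :: ρ) (.iter b) v n →
      Eval (s :: ρ) (.iter b) v (m + n + 1)

/-! ## Encodings -/

/-- Unary numerals. -/
def encNat : ℕ → Val
  | 0 => .nil
  | n + 1 => .cons .nil (encNat n)

def encList {β : Type*} (enc : β → Val) : List β → Val
  | [] => .nil
  | b :: l => .cons (enc b) (encList enc l)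

/-- Elements of a type enumerated by `Fin n` are encoded by their index. -/
def encIdx {β : Type*} {n : ℕ} (e : β ≃ Fin n) (b : β) : Val :=
  encNat (e b)

/-- A list of words. -/
def encSample {α : Type*} {s : ℕ} (eα : α ≃ Fin s) (l : List (List α)) : Val :=
  encList (encList (encIdx eα)) l

def encInterface {M : Type*} {m d : ℕ} (eM : M ≃ Fin m) (τ : Interface M d) : Val :=
  .cons (encList (fun i : Fin d => encNat i) (List.ofFn τ.1))
    (encList (encIdx eM) (List.ofFn τ.2))

def encNonterminal {α M : Type*} {s m : ℕ} (eα : α ≃ Fin s) (eM : M ≃ Fin m) :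
    Option (TypedTuple α M) → Val
  | none => .nil
  | some T => .cons (encSample eα (List.ofFn T.comps)) (encInterface eM T.iface)

/-- A template symbol, as a pair of a tag and an index. -/
def encSymbol {α : Type*} {s dB dC : ℕ} (eα : α ≃ Fin s) : α ⊕ (Fin dB ⊕ Fin dC) → Val
  | .inl a => .cons (encNat 0) (encIdx eα a)
  | .inr (.inl i) => .cons (encNat 1) (encNat i)
  | .inr (.inr j) => .cons (encNat 2) (encNat j)

def encTemplate {α : Type*} {s e dB dC : ℕ} (eα : α ≃ Fin s) (t : Template α e dB dC) : Val :=
  encList (encList (encSymbol eα)) (List.ofFn t)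

/-- A rule, as a tag followed by its data; the arities of a binary rule are those of its
template and of its nonterminals. -/
def encRule {α ν : Type*} {s : ℕ} (eα : α ≃ Fin s) (encν : ν → Val) : Rule α ν → Val
  | .start A => .cons (encNat 0) (encν A)
  | .term A a => .cons (encNat 1) (.cons (encν A) (encIdx eα a))
  | .binary A t B C =>
      .cons (encNat 2) (.cons (encν A) (.cons (encTemplate eα t) (.cons (encν B) (encν C))))
  | .unit A B => .cons (encNat 3) (.cons (encν A) (encν B))

/-- `v` is an explicit description of the grammar `G`: its start symbol, a list without
repetitions of all its nonterminals with their fan-outs, and a list without repetitions of all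
its rules. -/
def Describes {α ν : Type*} {s : ℕ} (eα : α ≃ Fin s) (encν : ν → Val) (v : Val)
    (G : Grammar α ν) : Prop :=
  ∃ (nts : List ν) (rules : List (Rule α ν)),
    nts.Nodup ∧ (∀ A, A ∈ nts ↔ A ∈ G.nts) ∧
    rules.Nodup ∧ (∀ r, r ∈ rules ↔ r ∈ G.rules) ∧
    v = .cons (encν G.start)
      (.cons (encList (fun A => .cons (encν A) (encNat (G.fanout A))) nts)
        (encList (encRule eα encν) rules))

/-- A grammar depending on a finite sample `K` is constructible in time polynomial in `‖K‖₊`,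
including output size: one fixed program, run on any repetition-free listing of `K`, halts with a
description of the grammar, and running time and output size are at most
`c * (max 1 ‖K‖₊) ^ k` with constants `c`, `k` independent of `K`. -/
def PolyConstructible {α ν : Type*} {s : ℕ} (eα : α ≃ Fin s) (encν : ν → Val)
    (G : Finset (List α) → Grammar α ν) : Prop :=
  ∃ (p : Prog) (c k : ℕ), ∀ (K : Finset (List α)) (l : List (List α)),
    l.Nodup → (∀ w, w ∈ l ↔ w ∈ K) →
    ∃ (v : Val) (n : ℕ), Eval [encSample eα l] p v n ∧
      Describes eα encν v (G K) ∧
      n ≤ c * (max 1 (sampleSize K)) ^ k ∧ v.size ≤ c * (max 1 (sampleSize K)) ^ k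

end TupleLearner

/-! ### Polynomial-time functions on tree encodings. -/

namespace TupleLearner

/-! ## Encodings of data types -/

/-! The nonterminals and rules of the learner grammar are words of `K` with marked factors. A
context `E` with `E[x] = w` is the word `w` with `d` consecutive, possibly empty, named factors
marked in it. A binary rule is `w` with two levels of marks: the outer marks are the components of
`z`, and the inner marks inside them are the occurrences of the variables `x^i` and `y^j`. Such a
word determines `E`, the template, both child tuples and all types. Conversely, erasing the outer
marks and the marks of the `y^j` leaves a context for `x` around the same word `w`. Because `h` is a
homomorphism, the type of this context is the transported interface `τ_B`; `τ_C` arises in the same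
way. So the children are observed automatically, and enumerating two-level marked words enumerates
exactly the binary rules (`rawBinary_mark`, `isRawBinary_of_rule`, `exists_rule_of_isRawBinary`).
One-level words give the nonterminals and the terminal rules, and pairs of them with a common
context give the substitution rules (`observed_iff`, `term_iff`, `unit_iff`).

Counting. A mark is given by two cuts, each with at most `|w| + 1` positions (`length_annot_le`).
Hence `d ≤ f` marks contribute the exponent `2f`, a pair of marked words `4f`, and a binary rule
`2(e + dB + dC) ≤ 6f`. The number of possible orders of names depends only on `f`, while letters and
monoid values are determined by the marked word, so the constant depends neither on the alphabet nor
on `M`. Since `a^k + b^k ≤ (a + b)^k`, summing over the words of `K` costs no further factor.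

Computation. The class `Poly` is closed under composition, case distinction, loops with bounded
accumulator, equality tests and finite tables. For fixed `f` the enumeration is a nest of loops of
fixed depth. Duplicates are removed by comparing encodings, which is legitimate because encodings
are injective on well-formed rules (`encRule_injOn`, `exists_nodup_preimage`). For unit elimination,
Warshall's algorithm computes the chains of unit rules, and the left-hand sides of the terminal and
binary rules are replaced along them. The language is unchanged because a unit step can be absorbed
into the next non-unit rule below it (`language_unitElim`). -/

/-- A type with a fixed encoding of its elements as binary trees. -/
class Enc (A : Type*) where
  enc : A → Val

open Enc (enc)

/-- The encoding is injective. -/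
class LawfulEnc (A : Type*) [Enc A] : Prop where
  inj : Function.Injective (enc : A → Val)

instance : Enc Val := ⟨id⟩
instance : Enc Bool := ⟨fun b => if b then .cons .nil .nil else .nil⟩
instance : Enc ℕ := ⟨encNat⟩
instance (n : ℕ) : Enc (Fin n) := ⟨fun i => encNat i⟩
instance {A : Type*} [Enc A] : Enc (List A) := ⟨encList enc⟩
instance {A B : Type*} [Enc A] [Enc B] : Enc (A × B) := ⟨fun p => .cons (enc p.1) (enc p.2)⟩
instance {A B : Type*} [Enc A] [Enc B] : Enc (A ⊕ B) :=
  ⟨Sum.elim (fun a => .cons .nil (enc a)) (fun b => .cons (.cons .nil .nil) (enc b))⟩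

@[simp] theorem enc_val (v : Val) : enc v = v := rfl
@[simp] theorem enc_true : enc true = Val.cons .nil .nil := rfl
@[simp] theorem enc_false : enc false = Val.nil := rfl
@[simp] theorem enc_listNil {A : Type*} [Enc A] : enc ([] : List A) = Val.nil := rfl
@[simp] theorem enc_listCons {A : Type*} [Enc A] (a : A) (l : List A) :
    enc (a :: l) = Val.cons (enc a) (enc l) := rfl
@[simp] theorem enc_pair {A B : Type*} [Enc A] [Enc B] (a : A) (b : B) :
    enc (a, b) = Val.cons (enc a) (enc b) := rfl
@[simp] theorem enc_inl {A B : Type*} [Enc A] [Enc B] (a : A) :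
    enc (Sum.inl a : A ⊕ B) = Val.cons .nil (enc a) := rfl
@[simp] theorem enc_inr {A B : Type*} [Enc A] [Enc B] (b : B) :
    enc (Sum.inr b : A ⊕ B) = Val.cons (.cons .nil .nil) (enc b) := rfl

theorem encNat_injective : Function.Injective encNat := by
  intro m
  induction m with
  | zero => intro n h; cases n <;> simp_all [encNat]
  | succ m ih =>
    intro n h
    cases n with
    | zero => simp [encNat] at h
    | succ n => simp only [encNat, Val.cons.injEq, true_and] at h; rw [ih h]

theorem encList_injective {β : Type*} {e : β → Val} (he : Function.Injective e) :
    Function.Injective (encList e) := by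
  intro l
  induction l with
  | nil => intro l' h; cases l' <;> simp_all [encList]
  | cons a l ih =>
    intro l' h
    cases l' with
    | nil => simp [encList] at h
    | cons b l' =>
      simp only [encList, Val.cons.injEq] at h
      rw [he h.1, ih h.2]

instance : LawfulEnc Val := ⟨fun _ _ h => h⟩
instance : LawfulEnc ℕ := ⟨encNat_injective⟩
instance (n : ℕ) : LawfulEnc (Fin n) := ⟨fun _ _ h => Fin.ext (encNat_injective h)⟩
instance {A : Type*} [Enc A] [LawfulEnc A] : LawfulEnc (List A) :=
  ⟨encList_injective LawfulEnc.inj⟩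
instance {A B : Type*} [Enc A] [Enc B] [LawfulEnc A] [LawfulEnc B] : LawfulEnc (A × B) :=
  ⟨by
    rintro ⟨a, b⟩ ⟨a', b'⟩ h
    simp only [enc_pair, Val.cons.injEq] at h
    rw [LawfulEnc.inj h.1, LawfulEnc.inj h.2]⟩
instance {A B : Type*} [Enc A] [Enc B] [LawfulEnc A] [LawfulEnc B] : LawfulEnc (A ⊕ B) :=
  ⟨by
    rintro (a | a) (b | b) h
    · simp only [enc_inl, Val.cons.injEq, true_and] at h
      rw [LawfulEnc.inj h]
    · simp at h
    · simp at h
    · simp only [enc_inr, Val.cons.injEq, true_and] at h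
      rw [LawfulEnc.inj h]⟩

/-! ## Sizes -/

theorem Val.size_pos (v : Val) : 1 ≤ v.size := by
  cases v <;> simp [Val.size]; omega

theorem length_le_size {A : Type*} [Enc A] (l : List A) : l.length + 1 ≤ (enc l).size := by
  induction l with
  | nil => simp [Val.size]
  | cons a l ih => simp only [List.length_cons, enc_listCons, Val.size]; omega

theorem size_le_of_mem {A : Type*} [Enc A] {a : A} {l : List A} (h : a ∈ l) :
    (enc a).size ≤ (enc l).size := by
  induction l with
  | nil => simp at h
  | cons b l ih =>
    simp only [enc_listCons, Val.size]
    rcases List.mem_cons.1 h with rfl | h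
    · omega
    · have := ih h; omega

theorem size_append {A : Type*} [Enc A] (l l' : List A) :
    (enc (l ++ l')).size + 1 = (enc l).size + (enc l').size := by
  induction l with
  | nil => simp [Val.size]; omega
  | cons a l ih => simp only [List.cons_append, enc_listCons, Val.size]; omega

theorem size_reverse {A : Type*} [Enc A] (l : List A) :
    (enc l.reverse).size = (enc l).size := by
  induction l with
  | nil => simp
  | cons a l ih =>
    have := size_append l.reverse [a]
    simp only [List.reverse_cons, enc_listCons, enc_listNil, Val.size] at *
    omega

theorem size_le_of_prefix {A : Type*} [Enc A] {l l' : List A} (h : l' <+: l) :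
    (enc l').size ≤ (enc l).size := by
  obtain ⟨t, rfl⟩ := h
  have := size_append l' t
  have := Val.size_pos (enc t)
  omega

theorem size_le_of_suffix {A : Type*} [Enc A] {l l' : List A} (h : l' <:+ l) :
    (enc l').size ≤ (enc l).size := by
  obtain ⟨t, rfl⟩ := h
  have := size_append t l'
  have := Val.size_pos (enc t)
  omega

theorem size_flatMap_le {A B : Type*} [Enc B] (l : List A) (F : A → List B) (k : ℕ)
    (h : ∀ a ∈ l, (enc (F a)).size ≤ k) : (enc (l.flatMap F)).size ≤ l.length * k + 1 := by
  induction l with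
  | nil => simp [Val.size]
  | cons a l ih =>
    have h1 := ih fun b hb => h b (List.mem_cons_of_mem _ hb)
    have h2 := h a List.mem_cons_self
    have h3 := size_append (F a) (l.flatMap F)
    simp only [List.flatMap_cons, List.length_cons, Nat.add_mul, one_mul]
    omega

theorem size_list_le {A : Type*} [Enc A] (l : List A) (k : ℕ)
    (h : ∀ a ∈ l, (enc a).size ≤ k) : (enc l).size ≤ l.length * (k + 1) + 1 := by
  induction l with
  | nil => simp [Val.size]
  | cons a l ih =>
    have h1 := ih fun b hb => h b (List.mem_cons_of_mem _ hb)
    have h2 := h a List.mem_cons_self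
    simp only [enc_listCons, Val.size, List.length_cons, Nat.add_mul, one_mul] at *
    omega

/-- The coefficients are natural numbers, so every monomial is monotone. This is what allows size
bounds to be substituted into one another. -/
theorem eval_mono (P : Polynomial ℕ) {x y : ℕ} (h : x ≤ y) : P.eval x ≤ P.eval y := by
  rw [Polynomial.eval_eq_sum_range, Polynomial.eval_eq_sum_range]
  gcongr

/-- With the argument displayed as a cons cell, the result is a plain variable, and evaluations of
concrete programs can be written as terms whose values are found by unification. -/
theorem Eval.hd_cons {ρ : List Val} {p : Prog} {u v : Val} {n : ℕ} (h : Eval ρ p (.cons u v) n) :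
    Eval ρ (.hd p) u (n + 1) :=
  h.hd

theorem Eval.tl_cons {ρ : List Val} {p : Prog} {u v : Val} {n : ℕ} (h : Eval ρ p (.cons u v) n) :
    Eval ρ (.tl p) v (n + 1) :=
  h.tl

/-! ## Functions computable in polynomial time -/

/-- `F` is computed on encodings by a program whose running time and output size are bounded by
a polynomial in the size of the input. -/
def Poly {A B : Type*} [Enc A] [Enc B] (F : A → B) : Prop :=
  ∃ (p : Prog) (P : Polynomial ℕ), ∀ (a : A) (ρ : List Val), ∃ n,
    Eval (enc a :: ρ) p (enc (F a)) n ∧ n ≤ P.eval (enc a).size ∧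
      (enc (F a)).size ≤ P.eval (enc a).size

namespace Poly

variable {A B C D : Type*} [Enc A] [Enc B] [Enc C] [Enc D]

theorem mk' {F : A → B} (p : Prog) (P Q : Polynomial ℕ)
    (h : ∀ (a : A) (ρ : List Val), ∃ n, Eval (enc a :: ρ) p (enc (F a)) n ∧
      n ≤ P.eval (enc a).size ∧ (enc (F a)).size ≤ Q.eval (enc a).size) : Poly F := by
  refine ⟨p, P + Q, fun a ρ => ?_⟩
  obtain ⟨n, h1, h2, h3⟩ := h a ρ
  refine ⟨n, h1, ?_, ?_⟩ <;> rw [Polynomial.eval_add] <;> omega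

theorem size_bound {F : A → B} (h : Poly F) :
    ∃ P : Polynomial ℕ, ∀ a, (enc (F a)).size ≤ P.eval (enc a).size := by
  obtain ⟨p, P, h⟩ := h
  exact ⟨P, fun a => (h a []).choose_spec.2.2⟩

/-- A function that does not change the encoding. -/
theorem recode {F : A → B} (h : ∀ a, enc (F a) = enc a) : Poly F :=
  mk' (.var 0) 1 Polynomial.X fun a ρ => by
    rw [h]
    exact ⟨1, .var rfl, by simp, by simp⟩

theorem id : Poly (fun a : A => a) := recode fun _ => rfl

theorem congr {F G : A → B} (h : Poly F) (e : ∀ a, F a = G a) : Poly G := by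
  rwa [← funext e]

/-- Composition is the reason why `Poly` controls output size as well as time: cells may be shared,
so a short run can produce a tree of exponential size on which the next program would be slow. -/
theorem comp {G : B → C} {F : A → B} (hG : Poly G) (hF : Poly F) : Poly (fun a => G (F a)) := by
  obtain ⟨p, P, hp⟩ := hG
  obtain ⟨q, Q, hq⟩ := hF
  refine mk' (.letIn q p) (Q + P.comp Q + 1) (P.comp Q) fun a ρ => ?_
  obtain ⟨n, h1, h2, h3⟩ := hq a ρ
  obtain ⟨m, g1, g2, g3⟩ := hp (F a) (enc a :: ρ)
  have := eval_mono P h3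
  refine ⟨_, .letIn h1 g1, ?_, ?_⟩
  · simp only [Polynomial.eval_add, Polynomial.eval_comp, Polynomial.eval_one]
    omega
  · simp only [Polynomial.eval_comp]
    omega

theorem exists_const_prog (v : Val) : ∃ p n, ∀ ρ, Eval ρ p v n := by
  induction v with
  | nil => exact ⟨.nil, 1, fun ρ => .nil⟩
  | cons a b iha ihb =>
    obtain ⟨p, m, hp⟩ := iha
    obtain ⟨q, n, hq⟩ := ihb
    exact ⟨.cons p q, _, fun ρ => .cons (hp ρ) (hq ρ)⟩

theorem const (b : B) : Poly (fun _ : A => b) := by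
  obtain ⟨p, n, hp⟩ := exists_const_prog (enc b)
  exact mk' p (Polynomial.C n) (Polynomial.C (enc b).size) fun a ρ =>
    ⟨n, hp _, by simp, by simp⟩

/-- The constructor `Val.cons` on encodings. -/
theorem consEnc {F : A → B} {G : A → C} {H : A → D} (hF : Poly F) (hG : Poly G)
    (h : ∀ a, enc (H a) = .cons (enc (F a)) (enc (G a))) : Poly H := by
  obtain ⟨p, P, hp⟩ := hF
  obtain ⟨q, Q, hq⟩ := hG
  refine ⟨.cons p q, P + Q + 1, fun a ρ => ?_⟩
  obtain ⟨n, h1, h2, h3⟩ := hp a ρ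
  obtain ⟨m, g1, g2, g3⟩ := hq a ρ
  rw [h]
  refine ⟨_, .cons h1 g1, ?_, ?_⟩ <;>
    simp only [Polynomial.eval_add, Polynomial.eval_one, Val.size] <;> omega

theorem pair {F : A → B} {G : A → C} (hF : Poly F) (hG : Poly G) : Poly (fun a => (F a, G a)) :=
  consEnc hF hG fun _ => rfl

theorem cons {F : A → B} {G : A → List B} (hF : Poly F) (hG : Poly G) :
    Poly (fun a => F a :: G a) :=
  consEnc hF hG fun _ => rfl

theorem valCons {F G : A → Val} (hF : Poly F) (hG : Poly G) :
    Poly (fun a => Val.cons (F a) (G a)) :=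
  consEnc hF hG fun _ => rfl

theorem hdEnc {F : A → B} {G : A → C} (hF : Poly F) (h : ∀ a, enc (G a) = (enc (F a)).hd) :
    Poly G := by
  obtain ⟨p, P, hp⟩ := hF
  refine ⟨.hd p, P + 1, fun a ρ => ?_⟩
  obtain ⟨n, h1, h2, h3⟩ := hp a ρ
  rw [h]
  refine ⟨_, .hd h1, ?_, ?_⟩ <;> simp only [Polynomial.eval_add, Polynomial.eval_one]
  · omega
  · cases h' : enc (F a) <;> simp only [h', Val.hd, Val.size] at * <;> omega

theorem tlEnc {F : A → B} {G : A → C} (hF : Poly F) (h : ∀ a, enc (G a) = (enc (F a)).tl) :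
    Poly G := by
  obtain ⟨p, P, hp⟩ := hF
  refine ⟨.tl p, P + 1, fun a ρ => ?_⟩
  obtain ⟨n, h1, h2, h3⟩ := hp a ρ
  rw [h]
  refine ⟨_, .tl h1, ?_, ?_⟩ <;> simp only [Polynomial.eval_add, Polynomial.eval_one]
  · omega
  · cases h' : enc (F a) <;> simp only [h', Val.tl, Val.size] at * <;> omega

theorem fst {F : A → B × C} (hF : Poly F) : Poly (fun a => (F a).1) := hdEnc hF fun _ => rfl

theorem snd {F : A → B × C} (hF : Poly F) : Poly (fun a => (F a).2) := tlEnc hF fun _ => rfl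

theorem tail {F : A → List B} (hF : Poly F) : Poly (fun a => (F a).tail) :=
  tlEnc hF fun a => by cases F a <;> rfl

/-- Branching on the encoding of `c a` being `nil`. -/
theorem branch {c : A → B} {F G H : A → C} (hc : Poly c) (hF : Poly F) (hG : Poly G)
    (h1 : ∀ a, enc (c a) ≠ .nil → H a = F a) (h2 : ∀ a, enc (c a) = .nil → H a = G a) :
    Poly H := by
  obtain ⟨r, R, hr⟩ := hc
  obtain ⟨p, P, hp⟩ := hF
  obtain ⟨q, Q, hq⟩ := hG
  refine ⟨.ite r p q, R + P + Q + 1, fun a ρ => ?_⟩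
  obtain ⟨k, i1, i2, i3⟩ := hr a ρ
  simp only [Polynomial.eval_add, Polynomial.eval_one]
  by_cases hnil : enc (c a) = .nil
  · obtain ⟨m, g1, g2, g3⟩ := hq a ρ
    rw [hnil] at i1
    rw [h2 a hnil]
    exact ⟨_, .ite_false i1 g1, by omega, by omega⟩
  · obtain ⟨n, f1, f2, f3⟩ := hp a ρ
    rw [h1 a hnil]
    exact ⟨_, .ite_true i1 hnil f1, by omega, by omega⟩

theorem ite {P : A → Prop} {_ : ∀ a, Decidable (P a)} {F G : A → B}
    (hP : Poly (fun a => decide (P a))) (hF : Poly F) (hG : Poly G) :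
    Poly (fun a => if P a then F a else G a) :=
  branch hP hF hG (fun a h => if_pos (by by_contra hn; simp [hn] at h))
    (fun a h => if_neg (by intro hn; simp [hn] at h))

theorem and {P Q : A → Prop} {_ : ∀ a, Decidable (P a)} {_ : ∀ a, Decidable (Q a)}
    {_ : ∀ a, Decidable (P a ∧ Q a)}
    (hP : Poly (fun a => decide (P a))) (hQ : Poly (fun a => decide (Q a))) :
    Poly (fun a => decide (P a ∧ Q a)) :=
  (hP.ite hQ (const false)).congr fun a => by by_cases h : P a <;> simp [h]

theorem or {P Q : A → Prop} {_ : ∀ a, Decidable (P a)} {_ : ∀ a, Decidable (Q a)}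
    {_ : ∀ a, Decidable (P a ∨ Q a)}
    (hP : Poly (fun a => decide (P a))) (hQ : Poly (fun a => decide (Q a))) :
    Poly (fun a => decide (P a ∨ Q a)) :=
  (hP.ite (const true) hQ).congr fun a => by by_cases h : P a <;> simp [h]

theorem inl {F : A → B} (hF : Poly F) : Poly (fun a => (Sum.inl (F a) : B ⊕ C)) :=
  consEnc (const Val.nil) hF fun _ => rfl

theorem inr {F : A → C} (hF : Poly F) : Poly (fun a => (Sum.inr (F a) : B ⊕ C)) :=
  consEnc (const (Val.cons .nil .nil)) hF fun _ => rfl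

/-- Case distinction on a sum, with a parameter. -/
theorem sumElim {E : A → B ⊕ C} {F : A → B → D} {G : A → C → D} (hE : Poly E)
    (hF : Poly (fun p : A × B => F p.1 p.2)) (hG : Poly (fun p : A × C => G p.1 p.2)) :
    Poly (fun a => Sum.elim (F a) (G a) (E a)) := by
  obtain ⟨r, R, hr⟩ := hE
  obtain ⟨p, P, hp⟩ := hF
  obtain ⟨q, Q, hq⟩ := hG
  -- The tag of `E a` is tested, and the pair of `a` with the untagged value becomes the input of
  -- `p` or `q`. Its size is at most `1 + X + R`: one node, `a`, and a part of `E a`.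
  refine mk' (.letIn (.cons (.var 0) r) (.ite (.hd (.tl (.var 0)))
    (.letIn (.cons (.hd (.var 0)) (.tl (.tl (.var 0)))) q)
    (.letIn (.cons (.hd (.var 0)) (.tl (.tl (.var 0)))) p)))
    (P.comp (1 + Polynomial.X + R) + Q.comp (1 + Polynomial.X + R) + R + 20)
    (P.comp (1 + Polynomial.X + R) + Q.comp (1 + Polynomial.X + R)) fun a ρ => ?_
  obtain ⟨n, h1, h2, h3⟩ := hr a ρ
  simp only [Polynomial.eval_add, Polynomial.eval_comp, Polynomial.eval_one, Polynomial.eval_X,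
    Polynomial.eval_ofNat]
  cases hEa : E a with
  | inl b =>
    rw [hEa, enc_inl] at h1 h3
    have hs : (enc (a, b)).size ≤ 1 + (enc a).size + R.eval (enc a).size := by
      simp only [enc_pair, Val.size] at h3 ⊢; omega
    obtain ⟨m, g1, g2, g3⟩ := hp (a, b)
      (.cons (enc a) (.cons .nil (enc b)) :: enc a :: ρ)
    have := eval_mono P hs
    refine ⟨_, .letIn (.cons (.var rfl) h1) (.ite_false (.hd_cons (.tl_cons (.var rfl)))
      (.letIn (.cons (.hd_cons (.var rfl)) (.tl_cons (.tl_cons (.var rfl)))) g1)), ?_, ?_⟩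
    · omega
    · simp only [Sum.elim_inl] at g3 ⊢; omega
  | inr b =>
    rw [hEa, enc_inr] at h1 h3
    have hs : (enc (a, b)).size ≤ 1 + (enc a).size + R.eval (enc a).size := by
      simp only [enc_pair, Val.size] at h3 ⊢; omega
    obtain ⟨m, g1, g2, g3⟩ := hq (a, b)
      (.cons (enc a) (.cons (.cons .nil .nil) (enc b)) :: enc a :: ρ)
    have := eval_mono Q hs
    refine ⟨_, .letIn (.cons (.var rfl) h1) (.ite_true (.hd_cons (.tl_cons (.var rfl)))
      (by simp)
      (.letIn (.cons (.hd_cons (.var rfl)) (.tl_cons (.tl_cons (.var rfl)))) g1)), ?_, ?_⟩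
    · omega
    · simp only [Sum.elim_inr] at g3 ⊢; omega

end Poly

/-! ## Loops -/

/-- Each of the `T` rounds costs its body plus one step, and the final test costs one more. -/
theorem exists_eval_iter (b : Prog) (T k : ℕ) (ρ : List Val) (st : ℕ → Val)
    (hstep : ∀ i < T, (st i).hd ≠ .nil ∧ ∃ n ≤ k, Eval (st i :: ρ) b (st (i + 1)) n)
    (hend : (st T).hd = .nil) :
    ∃ n ≤ T * (k + 1) + 1, Eval (st 0 :: ρ) (.iter b) (st T).tl n := by
  induction T generalizing st with
  | zero => exact ⟨1, by omega, Eval.iter_stop hend⟩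
  | succ T ih =>
    obtain ⟨h1, m, hm, h2⟩ := hstep 0 (by omega)
    obtain ⟨n, hn, h3⟩ := ih (fun i => st (i + 1)) (fun i hi => hstep (i + 1) (by omega)) hend
    refine ⟨m + n + 1, ?_, .iter_step h1 h2 h3⟩
    rw [Nat.add_mul]
    omega

namespace Poly

variable {A B C D : Type*} [Enc A] [Enc B] [Enc C] [Enc D]

/-- Iteration over a list, provided that the accumulator stays polynomially bounded. -/
theorem foldl {L : C → List A} {b : C → B} {step : C → B → A → B}
    (hstep : Poly (fun q : (C × B) × A => step q.1.1 q.1.2 q.2)) (hL : Poly L) (hb : Poly b)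
    (Q : Polynomial ℕ) (hQ : ∀ c l, l <+: L c →
      (enc (l.foldl (step c) (b c))).size ≤ Q.eval (enc c).size) :
    Poly (fun c => (L c).foldl (step c) (b c)) := by
  obtain ⟨p, P, hp⟩ := hstep
  obtain ⟨pl, PL, hpl⟩ := hL
  obtain ⟨pb, Pb, hpb⟩ := hb
  -- The state consists of the remaining list, the parameter `c` and the accumulator. An empty
  -- remaining list is encoded by `nil`, which is exactly the stopping condition of `iter`.
  let body : Prog := .cons (.tl (.hd (.var 0))) (.cons (.hd (.tl (.var 0)))
    (.letIn (.cons (.tl (.var 0)) (.hd (.hd (.var 0)))) p))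
  refine mk' (.letIn (.cons pl (.cons (.var 0) pb)) (.tl (.iter body)))
    -- The input `((c, acc), a)` of one step has two pairing nodes, the parameter, an accumulator
    -- bounded by `Q`, and an element of a list bounded by `PL`; the number of rounds is also at
    -- most `PL`.
    (PL + Pb + PL * (P.comp (2 + Polynomial.X + Q + PL) + 21) + 20) Q fun c ρ => ?_
  simp only [Polynomial.eval_add, Polynomial.eval_mul, Polynomial.eval_comp, Polynomial.eval_X,
    Polynomial.eval_ofNat]
  obtain ⟨m, l1, l2, l3⟩ := hpl c ρ
  obtain ⟨k, b1, b2, b3⟩ := hpb c ρ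
  let st : ℕ → Val := fun i => .cons (enc ((L c).drop i))
    (.cons (enc c) (enc (((L c).take i).foldl (step c) (b c))))
  obtain ⟨n, hn, hev⟩ := exists_eval_iter body (L c).length
    (P.eval (2 + (enc c).size + Q.eval (enc c).size + PL.eval (enc c).size) + 20) (enc c :: ρ) st
    (fun i hi => by
      have hd : (L c).drop i = (L c)[i] :: (L c).drop (i + 1) := List.drop_eq_getElem_cons hi
      have ht : (L c).take (i + 1) = (L c).take i ++ [(L c)[i]] :=
        (List.take_append_getElem hi).symm
      have e0 : st i = .cons (.cons (enc (L c)[i]) (enc ((L c).drop (i + 1))))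
          (.cons (enc c) (enc (((L c).take i).foldl (step c) (b c)))) := by
        simp only [st]
        rw [hd, enc_listCons]
      refine ⟨by rw [e0]; exact nofun, ?_⟩
      obtain ⟨n, h1, h2, h3⟩ := hp ((c, ((L c).take i).foldl (step c) (b c)), (L c)[i])
        (st i :: enc c :: ρ)
      have hs : (enc ((c, ((L c).take i).foldl (step c) (b c)), (L c)[i])).size ≤
          2 + (enc c).size + Q.eval (enc c).size + PL.eval (enc c).size := by
        have e1 := hQ c _ (List.take_prefix i (L c))
        have e2 := size_le_of_mem (List.getElem_mem hi)
        simp only [enc_pair, Val.size]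
        omega
      have := eval_mono P hs
      have hst : st (i + 1) = .cons (enc ((L c).drop (i + 1))) (.cons (enc c)
          (enc (step c (((L c).take i).foldl (step c) (b c)) (L c)[i]))) := by
        simp only [st, ht, List.foldl_append, List.foldl_cons, List.foldl_nil]
      rw [hst]
      rw [e0] at h1 ⊢
      refine ⟨_, ?_, .cons (.tl_cons (.hd_cons (.var rfl))) (.cons (.hd_cons (.tl_cons (.var rfl)))
        (.letIn (.cons (.tl_cons (.var rfl)) (.hd_cons (.hd_cons (.var rfl)))) h1))⟩
      omega)
    (by simp [st, Val.hd])
  have hst0 : st 0 = .cons (enc (L c)) (.cons (enc c) (enc (b c))) := by simp [st]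
  have hstT : (st (L c).length).tl.tl = enc ((L c).foldl (step c) (b c)) := by
    simp [st, Val.tl]
  rw [hst0] at hev
  have hall : Eval (enc c :: ρ) (.letIn (.cons pl (.cons (.var 0) pb)) (.tl (.iter body))) _ _ :=
    .letIn (.cons l1 (.cons (.var rfl) b1)) (.tl hev)
  rw [hstT] at hall
  refine ⟨_, hall, ?_, hQ c _ List.prefix_rfl⟩
  have hlen := length_le_size (L c)
  have : (L c).length * (P.eval (2 + (enc c).size + Q.eval (enc c).size + PL.eval (enc c).size) + 20 + 1) ≤
      PL.eval (enc c).size *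
        (P.eval (2 + (enc c).size + Q.eval (enc c).size + PL.eval (enc c).size) + 21) :=
    Nat.mul_le_mul (by omega) le_rfl
  have := hn.trans (Nat.add_le_add_right this 1)
  omega

theorem reverse {L : C → List A} (hL : Poly L) : Poly (fun c => (L c).reverse) := by
  obtain ⟨PL, hPL⟩ := hL.size_bound
  refine (foldl (b := fun _ => ([] : List A)) (step := fun _ acc a => a :: acc)
    (cons (snd id) (snd (fst id))) hL (const []) PL fun c l hl => ?_).congr fun c => by simp
  have := hPL c
  have := size_le_of_prefix hl
  simp only [List.foldl_flip_cons_eq_append, List.append_nil, List.map_id_fun', _root_.id, size_reverse] at *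
  omega

theorem append {L L' : C → List A} (hL : Poly L) (hL' : Poly L') :
    Poly (fun c => L c ++ L' c) := by
  obtain ⟨P, hP⟩ := hL.size_bound
  obtain ⟨P', hP'⟩ := hL'.size_bound
  refine (foldl (b := L') (step := fun _ acc a => a :: acc)
    (cons (snd id) (snd (fst id))) hL.reverse hL' (P + P') fun c l hl => ?_).congr
      fun c => by simp
  have h1 := hP c
  have h2 := hP' c
  have h3 := size_le_of_prefix hl
  have h4 := size_append l.reverse (L' c)
  have h5 := size_reverse l
  have h6 := size_reverse (L c)
  simp only [List.foldl_flip_cons_eq_append, List.map_id_fun', _root_.id, Polynomial.eval_add] at *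
  omega

theorem foldr {L : C → List A} {b : C → B} {step : C → A → B → B}
    (hstep : Poly (fun q : (C × A) × B => step q.1.1 q.1.2 q.2)) (hL : Poly L) (hb : Poly b)
    (Q : Polynomial ℕ) (hQ : ∀ c l, l <:+ L c →
      (enc (l.foldr (step c) (b c))).size ≤ Q.eval (enc c).size) :
    Poly (fun c => (L c).foldr (step c) (b c)) := by
  refine (foldl (b := b) (step := fun c acc a => step c a acc)
    (hstep.comp (((fst (fst id)).pair (snd id)).pair (snd (fst id)))) hL.reverse hb Q
      fun c l hl => ?_).congr fun c => by simp
  have := hQ c l.reverse (by rwa [← List.reverse_prefix, List.reverse_reverse])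
  simpa using this

theorem flatMap {L : C → List A} {F : C → A → List B} (hL : Poly L)
    (hF : Poly (fun q : C × A => F q.1 q.2)) : Poly (fun c => (L c).flatMap (F c)) := by
  obtain ⟨P, hP⟩ := hL.size_bound
  obtain ⟨Q, hQ⟩ := hF.size_bound
  have key : ∀ c (l : List A) (acc : List B),
      l.foldl (fun acc a => acc ++ F c a) acc = acc ++ l.flatMap (F c) := by
    intro c l
    induction l with
    | nil => simp
    | cons a l ih => intro acc; simp [ih]
  refine (foldl (b := fun _ => ([] : List B)) (step := fun c acc a => acc ++ F c a)
    ((snd (fst id)).append (hF.comp ((fst (fst id)).pair (snd id)))) hL (const [])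
    (P * Q.comp (1 + Polynomial.X + P) + 1) fun c l hl => ?_).congr fun c => by simp [key]
  rw [key, List.nil_append]
  simp only [Polynomial.eval_add, Polynomial.eval_mul, Polynomial.eval_comp, Polynomial.eval_X,
    Polynomial.eval_one]
  refine (size_flatMap_le l (F c) _ fun a ha => (hQ (c, a)).trans (eval_mono Q ?_)).trans
    (Nat.add_le_add_right (Nat.mul_le_mul ?_ le_rfl) 1)
  · have h1 := size_le_of_mem (hl.subset ha)
    have h2 := hP c
    simp only [enc_pair, Val.size]
    omega
  · have h1 := length_le_size (L c)
    have h2 := hP c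
    have h3 := hl.length_le
    omega

theorem map {L : C → List A} {F : C → A → B} (hL : Poly L)
    (hF : Poly (fun q : C × A => F q.1 q.2)) : Poly (fun c => (L c).map (F c)) :=
  (flatMap (F := fun c a => [F c a]) hL (cons hF (const []))).congr fun _ =>
    List.map_eq_flatMap.symm

theorem filter {L : C → List A} {p : C → A → Prop} {_ : ∀ c a, Decidable (p c a)} (hL : Poly L)
    (hp : Poly (fun q : C × A => decide (p q.1 q.2))) :
    Poly (fun c => (L c).filter (fun a => decide (p c a))) :=
  (flatMap (F := fun c a => if p c a then [a] else []) hL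
    (ite hp (cons (snd id) (const [])) (const []))).congr fun c => by
      induction L c with
      | nil => rfl
      | cons a l ih => by_cases h : p c a <;> simp [h, ih]

/-- A finite union over a list of constants. -/
theorem flatMap_const {ι : Type*} (l : List ι) {F : ι → C → List A} (h : ∀ i ∈ l, Poly (F i)) :
    Poly (fun c => l.flatMap fun i => F i c) := by
  induction l with
  | nil => exact const []
  | cons i l ih =>
    exact (append (h i List.mem_cons_self)
      (ih fun j hj => h j (List.mem_cons_of_mem _ hj))).congr fun c => by simp

theorem ofFn {d : ℕ} {F : Fin d → C → A} (h : ∀ i, Poly (F i)) :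
    Poly (fun c => List.ofFn fun i => F i c) := by
  induction d with
  | zero => exact (const []).congr fun c => by simp
  | succ d ih =>
    exact (cons (h 0) (ih fun i => h i.succ)).congr fun c => by simp [List.ofFn_succ]

/-! ### Equality -/

/-- One step of the comparison of two trees, working on a stack of pairs still to be compared. -/
def eqBody : Prog :=
  .ite (.hd (.hd (.hd (.var 0))))
    (.ite (.tl (.hd (.hd (.var 0))))
      (.cons (.cons (.cons (.hd (.hd (.hd (.hd (.var 0))))) (.hd (.tl (.hd (.hd (.var 0))))))
        (.cons (.cons (.tl (.hd (.hd (.hd (.var 0))))) (.tl (.tl (.hd (.hd (.var 0))))))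
          (.tl (.hd (.var 0))))) (.tl (.var 0)))
      (.cons .nil .nil))
    (.ite (.tl (.hd (.hd (.var 0))))
      (.cons .nil .nil)
      (.cons (.tl (.hd (.var 0))) (.tl (.var 0))))

/-- The total size of the left components on the stack decreases in every successful round: two
`nil`s are popped, and two cons cells are replaced by the pairs of their children. A mismatch moves
to the state with empty stack and answer `false`. -/
theorem eval_eqBody (N : ℕ) (stack : List (Val × Val))
    (hN : (stack.map fun p => p.1.size).sum ≤ N) (ρ : List Val) :
    ∃ b : Bool, (b = true ↔ ∀ p ∈ stack, p.1 = p.2) ∧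
      ∃ n ≤ 60 * N + 60, Eval (enc (stack, true) :: ρ) (.iter eqBody) (enc b) n := by
  induction N generalizing stack with
  | zero =>
    cases stack with
    | nil => exact ⟨true, by simp, 1, by omega, Eval.iter_stop rfl⟩
    | cons p l =>
      have := p.1.size_pos
      simp at hN
      omega
  | succ N ih =>
    have fail : ∀ ρ : List Val,
        Eval (enc (([] : List (Val × Val)), false) :: ρ) (.iter eqBody) (enc false) 1 :=
      fun ρ => Eval.iter_stop rfl
    cases stack with
    | nil => exact ⟨true, by simp, 1, by omega, Eval.iter_stop rfl⟩
    | cons p l =>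
      obtain ⟨u, v⟩ := p
      cases u with
      | nil =>
        cases v with
        | nil =>
          obtain ⟨b, hb, n, hn, hev⟩ := ih l (by simp [Val.size] at hN ⊢; omega)
          refine ⟨b, by simp [hb], _, ?_, .iter_step (by simp [Val.hd]) (.ite_false
            (.hd_cons (.hd_cons (.hd_cons (.var rfl)))) (.ite_false (.tl_cons (.hd_cons (.hd_cons (.var rfl))))
            (.cons (.tl_cons (.hd_cons (.var rfl))) (.tl_cons (.var rfl))))) hev⟩
          omega
        | cons v1 v2 =>
          refine ⟨false, by simp, _, ?_, .iter_step (by simp [Val.hd]) (.ite_false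
            (.hd_cons (.hd_cons (.hd_cons (.var rfl)))) (.ite_true (.tl_cons (.hd_cons (.hd_cons (.var rfl))))
            (by simp) (.cons .nil .nil))) (fail ρ)⟩
          omega
      | cons u1 u2 =>
        cases v with
        | nil =>
          refine ⟨false, by simp, _, ?_, .iter_step (by simp [Val.hd]) (.ite_true
            (.hd_cons (.hd_cons (.hd_cons (.var rfl)))) (by simp)
            (.ite_false (.tl_cons (.hd_cons (.hd_cons (.var rfl)))) (.cons .nil .nil))) (fail ρ)⟩
          omega
        | cons v1 v2 =>
          obtain ⟨b, hb, n, hn, hev⟩ := ih ((u1, v1) :: (u2, v2) :: l)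
            (by simp [Val.size] at hN ⊢; omega)
          refine ⟨b, by simp [hb, and_assoc], _, ?_, .iter_step (by simp [Val.hd]) (.ite_true
            (.hd_cons (.hd_cons (.hd_cons (.var rfl)))) (by simp)
            (.ite_true (.tl_cons (.hd_cons (.hd_cons (.var rfl)))) (by simp)
            (.cons (.cons (.cons (.hd_cons (.hd_cons (.hd_cons (.hd_cons (.var rfl)))))
              (.hd_cons (.tl_cons (.hd_cons (.hd_cons (.var rfl))))))
              (.cons (.cons (.tl_cons (.hd_cons (.hd_cons (.hd_cons (.var rfl))))) (.tl_cons (.tl_cons (.hd_cons (.hd_cons (.var rfl))))))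
              (.tl_cons (.hd_cons (.var rfl))))) (.tl_cons (.var rfl))))) hev⟩
          omega

theorem eq {F G : C → A} [LawfulEnc A] {_ : ∀ c, Decidable (F c = G c)} (hF : Poly F)
    (hG : Poly G) : Poly (fun c => decide (F c = G c)) := by
  classical
  have key : Poly (fun q : A × A => decide (q.1 = q.2)) := by
    refine mk' (.letIn (.cons (.cons (.var 0) .nil) (.cons .nil .nil)) (.iter eqBody))
      (60 * Polynomial.X + 100) 3 fun q ρ => ?_
    obtain ⟨b, hb, n, hn, hev⟩ := eval_eqBody (enc q.1).size [(enc q.1, enc q.2)] (by simp)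
      (enc q :: ρ)
    have hb' : b = decide (q.1 = q.2) := by
      rw [Bool.eq_iff_iff, hb]
      simp [LawfulEnc.inj.eq_iff]
    have hall : Eval (enc q :: ρ)
        (.letIn (.cons (.cons (.var 0) .nil) (.cons .nil .nil)) (.iter eqBody)) _ _ :=
      .letIn (.cons (.cons (.var rfl) .nil) (.cons .nil .nil)) hev
    rw [hb'] at hall
    refine ⟨_, hall, ?_, ?_⟩
    · have : (enc q.1).size ≤ (enc q).size := by
        change _ ≤ (Val.cons (enc q.1) (enc q.2)).size
        simp only [Val.size]; omega
      simp only [Polynomial.eval_add, Polynomial.eval_mul, Polynomial.eval_X,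
        Polynomial.eval_ofNat]
      omega
    · cases decide (q.1 = q.2) <;> simp [Val.size]
  exact (key.comp (hF.pair hG)).congr fun c => by simp

/-- Membership is the test whether filtering by equality leaves a nonempty list, since only the
empty list is encoded by `nil`. -/
theorem mem {a : C → A} {L : C → List A} [LawfulEnc A] {_ : ∀ c, Decidable (a c ∈ L c)}
    (ha : Poly a) (hL : Poly L) : Poly (fun c => decide (a c ∈ L c)) := by
  classical
  have h : Poly (fun c => (L c).filter fun b => decide (a c = b)) :=
    filter hL (eq (ha.comp (fst id)) (snd id))
  refine (branch h (const true) (const false) (H := fun c => decide (a c ∈ L c))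
    (fun c hc => ?_) (fun c hc => ?_))
  · cases hf : (L c).filter (fun b => decide (a c = b)) with
    | nil => simp [hf] at hc
    | cons b l =>
      have : b ∈ (L c).filter fun b => decide (a c = b) := by rw [hf]; simp
      simp only [List.mem_filter, decide_eq_true_eq] at this
      simp [this.2, this.1]
  · cases hf : (L c).filter (fun b => decide (a c = b)) with
    | nil =>
      simp only [List.filter_eq_nil_iff, decide_eq_true_eq] at hf
      simp only [decide_eq_false_iff_not]
      exact fun hm => hf _ hm rfl
    | cons b l => simp [hf] at hc

/-- Deduplication is a right fold whose intermediate values are deduplicated suffixes, hence never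
larger than the input list. -/
theorem dedup {L : C → List A} [LawfulEnc A] [DecidableEq A] (hL : Poly L) :
    Poly (fun c => (L c).dedup) := by
  obtain ⟨P, hP⟩ := hL.size_bound
  have key : ∀ l : List A, l.foldr (fun a acc => if a ∈ acc then acc else a :: acc) [] =
      l.dedup := by
    intro l
    induction l with
    | nil => rfl
    | cons a l ih =>
      by_cases h : a ∈ l
      · simp [ih, h, List.dedup_cons_of_mem]
      · simp [ih, h, List.dedup_cons_of_notMem]
  refine (foldr (b := fun _ => ([] : List A))
    (step := fun _ a acc => if a ∈ acc then acc else a :: acc)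
    (ite (mem (snd (fst id)) (snd id)) (snd id) (cons (snd (fst id)) (snd id)))
    hL (const []) P fun c l hl => ?_).congr fun c => key _
  rw [key]
  refine le_trans ?_ ((size_le_of_suffix hl).trans (hP c))
  clear hl
  induction l with
  | nil => simp
  | cons a l ih =>
    by_cases h : a ∈ l
    · simp only [List.dedup_cons_of_mem h, enc_listCons, Val.size]; omega
    · simp only [List.dedup_cons_of_notMem h, enc_listCons, Val.size]; omega

/-- Every function on a finite type is computed by table lookup. -/
theorem of_finite [Finite A] [LawfulEnc A] (F : A → B) : Poly F := by
  classical
  rcases isEmpty_or_nonempty A with hA | ⟨⟨a₀⟩⟩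
  · exact mk' .nil 0 0 fun a => isEmptyElim a
  have key : ∀ l : List A, ∃ G : A → B, Poly G ∧ ∀ a ∈ l, G a = F a := by
    intro l
    induction l with
    | nil => exact ⟨_, const (F a₀), by simp⟩
    | cons b l ih =>
      obtain ⟨G, hG, hGl⟩ := ih
      refine ⟨fun a => if a = b then F b else G a, ite (eq id (const b)) (const _) hG, ?_⟩
      intro a ha
      by_cases hab : a = b
      · simp [hab]
      · simp only [hab, if_false]
        exact hGl a ((List.mem_cons.1 ha).resolve_left hab)
  obtain ⟨l, hl⟩ : ∃ l : List A, ∀ a, a ∈ l := by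
    cases nonempty_fintype A
    exact ⟨Finset.univ.toList, by simp⟩
  obtain ⟨G, hG, hGl⟩ := key l
  exact hG.congr fun a => hGl a (hl a)

theorem exists_size_le [Finite A] : ∃ k, ∀ a : A, (enc a).size ≤ k := by
  cases nonempty_fintype A
  exact ⟨Finset.univ.sup fun a : A => (enc a).size, fun a =>
    Finset.le_sup (f := fun a : A => (enc a).size) (Finset.mem_univ a)⟩

end Poly
end TupleLearner

/-! ### Annotated words: contexts as words with marked factors, and their enumeration. -/

namespace TupleLearner

/-! ## Words with marked positions -/

section Interleave

variable {A A' B B' D : Type*}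

/-- The word `b₀ g₀ b₁ ⋯ g_{d-1} b_d`. -/
def interleave {d : ℕ} (b : Fin (d + 1) → List A) (g : Fin d → B) : List (A ⊕ B) :=
  (b 0).map Sum.inl ++ (List.ofFn fun i : Fin d => Sum.inr (g i) :: (b i.succ).map Sum.inl).flatten

theorem interleave_succ {d : ℕ} (b : Fin (d + 2) → List A) (g : Fin (d + 1) → B) :
    interleave b g = (b 0).map Sum.inl ++ Sum.inr (g 0) ::
      interleave (fun i => b i.succ) (fun i => g i.succ) := by
  simp [interleave, List.ofFn_succ]

theorem filterMap_getRight_map_inl (l : List A) :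
    (l.map (Sum.inl : A → A ⊕ B)).filterMap Sum.getRight? = [] := by
  simp [List.filterMap_map]

theorem rights_interleave {d : ℕ} (b : Fin (d + 1) → List A) (g : Fin d → B) :
    (interleave b g).filterMap Sum.getRight? = List.ofFn g := by
  induction d with
  | zero => simp [interleave]
  | succ d ih => simp [interleave_succ, ih, List.ofFn_succ]

theorem exists_interleave (W : List (A ⊕ B)) {d : ℕ} (g : Fin d → B)
    (h : W.filterMap Sum.getRight? = List.ofFn g) : ∃ b, W = interleave b g := by
  induction W generalizing d with
  | nil =>
    cases d with
    | zero => exact ⟨fun _ => [], by simp [interleave]⟩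
    | succ d => simp [List.ofFn_succ] at h
  | cons q W ih =>
    cases q with
    | inl a =>
      obtain ⟨b, rfl⟩ := ih g (by simpa [List.filterMap_cons] using h)
      exact ⟨Fin.cons (a :: b 0) (Fin.tail b), by simp [interleave, Fin.tail]⟩
    | inr q =>
      cases d with
      | zero => simp at h
      | succ d =>
        simp only [List.filterMap_cons, Sum.getRight?_inr, List.ofFn_succ, List.cons.injEq] at h
        obtain ⟨b, rfl⟩ := ih _ h.2
        exact ⟨Fin.cons [] b, by simp [interleave_succ, h.1]⟩

theorem map_inl_append_inr_inj {a a' : List A} {x x' : B} {r r' : List (A ⊕ B)}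
    (h : a.map Sum.inl ++ Sum.inr x :: r = a'.map Sum.inl ++ Sum.inr x' :: r') :
    a = a' ∧ x = x' ∧ r = r' := by
  induction a generalizing a' with
  | nil => cases a' <;> simp_all
  | cons c a ih =>
    cases a' with
    | nil => simp at h
    | cons c' a' =>
      simp only [List.map_cons, List.cons_append, List.cons.injEq, Sum.inl.injEq] at h
      obtain ⟨h1, h2⟩ := ih h.2
      exact ⟨by rw [h.1, h1], h2⟩

/-- The first mark ends the first block, so a word with marks parses uniquely; induct on the number
of marks. -/
theorem interleave_injective {d : ℕ} {b b' : Fin (d + 1) → List A} {g g' : Fin d → B}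
    (h : interleave b g = interleave b' g') : b = b' ∧ g = g' := by
  refine ⟨?_, List.ofFn_injective (by rw [← rights_interleave b, h, rights_interleave])⟩
  induction d with
  | zero =>
    funext i
    rw [Fin.fin_one_eq_zero i]
    exact List.map_injective_iff.2 Sum.inl_injective (by simpa [interleave] using h)
  | succ d ih =>
    rw [interleave_succ, interleave_succ] at h
    obtain ⟨h1, -, h3⟩ := map_inl_append_inr_inj h
    have := ih h3
    funext i
    refine Fin.cases h1 (fun i => congrFun this i) i

theorem map_interleave {d : ℕ} (b : Fin (d + 1) → List A) (g : Fin d → B) (φ : A → A')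
    (ψ : B → B') : (interleave b g).map (Sum.map φ ψ) =
      interleave (fun i => (b i).map φ) (fun i => ψ (g i)) := by
  simp [interleave, List.map_flatten, Function.comp_def, List.map_ofFn]

theorem flatMap_interleave {d : ℕ} (b : Fin (d + 1) → List A) (g : Fin d → B)
    (F : A ⊕ B → List D) : (interleave b g).flatMap F =
      (b 0).flatMap (fun a => F (.inl a)) ++ (List.ofFn fun i : Fin d =>
        F (.inr (g i)) ++ (b i.succ).flatMap (fun a => F (.inl a))).flatten := by
  induction d with
  | zero => simp [interleave, List.flatMap_map]
  | succ d ih =>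
    rw [interleave_succ, List.flatMap_append, List.flatMap_cons, ih]
    simp [List.flatMap_map, List.ofFn_succ]

theorem mem_interleave {d : ℕ} (b : Fin (d + 1) → List A) (g : Fin d → B) (i : Fin d) :
    Sum.inr (g i) ∈ interleave b g := by
  refine List.mem_append_right _ (List.mem_flatten.2 ⟨_, List.mem_ofFn.2 ⟨i, rfl⟩, ?_⟩)
  exact List.mem_cons_self

theorem exists_eq_ofFn {L : List B} {d : ℕ} (h : L.length = d) :
    ∃ g : Fin d → B, L = List.ofFn g := by
  subst h
  exact ⟨L.get, (List.ofFn_get L).symm⟩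

end Interleave

/-! ## Traces -/

section Trace

variable {α M B : Type*} [Monoid M]

/-- The list of block products of a trace, in front of a list of products whose first entry
belongs to the last block. -/
def blockFold (W : List (M ⊕ B)) (s : List M) : List M :=
  W.foldr (fun q s => Sum.elim (fun m => s.modifyHead (m * ·)) (fun _ => 1 :: s) q) s

theorem blockFold_append (W W' : List (M ⊕ B)) (s : List M) :
    blockFold (W ++ W') s = blockFold W (blockFold W' s) :=
  List.foldr_append

theorem blockFold_map_inl (l : List M) (s : List M) :
    blockFold (l.map (Sum.inl : M → M ⊕ B)) s = s.modifyHead (l.prod * ·) := by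
  induction l with
  | nil => cases s <;> simp [blockFold]
  | cons m l ih =>
    change List.modifyHead (m * ·) (blockFold (l.map (Sum.inl : M → M ⊕ B)) s) = _
    rw [ih]
    cases s <;> simp [mul_assoc]

theorem blockFold_interleave {d : ℕ} (b : Fin (d + 1) → List M) (g : Fin d → B) :
    blockFold (interleave b g) [1] = List.ofFn fun i => (b i).prod := by
  induction d with
  | zero => simp [interleave, blockFold_map_inl]
  | succ d ih =>
    rw [interleave_succ, blockFold_append, List.ofFn_succ, ← ih _ fun i => g i.succ,
      blockFold_map_inl]
    change List.modifyHead _ (1 :: blockFold _ _) = _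
    simp

/-- This turns the existential `ReadsOff` into equalities of two lists computed from the trace, so
that transported interfaces can be produced by a program. -/
theorem readsOff_iff {d : ℕ} (W : List (M ⊕ Fin d)) (ι : Interface M d) :
    ReadsOff W ι ↔ W.filterMap Sum.getRight? = List.ofFn ι.1 ∧
      blockFold W [1] = List.ofFn ι.2 := by
  constructor
  · rintro ⟨β, hW, hβ⟩
    have hW' : W = interleave β ι.1 := hW
    rw [hW', rights_interleave, blockFold_interleave]
    exact ⟨rfl, congrArg List.ofFn (funext fun i => (hβ i).symm)⟩
  · rintro ⟨h1, h2⟩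
    obtain ⟨b, hb⟩ := exists_interleave W ι.1 h1
    rw [hb, blockFold_interleave] at h2
    exact ⟨b, hb, fun i => congrFun (List.ofFn_injective h2).symm i⟩

/-- Two traces with the same visible variables and the same block products. -/
def TraceEq (W W' : List (M ⊕ B)) : Prop :=
  W.filterMap Sum.getRight? = W'.filterMap Sum.getRight? ∧ ∀ s, blockFold W s = blockFold W' s

theorem TraceEq.refl (W : List (M ⊕ B)) : TraceEq W W := ⟨rfl, fun _ => rfl⟩

theorem TraceEq.append {W W' X X' : List (M ⊕ B)} (h : TraceEq W W') (h' : TraceEq X X') :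
    TraceEq (W ++ X) (W' ++ X') :=
  ⟨by rw [List.filterMap_append, List.filterMap_append, h.1, h'.1],
    fun s => by rw [blockFold_append, blockFold_append, h.2, h'.2]⟩

theorem TraceEq.flatten {d : ℕ} {F F' : Fin d → List (M ⊕ B)} (h : ∀ i, TraceEq (F i) (F' i)) :
    TraceEq (List.ofFn F).flatten (List.ofFn F').flatten := by
  induction d with
  | zero => simpa using TraceEq.refl _
  | succ d ih =>
    simp only [List.ofFn_succ, List.flatten_cons]
    exact (h 0).append (ih fun i => h i.succ)

/-- Merging a run of monoid elements into one product changes neither the visible variables nor the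
block products. -/
theorem TraceEq.prod (l : List M) :
    TraceEq (B := B) [Sum.inl l.prod] (l.map Sum.inl) :=
  ⟨by rw [filterMap_getRight_map_inl]; rfl, fun s => by rw [blockFold_map_inl]; rfl⟩

theorem TraceEq.readsOff_iff {d : ℕ} {W W' : List (M ⊕ Fin d)} (h : TraceEq W W')
    (ι : Interface M d) : ReadsOff W ι ↔ ReadsOff W' ι := by
  rw [TupleLearner.readsOff_iff, TupleLearner.readsOff_iff, h.1, h.2]

theorem hval_eq_prod (h : FreeMonoid α →* M) (w : List α) :
    hval h w = (w.map fun a => hval h [a]).prod := by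
  induction w with
  | nil => exact map_one h
  | cons a w ih =>
    rw [List.map_cons, List.prod_cons, ← ih]
    exact map_mul h (FreeMonoid.ofList [a]) (FreeMonoid.ofList w)

end Trace

/-! ## Annotated words -/

/-- Words over letters and names `v : V` that carry a list as payload. -/
abbrev AWord (α V Q : Type*) : Type _ := List (α ⊕ V × List Q)

namespace AWord

variable {α V Q M I : Type*}

/-- The names, from left to right. -/
def names (T : AWord α V Q) : List V := (T.filterMap Sum.getRight?).map Prod.fst

/-- Replace the names by their payload. -/
def expand (ex : List Q → List α) (T : AWord α V Q) : List α :=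
  T.flatMap (Sum.elim (fun a => [a]) fun p => ex p.2)

/-- The payload of the name `v`, if `v` occurs once. -/
def collect [DecidableEq V] (v : V) (T : AWord α V Q) : List Q :=
  T.flatMap (Sum.elim (fun _ => []) fun p => if p.1 = v then p.2 else [])

/-- Remove the payloads. -/
def forget (T : AWord α V Q) : List (α ⊕ V) := T.map (Sum.map id Prod.fst)

/-- Attach payloads. -/
def annotate (val : V → List Q) (t : List (α ⊕ V)) : AWord α V Q :=
  t.map (Sum.map id fun v => (v, val v))

/-- Keep the names `v` with `keep v = some j` under the new name `j` and expand all others. -/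
def restrict {d : ℕ} (keep : V → Option (Fin d)) (T : AWord α V α) : AWord α (Fin d) α :=
  T.flatMap (Sum.elim (fun a => [.inl a]) fun p =>
    (keep p.1).elim (p.2.map .inl) fun j => [.inr (j, p.2)])

/-- Replace the outer names by the inner annotated words. -/
def flat (U : AWord α I (α ⊕ V × List α)) : AWord α V α :=
  U.flatMap (Sum.elim (fun a => [.inl a]) fun p => p.2)

/-- Expand the inner annotated words. -/
def inner (U : AWord α I (α ⊕ V × List α)) : AWord α I α :=
  U.map (Sum.map id fun p => (p.1, expand id p.2))

/-- The word of values, with visible names. -/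
def toTrace [Monoid M] (h : FreeMonoid α →* M) (T : AWord α V Q) : List (M ⊕ V) :=
  T.map (Sum.map (fun a => hval h [a]) Prod.fst)

@[simp] theorem names_nil : names ([] : AWord α V Q) = [] := rfl

@[simp] theorem names_inl (a : α) (T : AWord α V Q) : names (.inl a :: T) = names T := rfl

@[simp] theorem names_inr (p : V × List Q) (T : AWord α V Q) :
    names (.inr p :: T) = p.1 :: names T := rfl

@[simp] theorem names_append (T T' : AWord α V Q) : names (T ++ T') = names T ++ names T' := by
  simp [names]

@[simp] theorem names_map_inl (l : List α) : names (l.map Sum.inl : AWord α V Q) = [] := by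
  simp [names]

theorem names_eq_flatMap (T : AWord α V Q) :
    names T = T.flatMap (Sum.elim (fun _ => []) fun p => [p.1]) := by
  induction T with
  | nil => rfl
  | cons q T ih => cases q <;> simp [ih]

theorem mem_names {v : V} {x : List Q} {T : AWord α V Q} (h : Sum.inr (v, x) ∈ T) :
    v ∈ names T := by
  rw [names_eq_flatMap]
  exact List.mem_flatMap.2 ⟨_, h, by simp⟩

theorem rights_toTrace [Monoid M] (h : FreeMonoid α →* M) (T : AWord α V Q) :
    (toTrace h T).filterMap Sum.getRight? = names T := by
  induction T with
  | nil => rfl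
  | cons q T ih =>
    cases q
    · exact ih
    · exact congrArg (_ :: ·) ih

theorem forget_annotate (val : V → List Q) (t : List (α ⊕ V)) : forget (annotate val t) = t := by
  simp only [forget, annotate, List.map_map, Sum.map_comp_map]
  convert List.map_id t
  ext x; cases x <;> rfl

theorem annotate_forget (val : V → List Q) (T : AWord α V Q)
    (h : ∀ v x, .inr (v, x) ∈ T → val v = x) : annotate val (forget T) = T := by
  induction T with
  | nil => rfl
  | cons q T ih =>
    have ih' := ih fun v x hx => h v x (List.mem_cons_of_mem _ hx)
    simp only [annotate, forget, List.map_cons, List.map_map, List.cons.injEq] at ih' ⊢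
    refine ⟨?_, ih'⟩
    rcases q with a | ⟨v, x⟩
    · rfl
    · simp [h v x List.mem_cons_self]

theorem names_annotate (val : V → List Q) (t : List (α ⊕ V)) :
    names (annotate val t) = t.filterMap Sum.getRight? := by
  induction t with
  | nil => rfl
  | cons q t ih =>
    cases q
    · exact ih
    · exact congrArg (_ :: ·) ih

theorem expand_annotate (val : V → List α) (t : List (α ⊕ V)) :
    expand id (annotate val t) = t.flatMap (Sum.elim (fun a => [a]) val) := by
  simp only [expand, annotate, List.flatMap_map]
  congr 1
  ext x : 1; cases x <;> rfl

theorem collect_eq_nil [DecidableEq V] {v : V} {T : AWord α V Q} (h : v ∉ names T) :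
    collect v T = [] := by
  induction T with
  | nil => rfl
  | cons q T ih =>
    rcases q with a | p
    · simpa [collect] using ih h
    · simp only [names_inr, List.mem_cons, not_or] at h
      have := ih h.2
      simp only [collect] at this
      simp [collect, Ne.symm h.1, this]

theorem collect_of_mem [DecidableEq V] {v : V} {x : List Q} {T : AWord α V Q}
    (hn : (names T).Nodup) (h : .inr (v, x) ∈ T) : collect v T = x := by
  induction T with
  | nil => simp at h
  | cons q T ih =>
    rcases q with a | p
    · simpa [collect] using ih hn (by simpa using h)
    · rw [names_inr, List.nodup_cons] at hn
      have hc : collect v (.inr p :: T) = (if p.1 = v then p.2 else []) ++ collect v T := by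
        simp [collect]
      rw [hc]
      rcases List.mem_cons.1 h with h | h
      · simp only [Sum.inr.injEq] at h
        subst h
        simp [collect_eq_nil hn.1]
      · rw [ih hn.2 h, if_neg, List.nil_append]
        rintro rfl
        exact hn.1 (mem_names h)

theorem names_restrict {d : ℕ} (keep : V → Option (Fin d)) (T : AWord α V α) :
    names (restrict keep T) = (names T).filterMap keep := by
  induction T with
  | nil => rfl
  | cons q T ih =>
    have : ∀ q, restrict keep (q :: T) = restrict keep [q] ++ restrict keep T := by
      intro q; simp [restrict]
    rw [this, names_append, ih]
    rcases q with a | p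
    · simp [restrict]
    · cases hk : keep p.1 <;> simp [restrict, hk]

/-- Whether a name is expanded now or later, the final word is the same. Hiding the variables of one
child therefore keeps the underlying sample word. -/
theorem expand_restrict {d : ℕ} (keep : V → Option (Fin d)) (T : AWord α V α) :
    expand id (restrict keep T) = expand id T := by
  simp only [expand, restrict, List.flatMap_assoc]
  congr 1
  ext q : 1
  rcases q with a | p
  · simp
  · cases hk : keep p.1 <;> simp [hk, List.flatMap_map]

theorem collect_restrict [DecidableEq V] {d : ℕ} {keep : V → Option (Fin d)} {j : Fin d} {v : V}
    (hk : ∀ v', keep v' = some j ↔ v' = v) (T : AWord α V α) :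
    collect j (restrict keep T) = collect v T := by
  simp only [collect, restrict, List.flatMap_assoc]
  congr 1
  ext q : 1
  rcases q with a | p
  · simp
  · cases hp : keep p.1 with
    | none =>
      have : p.1 ≠ v := fun h => by simp [(hk p.1).2 h] at hp
      simp [hp, this, List.flatMap_map]
    | some i =>
      have : i = j ↔ p.1 = v := by rw [← hk, hp]; simp
      simp [hp, this]

theorem expand_flat (U : AWord α I (α ⊕ V × List α)) :
    expand id (flat U) = expand (expand id) U := by
  simp only [expand, flat, List.flatMap_assoc]
  congr 1
  ext q : 1
  rcases q with a | p <;> simp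

theorem mem_flat {U : AWord α I (α ⊕ V × List α)} {i : I} {P : AWord α V α} {q}
    (hU : .inr (i, P) ∈ U) (hq : q ∈ P) : q ∈ flat U :=
  List.mem_flatMap.2 ⟨_, hU, by simpa using hq⟩

end AWord

open AWord

/-! ## Sentence contexts as annotated words -/

section Mark

variable {α M V Q : Type*} [Monoid M] {d : ℕ}

/-- The context `E` with payload `p i` at the hole `i`. -/
def mark (E : SentenceContext α d) (p : Fin d → List Q) : AWord α (Fin d) Q :=
  interleave E.bdry fun i => (E.perm i, p (E.perm i))

theorem names_mark (E : SentenceContext α d) (p : Fin d → List Q) :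
    names (mark E p) = List.ofFn E.perm := by
  simp [names, mark, rights_interleave, List.map_ofFn, Function.comp_def]

theorem nodup_names_mark (E : SentenceContext α d) (p : Fin d → List Q) :
    (names (mark E p)).Nodup := by
  rw [names_mark]
  exact List.nodup_ofFn.2 E.perm.injective

theorem mem_mark (E : SentenceContext α d) (p : Fin d → List Q) (i : Fin d) :
    .inr (i, p i) ∈ mark E p := by
  have := mem_interleave E.bdry (fun i => (E.perm i, p (E.perm i))) (E.perm.symm i)
  rwa [Equiv.apply_symm_apply] at this

theorem collect_mark (E : SentenceContext α d) (p : Fin d → List Q) (i : Fin d) :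
    collect i (mark E p) = p i :=
  collect_of_mem (nodup_names_mark E p) (mem_mark E p i)

theorem expand_mark (ex : List Q → List α) (E : SentenceContext α d) (p : Fin d → List Q) :
    expand ex (mark E p) = E.fill fun i => ex (p i) := by
  simp [expand, mark, flatMap_interleave, SentenceContext.fill]

theorem forget_mark (E : SentenceContext α d) (p : Fin d → List Q) :
    forget (mark E p) = interleave E.bdry E.perm := by
  simp [forget, mark, map_interleave]

/-- The letters between two holes multiply to the value of the boundary word, so the type of a
context is the interface read off from its own marked word. -/
theorem readsOff_mark (h : FreeMonoid α →* M) (E : SentenceContext α d) (p : Fin d → List Q) :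
    ReadsOff (toTrace h (mark E p)) (E.type h) := by
  refine ⟨fun i => (E.bdry i).map fun a => hval h [a], ?_, fun i => hval_eq_prod h _⟩
  exact map_interleave _ _ _ _

/-- Converse of `mark`: the unmarked stretches serve as boundary words, and the payloads are
reindexed from positions to hole names by `σ.symm`. -/
theorem exists_mark (T : AWord α (Fin d) Q) (σ : Equiv.Perm (Fin d))
    (hT : names T = List.ofFn σ) : ∃ (E : SentenceContext α d) (p : Fin d → List Q),
      E.perm = σ ∧ T = mark E p := by
  have hlen : (T.filterMap Sum.getRight?).length = d := by
    have := congrArg List.length hT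
    simpa [names] using this
  obtain ⟨g, hg⟩ := exists_eq_ofFn hlen
  have hσ : ∀ i, (g i).1 = σ i := by
    rw [names, hg, List.map_ofFn] at hT
    exact fun i => congrFun (List.ofFn_injective hT) i
  obtain ⟨b, rfl⟩ := exists_interleave T g hg
  refine ⟨⟨σ, b⟩, fun j => (g (σ.symm j)).2, rfl, ?_⟩
  simp only [mark]
  congr 1
  funext i
  rw [← hσ]
  simp [hσ, Prod.ext_iff]

theorem exists_perm_of_count {L : List (Fin d)} (h : ∀ j, L.count j = 1) :
    ∃ κ : Equiv.Perm (Fin d), L = List.ofFn κ := by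
  have hnd : L.Nodup := List.nodup_iff_count_le_one.2 fun j => (h j).le
  have hlen : L.length = d := by
    rw [← List.toFinset_card_of_nodup hnd]
    have : L.toFinset = Finset.univ := by
      ext j
      simpa using List.count_pos_iff.1 (by rw [h j]; exact one_pos)
    rw [this, Finset.card_univ, Fintype.card_fin]
  obtain ⟨g, rfl⟩ := exists_eq_ofFn hlen
  exact ⟨Equiv.ofBijective g (Finite.injective_iff_bijective.1 (List.nodup_ofFn.1 hnd)), rfl⟩

end Mark

/-! ## Raw nonterminals -/

section Raw

variable {α M : Type*} {d : ℕ}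

/-- A typed tuple written as a list of components, the list of hole names and a list of monoid
elements. -/
abbrev RawTuple (α M : Type*) : Type _ := List (List α) × (List ℕ × List M)

/-- The raw form of a typed tuple. -/
def TypedTuple.raw (T : TypedTuple α M) : RawTuple α M :=
  (List.ofFn T.comps, (List.ofFn T.iface.1).map Fin.val, List.ofFn T.iface.2)

/-- The arity is the length of the component list, so the dependent data can be flattened to lists
without loss. -/
theorem raw_injective : Function.Injective (TypedTuple.raw : TypedTuple α M → RawTuple α M) := by
  rintro ⟨d, x, σ, m⟩ ⟨d', x', σ', m'⟩ h
  simp only [TypedTuple.raw, Prod.mk.injEq] at h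
  obtain rfl : d = d' := by simpa using congrArg List.length h.1
  obtain rfl := List.ofFn_injective h.1
  obtain rfl := List.ofFn_injective h.2.2
  have := List.ofFn_injective (List.map_injective_iff.2 Fin.val_injective h.2.1)
  obtain rfl : σ = σ' := DFunLike.coe_injective this
  rfl

/-- The raw typed tuple of an annotated word. -/
def rawTuple [Monoid M] (h : FreeMonoid α →* M) (T : AWord α (Fin d) α) : RawTuple α M :=
  (List.ofFn fun i => collect i T, (names T).map Fin.val, blockFold (toTrace h T) [1])

theorem rawTuple_of_readsOff [Monoid M] {h : FreeMonoid α →* M} {T : AWord α (Fin d) α} {x : Fin d → List α}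
    {ι : Interface M d} (hx : ∀ i, collect i T = x i) (hι : ReadsOff (toTrace h T) ι) :
    rawTuple h T = TypedTuple.raw ⟨d, x, ι⟩ := by
  rw [readsOff_iff, rights_toTrace] at hι
  simp only [rawTuple, TypedTuple.raw, hι.1, hι.2, hx]

theorem rawTuple_mark [Monoid M] (h : FreeMonoid α →* M) (E : SentenceContext α d) (x : Fin d → List α) :
    rawTuple h (mark E x) = TypedTuple.raw ⟨d, x, E.type h⟩ :=
  rawTuple_of_readsOff (collect_mark E x) (readsOff_mark h E x)

end Raw

/-! ## Enumeration of annotated words -/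

section Annot

variable {α V Q : Type*}

/-- All ways to cut a word into two pieces. -/
def splits : List α → List (List α × List α)
  | [] => [([], [])]
  | a :: w => ([], a :: w) :: (splits w).map fun p => (a :: p.1, p.2)

theorem mem_splits {w : List α} {p : List α × List α} : p ∈ splits w ↔ p.1 ++ p.2 = w := by
  induction w generalizing p with
  | nil => simp [splits, Prod.ext_iff]
  | cons a w ih =>
    obtain ⟨x, y⟩ := p
    simp only [splits, List.mem_cons, List.mem_map, ih, Prod.ext_iff, Prod.exists]
    constructor
    · rintro (⟨rfl, rfl⟩ | ⟨x', y', h, rfl, rfl⟩) <;> simp_all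
    · intro h
      cases x with
      | nil => simp_all
      | cons b x =>
        simp only [List.cons_append, List.cons.injEq] at h
        exact Or.inr ⟨x, y, h.2, by rw [h.1], rfl⟩

theorem length_splits (w : List α) : (splits w).length = w.length + 1 := by
  induction w with
  | nil => rfl
  | cons a w ih => simp [splits, ih]

/-- All annotated words with the given names and expansion, where `enum v x` lists the admissible
payloads of the name `v` with expansion `x`. -/
def annot (enum : V → List α → List (List Q)) : List V → List α → List (AWord α V Q)
  | [], w => [w.map .inl]
  -- Two cuts per name: one before and one after the marked factor `q.1`.
  | v :: vs, w => (splits w).flatMap fun p => (splits p.2).flatMap fun q =>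
      (enum v q.1).flatMap fun P => (annot enum vs q.2).map fun T => p.1.map .inl ++ .inr (v, P) :: T

theorem exists_eq_append_of_names {T : AWord α V Q} {v : V} {vs : List V}
    (h : names T = v :: vs) : ∃ (a : List α) (P : List Q) (T' : AWord α V Q),
      T = a.map .inl ++ .inr (v, P) :: T' ∧ names T' = vs := by
  induction T with
  | nil => simp at h
  | cons q T ih =>
    rcases q with a | ⟨v', P⟩
    · obtain ⟨b, P, T', rfl, h'⟩ := ih (by simpa using h)
      exact ⟨a :: b, P, T', by simp, h'⟩
    · simp only [names_inr, List.cons.injEq] at h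
      exact ⟨[], P, T, by simp [h.1], h.2⟩

theorem eq_map_inl_of_names {T : AWord α V Q} (h : names T = []) :
    ∃ w : List α, T = w.map .inl := by
  induction T with
  | nil => exact ⟨[], rfl⟩
  | cons q T ih =>
    rcases q with a | p
    · obtain ⟨w, rfl⟩ := ih (by simpa using h)
      exact ⟨a :: w, rfl⟩
    · simp at h

/-- The first name of an annotated word determines its decomposition into unmarked prefix, marked
factor and rest, so the recursion reaches every word with the prescribed names and expansion. -/
theorem mem_annot {enum : V → List α → List (List Q)} {ex : List Q → List α}
    {good : V → List Q → Prop} (henum : ∀ v x P, P ∈ enum v x ↔ ex P = x ∧ good v P)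
    {vs : List V} {w : List α} {T : AWord α V Q} :
    T ∈ annot enum vs w ↔
      names T = vs ∧ expand ex T = w ∧ ∀ v P, .inr (v, P) ∈ T → good v P := by
  induction vs generalizing w T with
  | nil =>
    simp only [annot, List.mem_singleton]
    constructor
    · rintro rfl
      simp [expand, List.flatMap_map]
    · rintro ⟨h1, h2, -⟩
      obtain ⟨u, rfl⟩ := eq_map_inl_of_names h1
      simp only [expand, List.flatMap_map, Sum.elim_inl, List.flatMap_singleton'] at h2
      rw [h2]
  | cons v vs ih =>
    simp only [annot, List.mem_flatMap, List.mem_map, mem_splits, henum, ih, Prod.exists]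
    constructor
    · rintro ⟨a, r, rfl, x, r', rfl, P, ⟨rfl, hg⟩, T, ⟨rfl, rfl, hT⟩, rfl⟩
      refine ⟨by simp, by simp [expand, List.flatMap_map], ?_⟩
      intro v' P' hm
      simp only [List.mem_append, List.mem_map, reduceCtorEq, and_false, exists_false,
        List.mem_cons, Sum.inr.injEq, Prod.mk.injEq, false_or] at hm
      rcases hm with ⟨rfl, rfl⟩ | hm
      · exact hg
      · exact hT _ _ hm
    · rintro ⟨h1, h2, h3⟩
      obtain ⟨a, P, T', rfl, h'⟩ := exists_eq_append_of_names h1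
      refine ⟨a, _, ?_, ex P, expand ex T', rfl, P, ⟨rfl, h3 _ _ (by simp)⟩, T',
        ⟨h', rfl, fun v P hm => h3 v P (by simp [hm])⟩, rfl⟩
      rw [← h2]
      simp [expand, List.flatMap_map]

theorem length_flatMap_le {A B : Type*} (l : List A) (F : A → List B) (k : ℕ)
    (h : ∀ a ∈ l, (F a).length ≤ k) : (l.flatMap F).length ≤ l.length * k := by
  induction l with
  | nil => simp
  | cons a l ih =>
    have h1 := ih fun b hb => h b (List.mem_cons_of_mem _ hb)
    have h2 := h a List.mem_cons_self
    simp only [List.flatMap_cons, List.length_append, List.length_cons, Nat.add_mul, one_mul]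
    omega

/-- Each name contributes two cuts with at most `w.length + 1` positions, and its payload
contributes `k v` more such factors. All exponents in the counting bounds come from here. -/
theorem length_annot_le {enum : V → List α → List (List Q)} {k : V → ℕ}
    (henum : ∀ v x, (enum v x).length ≤ (x.length + 1) ^ k v) (vs : List V) (w : List α) :
    (annot enum vs w).length ≤ (w.length + 1) ^ (2 * vs.length + (vs.map k).sum) := by
  induction vs generalizing w with
  | nil => simp [annot]
  | cons v vs ih =>
    have key : (w.length + 1) ^ (2 * (v :: vs).length + ((v :: vs).map k).sum) =
        (w.length + 1) * ((w.length + 1) * ((w.length + 1) ^ k v *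
          (w.length + 1) ^ (2 * vs.length + (vs.map k).sum))) := by
      simp only [List.length_cons, List.map_cons, List.sum_cons]
      ring
    rw [key, annot]
    refine (length_flatMap_le _ _ _ fun p hp => ?_).trans
      (Nat.mul_le_mul_right _ (length_splits w).le)
    have hp' : p.2.length ≤ w.length := by
      rw [← mem_splits.1 hp]; simp
    refine (length_flatMap_le _ _ _ fun q hq => ?_).trans
      (Nat.mul_le_mul_right _ ((length_splits p.2).trans_le (by omega)))
    have hq' : q.1.length ≤ w.length ∧ q.2.length ≤ w.length := by
      have := congrArg List.length (mem_splits.1 hq)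
      simp only [List.length_append] at this
      omega
    refine (length_flatMap_le _ _ _ fun P hP => ?_).trans
      (Nat.mul_le_mul_right _ ((henum v q.1).trans (Nat.pow_le_pow_left (by omega) _)))
    rw [List.length_map]
    exact (ih q.2).trans (Nat.pow_le_pow_left (by omega) _)

/-- All annotated words with the given names and expansion. -/
def annot₁ (vs : List V) (w : List α) : List (AWord α V α) := annot (fun _ x => [x]) vs w

/-- All two-level annotated words, with the names `s i` inside the outer name `i`. -/
def annot₂ {I : Type*} (s : I → List V) (is : List I) (w : List α) :
    List (AWord α I (α ⊕ V × List α)) :=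
  annot (fun i x => annot₁ (s i) x) is w

theorem mem_annot₁ {vs : List V} {w : List α} {T : AWord α V α} :
    T ∈ annot₁ vs w ↔ names T = vs ∧ expand id T = w := by
  rw [annot₁, mem_annot (ex := id) (good := fun _ _ => True)]
  · simp
  · simp [eq_comm]

theorem mem_annot₂ {I : Type*} {s : I → List V} {is : List I} {w : List α}
    {U : AWord α I (α ⊕ V × List α)} :
    U ∈ annot₂ s is w ↔ names U = is ∧ expand (expand id) U = w ∧
      ∀ i (P : AWord α V α), .inr (i, P) ∈ U → names P = s i :=
  mem_annot fun i x P => by rw [mem_annot₁, and_comm]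

theorem length_annot₁_le (vs : List V) (w : List α) :
    (annot₁ vs w).length ≤ (w.length + 1) ^ (2 * vs.length) := by
  rw [annot₁]
  simpa using length_annot_le (enum := fun _ x => [x]) (k := fun _ : V => 0) (by simp) vs w

theorem length_annot₂_le {I : Type*} (s : I → List V) (is : List I) (w : List α) :
    (annot₂ s is w).length ≤
      (w.length + 1) ^ (2 * is.length + (is.map fun i => 2 * (s i).length).sum) :=
  length_annot_le (fun i x => length_annot₁_le (s i) x) is w

end Annot

end TupleLearner

/-! ### Correspondence between nonterminals or rules and annotated sample words. -/

namespace TupleLearner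

open AWord

/-- Linearity counts occurrences of variables from a sum type; the counting lemmas need its Boolean
test to reflect equality. -/
instance {A B : Type*} [BEq A] [BEq B] [LawfulBEq A] [LawfulBEq B] : LawfulBEq (A ⊕ B) where
  eq_of_beq {x y} h := by
    rcases x with a | a <;> rcases y with b | b
    · exact congrArg _ (eq_of_beq (α := A) h)
    · cases h
    · cases h
    · exact congrArg _ (eq_of_beq (α := B) h)
  rfl {x} := by
    rcases x with a | a
    · exact BEq.rfl (α := A)
    · exact BEq.rfl (α := B)

/-! ## Binary rules as two-level annotated words -/

section Binary

variable {α M V : Type*} [Monoid M] {d e dB dC : ℕ}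

/-- The decorated trace of a tuple of words with variables, in which the variables `v` with
`keep v = some j` stay visible as `j`. -/
def decoratedTrace (h : FreeMonoid α →* M) (keep : V → Option (Fin d)) (val : V → List α)
    (τ : Interface M e) (t : Fin e → List (α ⊕ V)) : List (M ⊕ Fin d) :=
  decorate τ fun i => (t i).map
    (Sum.elim (fun a => Sum.inl (hval h [a])) fun v => (keep v).elim (.inl (hval h (val v))) .inr)

theorem traceB_eq (h : FreeMonoid α →* M) (t : Template α e dB dC) (τ : Interface M e)
    (x : Fin dB → List α) (y : Fin dC → List α) :
    traceB h t τ (fun j => hval h (y j)) =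
      decoratedTrace h Sum.getLeft? (Sum.elim x y) τ t := by
  simp only [traceB, decoratedTrace]
  congr 1
  funext i
  congr 1
  funext q
  rcases q with a | j | j <;> rfl

theorem traceC_eq (h : FreeMonoid α →* M) (t : Template α e dB dC) (τ : Interface M e)
    (x : Fin dB → List α) (y : Fin dC → List α) :
    traceC h t τ (fun j => hval h (x j)) =
      decoratedTrace h Sum.getRight? (Sum.elim x y) τ t := by
  simp only [traceC, decoratedTrace]
  congr 1
  funext i
  congr 1
  funext q
  rcases q with a | j | j <;> rfl

theorem flat_mark (E : SentenceContext α e) (p : Fin e → AWord α V α) :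
    flat (mark E p) = (E.bdry 0).map .inl ++
      (List.ofFn fun i => p (E.perm i) ++ (E.bdry i.succ).map .inl).flatten := by
  simp only [flat, mark, flatMap_interleave, Sum.elim_inl, Sum.elim_inr,
    List.map_eq_flatMap]

/-- The two traces differ only in granularity: the decorated one has a single monoid element for
each boundary word and hidden variable, the other one element per letter. Multiplicativity of `h`
makes the block products agree. -/
theorem traceEq_decoratedTrace (h : FreeMonoid α →* M) (keep : V → Option (Fin d))
    (val : V → List α) (E : SentenceContext α e) (t : Fin e → List (α ⊕ V)) :
    TraceEq (decoratedTrace h keep val (E.type h) t)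
      (toTrace h (restrict keep (flat (mark E fun i => annotate val (t i))))) := by
  have hu : ∀ u : List α, TraceEq [Sum.inl (hval h u)]
      (toTrace h (restrict keep (u.map .inl : AWord α V α))) := by
    intro u
    have : toTrace h (restrict keep (u.map .inl : AWord α V α)) =
        (u.map fun a => hval h [a]).map (.inl : M → M ⊕ Fin d) := by
      simp only [toTrace, restrict, List.flatMap_map, Sum.elim_inl,
        ← List.map_eq_flatMap, List.map_map]
      rfl
    rw [this, hval_eq_prod]
    exact TraceEq.prod _
  have ht : ∀ l : List (α ⊕ V), TraceEq (l.map (Sum.elim (fun a => Sum.inl (hval h [a]))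
      fun v => (keep v).elim (.inl (hval h (val v))) .inr))
      (toTrace h (restrict keep (annotate val l))) := by
    intro l
    induction l with
    | nil => exact TraceEq.refl _
    | cons q l ih =>
      have hc : toTrace h (restrict keep (annotate val (q :: l))) =
          toTrace h (restrict keep (annotate val [q])) ++
            toTrace h (restrict keep (annotate val l)) := by
        simp [toTrace, restrict, annotate]
      rw [hc, List.map_cons]
      refine TraceEq.append (W := [_]) ?_ ih
      rcases q with a | v
      · exact TraceEq.refl _
      · cases hk : keep v with
        | none =>
          have := hu (val v)
          simpa [toTrace, restrict, annotate, hk, List.flatMap_map, Function.comp_def,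
            ← List.map_eq_flatMap] using this
        | some j => simpa [toTrace, restrict, annotate, hk] using TraceEq.refl _
  have hsplit : toTrace h (restrict keep (flat (mark E fun i => annotate val (t i)))) =
      toTrace h (restrict keep ((E.bdry 0).map .inl : AWord α V α)) ++
        (List.ofFn fun i => toTrace h (restrict keep (annotate val (t (E.perm i)))) ++
          toTrace h (restrict keep ((E.bdry i.succ).map .inl : AWord α V α))).flatten := by
    rw [flat_mark]
    simp only [toTrace, restrict, List.map_append, List.flatMap_def,
      List.map_flatten, List.map_ofFn, List.flatten_flatten, List.flatten_append,
      Function.comp_def]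
  rw [hsplit]
  exact TraceEq.append (W := [_]) (hu _) (TraceEq.flatten fun i => (ht _).append (hu _))

theorem count_filterMap_eq [BEq V] [LawfulBEq V] {keep : V → Option (Fin d)} {j : Fin d} {v : V}
    (hk : ∀ v', keep v' = some j ↔ v' = v) (l : List V) :
    (l.filterMap keep).count j = l.count v := by
  induction l with
  | nil => rfl
  | cons v' l ih =>
    by_cases hv : v' = v
    · rw [List.filterMap_cons_some ((hk v').2 hv), hv, List.count_cons_self, List.count_cons_self,
        ih]
    · have hne : keep v' ≠ some j := fun h => hv ((hk v').1 h)
      rw [List.count_cons_of_ne hv, ← ih]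
      cases hc : keep v' with
      | none => rw [List.filterMap_cons_none hc]
      | some i =>
        rw [List.filterMap_cons_some hc, List.count_cons_of_ne]
        rintro rfl
        exact hne hc

/-- Every variable occurs exactly once in the tuple of words. -/
def LinearSkeleton [BEq V] (s : Fin e → List V) : Prop :=
  ∀ v, (List.ofFn s).flatten.count v = 1

theorem linear_iff (t : Template α e dB dC) :
    t.Linear ↔ LinearSkeleton fun i => (t i).filterMap Sum.getRight? := by
  simp only [Template.Linear, LinearSkeleton, List.filterMap_flatten, List.map_ofFn]
  rfl

/-- The context only permutes the components, and the number of occurrences is a sum over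
components. -/
theorem count_names_flat_mark [BEq V] (E : SentenceContext α e)
    (p : Fin e → AWord α V α) (v : V) : (names (flat (mark E p))).count v =
      (List.ofFn fun i => names (p i)).flatten.count v := by
  have h1 : names (flat (mark E p)) = (List.ofFn fun i => names (p (E.perm i))).flatten := by
    rw [flat_mark, names_append, names_map_inl, List.nil_append, names_eq_flatMap,
      List.flatMap_def, List.map_flatten, List.flatten_flatten, List.map_map, List.map_ofFn]
    congr 2
    funext i
    simp only [Function.comp_apply]
    rw [← List.flatMap_def, ← names_eq_flatMap, names_append, names_map_inl, List.append_nil]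
  rw [h1, List.count_flatten, List.count_flatten, List.map_ofFn, List.map_ofFn, List.sum_ofFn,
    List.sum_ofFn]
  exact Equiv.sum_comp E.perm fun i => (names (p i)).count v

/-- The raw nonterminals and the template of the rule described by a two-level annotated word. -/
def rawBinary (h : FreeMonoid α →* M) (U : AWord α (Fin e) (α ⊕ (Fin dB ⊕ Fin dC) × List α)) :
    RawTuple α M × (List (List (α ⊕ (Fin dB ⊕ Fin dC))) × (RawTuple α M × RawTuple α M)) :=
  (rawTuple h (AWord.inner U), (List.ofFn fun i => forget (collect i U)),
    rawTuple h (restrict Sum.getLeft? (flat U)), rawTuple h (restrict Sum.getRight? (flat U)))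

theorem inner_mark (E : SentenceContext α e) (p : Fin e → AWord α V α) :
    AWord.inner (mark E p) = mark E fun i => expand id (p i) := by
  simp [AWord.inner, mark, map_interleave]

theorem names_count_of_linear {E : SentenceContext α e} {t : Template α e dB dC}
    (ht : t.Linear) (val : Fin dB ⊕ Fin dC → List α) (v : Fin dB ⊕ Fin dC) :
    (names (flat (mark E fun i => annotate val (t i)))).count v = 1 := by
  rw [count_names_flat_mark]
  simp only [names_annotate]
  exact (linear_iff t).1 ht v

theorem collect_flat_mark {E : SentenceContext α e} {t : Template α e dB dC}
    (ht : t.Linear) (val : Fin dB ⊕ Fin dC → List α) (v : Fin dB ⊕ Fin dC) :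
    collect v (flat (mark E fun i => annotate val (t i))) = val v := by
  have hc := fun v => names_count_of_linear (E := E) ht val v
  refine collect_of_mem (List.nodup_iff_count_le_one.2 fun v => (hc v).le) ?_
  have h1 : v ∈ (List.ofFn t).flatten.filterMap Sum.getRight? :=
    List.count_pos_iff.1 (by rw [ht v]; exact one_pos)
  simp only [List.mem_filterMap, List.mem_flatten, List.mem_ofFn, Sum.getRight?_eq_some_iff,
    exists_eq_right] at h1
  obtain ⟨_, ⟨i, rfl⟩, hi⟩ := h1
  refine mem_flat (mem_mark E _ i) ?_
  exact List.mem_map.2 ⟨_, hi, rfl⟩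

theorem getLeft?_eq_some_iff_eq (j : Fin dB) (v : Fin dB ⊕ Fin dC) :
    v.getLeft? = some j ↔ v = .inl j := Sum.getLeft?_eq_some_iff

theorem getRight?_eq_some_iff_eq (j : Fin dC) (v : Fin dB ⊕ Fin dC) :
    v.getRight? = some j ↔ v = .inr j := Sum.getRight?_eq_some_iff

/-- From a rule to a marked word: the context marks the components of `z`, and inside them the
template marks its variables with their values. Every item of the rule is recovered from this word.
-/
theorem rawBinary_mark {h : FreeMonoid α →* M} {E : SentenceContext α e}
    {t : Template α e dB dC} (ht : t.Linear) {x : Fin dB → List α} {y : Fin dC → List α}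
    {τB : Interface M dB} {τC : Interface M dC}
    (hB : ReadsOff (traceB h t (E.type h) fun j => hval h (y j)) τB)
    (hC : ReadsOff (traceC h t (E.type h) fun i => hval h (x i)) τC) :
    rawBinary h (mark E fun i => annotate (Sum.elim x y) (t i)) =
      (TypedTuple.raw ⟨e, t.subst x y, E.type h⟩, List.ofFn t, TypedTuple.raw ⟨dB, x, τB⟩,
        TypedTuple.raw ⟨dC, y, τC⟩) := by
  rw [traceB_eq, (traceEq_decoratedTrace _ _ _ _ _).readsOff_iff] at hB
  rw [traceC_eq, (traceEq_decoratedTrace _ _ _ _ _).readsOff_iff] at hC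
  simp only [rawBinary, Prod.mk.injEq]
  refine ⟨?_, ?_, rawTuple_of_readsOff (fun i => ?_) hB, rawTuple_of_readsOff (fun i => ?_) hC⟩
  · rw [inner_mark, rawTuple_mark]
    simp only [expand_annotate]
    rfl
  · simp only [collect_mark, forget_annotate]
  · rw [collect_restrict (getLeft?_eq_some_iff_eq i), collect_flat_mark ht]
    rfl
  · rw [collect_restrict (getRight?_eq_some_iff_eq i), collect_flat_mark ht]
    rfl

/-- The raw data of binary rules with given fan-outs. -/
def IsRawBinary (h : FreeMonoid α →* M) (K : Finset (List α)) (e dB dC : ℕ)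
    (R : RawTuple α M × (List (List (α ⊕ (Fin dB ⊕ Fin dC))) × (RawTuple α M × RawTuple α M))) :
    Prop :=
  ∃ σ : Equiv.Perm (Fin e), ∃ s : Fin e → List (Fin dB ⊕ Fin dC), LinearSkeleton s ∧
    ∃ w ∈ K, ∃ U ∈ annot₂ s (List.ofFn σ) w, rawBinary h U = R

theorem isRawBinary_of_rule {f : ℕ} {h : FreeMonoid α →* M} {K : Finset (List α)}
    {A B C : Option (TypedTuple α M)} {t : Template α e dB dC}
    (hr : LearnerRule f h K (.binary A t B C)) :
    (1 ≤ e ∧ e ≤ f) ∧ (1 ≤ dB ∧ dB ≤ f) ∧ (1 ≤ dC ∧ dC ≤ f) ∧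
      ∃ TA TB TC : TypedTuple α M, A = some TA ∧ B = some TB ∧ C = some TC ∧
        IsRawBinary h K e dB dC (TA.raw, List.ofFn t, TB.raw, TC.raw) := by
  cases hr with
  | @binary _ _ _ E z x y τB τC _ h1 h2 hK hB hC ht hz hτB hτC =>
  refine ⟨⟨h1, h2⟩, ⟨hB.1, hB.2.1⟩, ⟨hC.1, hC.2.1⟩, _, _, _, rfl, rfl, rfl, E.perm,
    fun i => (t i).filterMap Sum.getRight?, (linear_iff t).1 ht, _, hK,
    mark E fun i => annotate (Sum.elim x y) (t i), ?_, ?_⟩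
  · rw [mem_annot₂]
    refine ⟨names_mark _ _, ?_, fun i P hP => ?_⟩
    · rw [expand_mark, hz]
      simp only [expand_annotate]
      rfl
    · rw [← collect_of_mem (nodup_names_mark _ _) hP, collect_mark, names_annotate]
  · rw [rawBinary_mark ht hτB hτC, hz]

/-- Expanding all names except those `keep` retains leaves a context for the visible components with
the same filling. The sample word that carries the rule thus also witnesses that its children are
observed. -/
theorem exists_observed_restrict {f : ℕ} (h : FreeMonoid α →* M) {K : Finset (List α)}
    (h1 : 1 ≤ d) (h2 : d ≤ f) [DecidableEq V] [BEq V] [LawfulBEq V]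
    {keep : V → Option (Fin d)} {v : Fin d → V}
    (hk : ∀ j v', keep v' = some j ↔ v' = v j) {T : AWord α V α}
    (hT : ∀ j, (names T).count (v j) = 1) (hK : expand id T ∈ K) :
    ∃ τ, ReadsOff (toTrace h (restrict keep T)) τ ∧
      Observed f h K ⟨d, fun j => collect (v j) T, τ⟩ := by
  obtain ⟨κ, hκ⟩ := exists_perm_of_count (L := names (restrict keep T)) fun j => by
    rw [names_restrict, count_filterMap_eq (hk j), hT]
  obtain ⟨E, x, -, hE⟩ := exists_mark _ κ hκ
  have hx : ∀ j, collect (v j) T = x j := fun j => by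
    rw [← collect_restrict (hk j), hE, collect_mark]
  refine ⟨E.type h, hE ▸ readsOff_mark h E x, h1, h2, E, ?_, rfl⟩
  simp only [hx]
  rw [← expand_restrict keep, hE, expand_mark] at hK
  exact hK

theorem exists_rule_of_isRawBinary {f : ℕ} {h : FreeMonoid α →* M} {K : Finset (List α)}
    (he : 1 ≤ e ∧ e ≤ f) (hB : 1 ≤ dB ∧ dB ≤ f) (hC : 1 ≤ dC ∧ dC ≤ f) {R}
    (hR : IsRawBinary h K e dB dC R) :
    ∃ (TA TB TC : TypedTuple α M) (t : Template α e dB dC),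
      LearnerRule f h K (.binary (some TA) t (some TB) (some TC)) ∧
        R = (TA.raw, List.ofFn t, TB.raw, TC.raw) := by
  obtain ⟨σ, s, hs, w, hw, U, hU, rfl⟩ := hR
  obtain ⟨hn, hex, hi⟩ := mem_annot₂.1 hU
  obtain ⟨E, p, rfl, rfl⟩ := exists_mark U σ hn
  have hp : ∀ i, names (p i) = s i := fun i => hi i _ (mem_mark E p i)
  have hcount : ∀ v, (names (flat (mark E p))).count v = 1 := fun v => by
    rw [count_names_flat_mark]
    simp only [hp]
    exact hs v
  have hnd : (names (flat (mark E p))).Nodup :=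
    List.nodup_iff_count_le_one.2 fun v => (hcount v).le
  let t : Template α e dB dC := fun i => forget (p i)
  let x : Fin dB → List α := fun j => collect (.inl j) (flat (mark E p))
  let y : Fin dC → List α := fun j => collect (.inr j) (flat (mark E p))
  -- Every variable is marked exactly once, so its payload depends on its name alone, and `p` is the
  -- template annotated by the collected values.
  have hpt : p = fun i => annotate (Sum.elim x y) (t i) := by
    funext i
    refine (annotate_forget _ _ fun v x' hv => ?_).symm
    have := collect_of_mem hnd (mem_flat (mem_mark E p i) hv)
    rw [← this]
    cases v <;> rfl
  have ht : t.Linear := by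
    rw [linear_iff]
    have : (fun i => (t i).filterMap Sum.getRight?) = s := by
      funext i
      rw [← hp i]
      simp only [hpt, names_annotate]
    rw [this]
    exact hs
  have hK : expand id (flat (mark E p)) ∈ K := by rw [expand_flat, hex]; exact hw
  obtain ⟨τB, hτB, hoB⟩ := exists_observed_restrict h hB.1 hB.2 getLeft?_eq_some_iff_eq
    (fun j => hcount (.inl j)) hK
  obtain ⟨τC, hτC, hoC⟩ := exists_observed_restrict h hC.1 hC.2 getRight?_eq_some_iff_eq
    (fun j => hcount (.inr j)) hK
  have hfill : E.fill (t.subst x y) ∈ K := by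
    rw [hpt, expand_mark] at hex
    simp only [expand_annotate] at hex
    rw [← hex] at hw
    exact hw
  have htB : ReadsOff (traceB h t (E.type h) fun j => hval h (y j)) τB := by
    rw [traceB_eq, (traceEq_decoratedTrace _ _ _ _ _).readsOff_iff, ← hpt]
    exact hτB
  have htC : ReadsOff (traceC h t (E.type h) fun i => hval h (x i)) τC := by
    rw [traceC_eq, (traceEq_decoratedTrace _ _ _ _ _).readsOff_iff, ← hpt]
    exact hτC
  refine ⟨_, _, _, t, .binary he.1 he.2 hfill hoB hoC ht rfl htB htC, ?_⟩
  rw [← rawBinary_mark ht htB htC, ← hpt]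

/-- Every component is a list without repetitions over a finite type, hence of bounded length. -/
theorem finite_linearSkeleton [Fintype V] [BEq V] [LawfulBEq V] :
    {s : Fin e → List V | LinearSkeleton s}.Finite := by
  refine (Set.Finite.pi' fun _ : Fin e =>
    List.finite_length_le V (Fintype.card V)).subset fun s hs i => ?_
  refine List.Nodup.length_le_card (List.nodup_iff_count_le_one.2 fun v => ?_)
  rw [← hs v]
  exact (List.sublist_flatten_of_mem (List.mem_ofFn.2 ⟨i, rfl⟩)).count_le v

theorem sum_length_linearSkeleton [Fintype V] [BEq V] [LawfulBEq V] {s : Fin e → List V}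
    (hs : LinearSkeleton s) : (List.ofFn s).flatten.length = Fintype.card V := by
  classical
  rw [← List.toFinset_card_of_nodup (List.nodup_iff_count_le_one.2 fun v => (hs v).le)]
  have : (List.ofFn s).flatten.toFinset = Finset.univ := by
    ext v
    simp only [List.mem_toFinset, Finset.mem_univ, iff_true]
    exact List.count_pos_iff.1 (by rw [hs v]; exact one_pos)
  rw [this, Finset.card_univ]

end Binary

/-! ## Nonterminals and the other rules -/

section Other

variable {α M : Type*} [Monoid M] {d : ℕ}

theorem observed_iff {f : ℕ} {h : FreeMonoid α →* M} {K : Finset (List α)}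
    {R : RawTuple α M} : (∃ T, Observed f h K T ∧ T.raw = R) ↔
      ∃ d, 1 ≤ d ∧ d ≤ f ∧ ∃ σ : Equiv.Perm (Fin d), ∃ w ∈ K,
        ∃ T ∈ annot₁ (List.ofFn σ) w, rawTuple h T = R := by
  constructor
  · rintro ⟨⟨d, x, τ⟩, ⟨h1, h2, hE⟩, rfl⟩
    change ∃ E : SentenceContext α d, E.fill x ∈ K ∧ E.type h = τ at hE
    obtain ⟨E, hK, rfl⟩ := hE
    exact ⟨d, h1, h2, E.perm, _, hK, mark E x,
      mem_annot₁.2 ⟨names_mark E x, expand_mark id E x⟩, rawTuple_mark h E x⟩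
  · rintro ⟨d, h1, h2, σ, w, hw, T, hT, rfl⟩
    obtain ⟨hn, rfl⟩ := mem_annot₁.1 hT
    obtain ⟨E, x, rfl, rfl⟩ := exists_mark T σ hn
    rw [expand_mark] at hw
    exact ⟨⟨d, x, E.type h⟩, ⟨h1, h2, E, hw, rfl⟩, (rawTuple_mark h E x).symm⟩

/-- The values of the components of an annotated word. -/
def compVals (h : FreeMonoid α →* M) (T : AWord α (Fin d) α) : List M :=
  List.ofFn fun i => hval h (collect i T)

/-- Erasing the payloads leaves precisely the context, so equality of the two erased words says that
both tuples are filled into one common context. -/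
theorem unit_iff {f : ℕ} {h : FreeMonoid α →* M} {K : Finset (List α)}
    {R R' : RawTuple α M} :
    (∃ T T', LearnerRule f h K (.unit (some T) (some T')) ∧ T.raw = R ∧ T'.raw = R') ↔
      ∃ d, 1 ≤ d ∧ d ≤ f ∧ ∃ σ : Equiv.Perm (Fin d), ∃ w ∈ K, ∃ T ∈ annot₁ (List.ofFn σ) w,
        ∃ w' ∈ K, ∃ T' ∈ annot₁ (List.ofFn σ) w', forget T = forget T' ∧
          compVals h T = compVals h T' ∧ rawTuple h T = R ∧ rawTuple h T' = R' := by
  constructor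
  · rintro ⟨T, T', hr, rfl, rfl⟩
    cases hr with
    | @unit d x y E h1 h2 hxy hx hy =>
    exact ⟨d, h1, h2, E.perm, _, hx, mark E x,
      mem_annot₁.2 ⟨names_mark E x, expand_mark id E x⟩, _, hy, mark E y,
      mem_annot₁.2 ⟨names_mark E y, expand_mark id E y⟩, by rw [forget_mark, forget_mark],
      by simp [compVals, collect_mark, hxy], rawTuple_mark h E x, rawTuple_mark h E y⟩
  · rintro ⟨d, h1, h2, σ, w, hw, T, hT, w', hw', T', hT', hf, hv, rfl, rfl⟩
    obtain ⟨hn, rfl⟩ := mem_annot₁.1 hT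
    obtain ⟨hn', rfl⟩ := mem_annot₁.1 hT'
    obtain ⟨E, x, rfl, rfl⟩ := exists_mark T σ hn
    obtain ⟨E', x', -, rfl⟩ := exists_mark T' E.perm hn'
    rw [forget_mark, forget_mark] at hf
    obtain ⟨hb, hp⟩ := interleave_injective hf
    obtain rfl : E = E' := by
      cases E; cases E'
      simp only [SentenceContext.mk.injEq]
      exact ⟨DFunLike.coe_injective hp, hb⟩
    rw [expand_mark] at hw hw'
    simp only [compVals, collect_mark] at hv
    exact ⟨_, _, .unit h1 h2 (fun i => congrFun (List.ofFn_injective hv) i) hw hw',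
      (rawTuple_mark h E x).symm, (rawTuple_mark h E x').symm⟩

theorem term_iff {f : ℕ} (hf : 1 ≤ f) {h : FreeMonoid α →* M} {K : Finset (List α)}
    {R : RawTuple α M} {a : α} :
    (∃ T, LearnerRule f h K (.term (some T) a) ∧ T.raw = R) ↔
      ∃ w ∈ K, ∃ T ∈ annot₁ [(0 : Fin 1)] w, collect 0 T = [a] ∧ rawTuple h T = R := by
  constructor
  · rintro ⟨T, hr, rfl⟩
    cases hr with
    | @term _ τ ho =>
    obtain ⟨-, -, ho⟩ := ho
    change ∃ E : SentenceContext α 1, E.fill (fun _ => [a]) ∈ K ∧ E.type h = τ at ho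
    obtain ⟨E, hE, rfl⟩ := ho
    refine ⟨_, hE, mark E fun _ => [a], mem_annot₁.2 ⟨?_, expand_mark id E _⟩,
      collect_mark E _ 0, rawTuple_mark h E _⟩
    rw [names_mark, Subsingleton.elim E.perm 1]
    rfl
  · rintro ⟨w, hw, T, hT, ha, rfl⟩
    obtain ⟨hn, rfl⟩ := mem_annot₁.1 hT
    obtain ⟨E, x, -, rfl⟩ := exists_mark T 1 hn
    rw [collect_mark] at ha
    have hx : x = fun _ => [a] := by
      funext i
      rw [Subsingleton.elim i 0, ha]
    subst hx
    rw [expand_mark] at hw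
    exact ⟨⟨1, fun _ => [a], E.type h⟩, .term ⟨le_rfl, hf, E, hw, rfl⟩,
      (rawTuple_mark h E _).symm⟩

end Other

end TupleLearner

/-! ### Polynomial-time computation of the enumerations. -/

namespace TupleLearner

open AWord
open Enc (enc)

/-! ## The enumeration is computable in polynomial time -/

namespace Poly

variable {α M V Q C I : Type*} [Enc α] [Enc V] [Enc Q] [Enc C] [Enc I]

theorem size_splits (w : List α) : (enc (splits w)).size ≤
    (enc w).size * ((enc w).size + 3) + 1 := by
  refine (size_list_le (splits w) ((enc w).size + 2) fun p hp => ?_).trans ?_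
  · have h := size_append p.1 p.2
    rw [mem_splits.1 hp] at h
    change (Val.cons (enc p.1) (enc p.2)).size ≤ _
    simp only [Val.size]
    omega
  · rw [length_splits]
    exact Nat.add_le_add_right (Nat.mul_le_mul_right _ (length_le_size w)) 1

theorem splits {w : C → List α} (hw : Poly w) : Poly (fun c => TupleLearner.splits (w c)) := by
  -- The fold carries the current suffix along with its list of splits, because the new split with
  -- empty left part needs the whole suffix.
  have key : ∀ w : List α, w.foldr (fun a s => (a :: s.1, ([], a :: s.1) ::
      s.2.map fun p => (a :: p.1, p.2))) (([] : List α), [(([] : List α), ([] : List α))]) =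
      (w, TupleLearner.splits w) := by
    intro w
    induction w with
    | nil => rfl
    | cons a w ih => rw [List.foldr_cons, ih]; rfl
  have hstep : Poly fun q : (List α × α) × (List α × List (List α × List α)) =>
      (q.1.2 :: q.2.1, (([] : List α), q.1.2 :: q.2.1) ::
        q.2.2.map fun p => (q.1.2 :: p.1, p.2)) := by
    refine pair (cons (snd (fst id)) (fst (snd id)))
      (cons (pair (const []) (cons (snd (fst id)) (fst (snd id)))) ?_)
    exact map (F := fun (q : (List α × α) × (List α × List (List α × List α))) p =>
      (q.1.2 :: p.1, p.2)) (snd (snd id))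
      (pair (cons (snd (fst (fst id))) (fst (snd id))) (snd (snd id)))
  have h : Poly fun w : List α => TupleLearner.splits w := by
    refine (snd (foldr (b := fun _ => (([] : List α), [(([] : List α), ([] : List α))]))
      hstep id (const _) (Polynomial.X + Polynomial.X * (Polynomial.X + 3) + 2)
      fun w l hl => ?_)).congr fun w => by rw [key]
    rw [key]
    have h1 := size_le_of_suffix hl
    have h2 := size_splits l
    have h3 : (enc l).size * ((enc l).size + 3) ≤ (enc w).size * ((enc w).size + 3) := by
      gcongr
    simp only [enc_pair, Val.size, Polynomial.eval_add, Polynomial.eval_mul, Polynomial.eval_X,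
      Polynomial.eval_ofNat]
    omega
  exact h.comp hw

/-- The list of names is a constant of the program, so the recursion unrolls into a fixed number of
nested loops. -/
theorem annot {enum : V → List α → List (List Q)} (henum : ∀ v, Poly (enum v)) (vs : List V) :
    Poly fun w => TupleLearner.annot enum vs w := by
  induction vs with
  | nil => exact cons (map (F := fun _ a => Sum.inl a) id (inl (snd id))) (const [])
  | cons v vs ih =>
    refine flatMap (splits id) (flatMap (splits (snd (snd id)))
      (flatMap ((henum v).comp (fst (snd id))) (map (ih.comp (snd (snd (fst id)))) ?_)))
    refine append (map (F := fun _ a => Sum.inl a) (fst (snd (fst (fst (fst id)))))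
      (inl (snd id))) (cons (inr (pair (const v) (snd (fst id)))) (snd id))

theorem annot₁ (vs : List V) : Poly fun w : List α => TupleLearner.annot₁ vs w :=
  annot (fun _ => cons id (const [])) vs

theorem annot₂ (s : I → List V) (is : List I) :
    Poly fun w : List α => TupleLearner.annot₂ s is w :=
  annot (fun i => annot₁ (s i)) is

theorem names : Poly fun T : AWord α V Q => AWord.names T :=
  (flatMap (F := fun _ q => Sum.elim (fun _ => []) (fun p => [p.1]) q) id
    (sumElim (snd id) (const []) (cons (fst (snd id)) (const [])))).congr fun T =>
      (names_eq_flatMap T).symm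

theorem forget : Poly fun T : AWord α V Q => AWord.forget T :=
  (map (F := fun _ q => Sum.elim Sum.inl (fun p => Sum.inr p.1) q) id
    (sumElim (snd id) (inl (snd id)) (inr (fst (snd id))))).congr fun T => by
      simp only [AWord.forget]
      congr 1

theorem collect [DecidableEq V] [LawfulEnc V] (v : V) :
    Poly fun T : AWord α V Q => AWord.collect v T :=
  flatMap (F := fun _ q => Sum.elim (fun _ => []) (fun p : V × List Q => if p.1 = v then p.2 else []) q) id
    (sumElim (snd id) (const [])
      (ite (eq (fst (snd id)) (const v)) (snd (snd id)) (const [])))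

theorem expand : Poly fun T : AWord α V α => AWord.expand _root_.id T :=
  flatMap (F := fun _ q => Sum.elim (fun a => [a]) (fun p : V × List α => p.2) q) id
    (sumElim (snd id) (cons (snd id) (const [])) (snd (snd id)))

theorem inner : Poly fun U : AWord α I (α ⊕ V × List α) => AWord.inner U :=
  (map (F := fun _ q => Sum.elim Sum.inl
    (fun p => Sum.inr (p.1, AWord.expand _root_.id p.2)) q) id
    (sumElim (snd id) (inl (snd id))
      (inr (pair (fst (snd id)) (expand.comp (snd (snd id))))))).congr fun U => by
      simp only [AWord.inner]
      congr 1

theorem flat : Poly fun U : AWord α I (α ⊕ V × List α) => AWord.flat U :=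
  flatMap (F := fun _ q => Sum.elim (fun a => [Sum.inl a])
    (fun p : I × List (α ⊕ V × List α) => p.2) q) id
    (sumElim (snd id) (cons (inl (snd id)) (const [])) (snd (snd id)))

theorem optionElim {B D : Type*} [Enc B] [Enc D] [Finite V] [LawfulEnc V] {d : V → Option B}
    {v : C → V} {F : C → D}
    {G : C → B → D} (hv : Poly v) (hF : Poly F) (hG : Poly fun q : C × B => G q.1 q.2) :
    Poly fun c => (d (v c)).elim (F c) (G c) := by
  have hd : Poly fun v => (d v).elim (Sum.inl true : Bool ⊕ B) Sum.inr := of_finite _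
  refine (sumElim (F := fun c _ => F c) (hd.comp hv) (hF.comp (fst id)) hG).congr fun c => ?_
  cases d (v c) <;> rfl

theorem restrict [Finite V] [LawfulEnc V] {d : ℕ} (keep : V → Option (Fin d)) :
    Poly fun T : AWord α V α => AWord.restrict keep T :=
  flatMap (F := fun _ q => Sum.elim (fun a => [Sum.inl a]) (fun p : V × List α =>
    (keep p.1).elim (p.2.map .inl) fun j => [.inr (j, p.2)]) q) id
    (sumElim (snd id) (cons (inl (snd id)) (const []))
      (optionElim (fst (snd id)) (map (F := fun _ a => Sum.inl a) (snd (snd id)) (inl (snd id)))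
        (cons (inr (pair (snd id) (snd (snd (fst id))))) (const []))))

theorem length_blockFold_le [Monoid M] {B : Type*} (W : List (M ⊕ B)) (s : List M) :
    (TupleLearner.blockFold W s).length ≤ W.length + s.length := by
  induction W with
  | nil => simp [TupleLearner.blockFold]
  | cons q W ih =>
    cases q with
    | inl m =>
      change (List.modifyHead _ (TupleLearner.blockFold W s)).length ≤ _
      simp only [List.length_modifyHead, List.length_cons]; omega
    | inr b =>
      change (1 :: TupleLearner.blockFold W s).length ≤ _
      simp only [List.length_cons]; omega

theorem toTrace [Finite α] [LawfulEnc α] [Monoid M] [Enc M] (h : FreeMonoid α →* M) : Poly fun T : AWord α V Q => AWord.toTrace h T :=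
  (map (F := fun _ q => Sum.elim (fun a => Sum.inl (hval h [a])) (fun p => Sum.inr p.1) q) id
    (sumElim (snd id) (inl ((of_finite fun a => hval h [a]).comp (snd id)))
      (inr (fst (snd id))))).congr fun T => by
      simp only [AWord.toTrace]
      congr 1

section Monoid

variable [Finite α] [LawfulEnc α] [Monoid M] [Enc M] [Finite M] [LawfulEnc M]

theorem mul {F G : C → M} (hF : Poly F) (hG : Poly G) : Poly fun c => F c * G c :=
  (of_finite fun p : M × M => p.1 * p.2).comp (pair hF hG)

theorem modifyHead_mul {m : C → M} {s : C → List M} (hm : Poly m) (hs : Poly s) :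
    Poly fun c => (s c).modifyHead (m c * ·) := by
  classical
  obtain ⟨k, hk⟩ := exists_size_le (A := M)
  have hhead : Poly fun s : List M => s.foldr (fun a _ => a) 1 :=
    foldr (step := fun _ a _ => a) (b := fun _ => (1 : M)) (snd (fst id)) id (const 1)
      (Polynomial.C k) fun _ _ _ => (hk _).trans (by simp)
  refine (branch (H := fun c => (s c).modifyHead (m c * ·)) hs
    (cons (mul hm (hhead.comp hs)) (tail hs)) (const []) (fun c hc => ?_) fun c hc => ?_)
  · cases hsc : s c with
    | nil => simp [hsc] at hc
    | cons a l => rfl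
  · cases hsc : s c with
    | nil => rfl
    | cons a l => simp [hsc] at hc

/-- Elements of the finite monoid have bounded encodings, and the number of blocks is at most one
more than the length of the trace; this bounds the accumulator. -/
theorem blockFold : Poly fun W : List (M ⊕ V) => TupleLearner.blockFold W [1] := by
  obtain ⟨k, hk⟩ := exists_size_le (A := M)
  refine foldr (b := fun _ => [(1 : M)])
    (step := fun _ q s => Sum.elim (fun m => s.modifyHead (m * ·)) (fun _ => 1 :: s) q)
    (sumElim (snd (fst id)) (modifyHead_mul (snd id) (snd (fst id)))
      (cons (const 1) (snd (fst id)))) id (const _)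
    ((Polynomial.X + 1) * Polynomial.C (k + 1) + 1) fun W l hl => ?_
  refine (size_list_le (TupleLearner.blockFold l [1]) k fun a _ => hk a).trans ?_
  have h1 := length_blockFold_le l [(1 : M)]
  have h2 := hl.length_le
  have h3 := length_le_size W
  simp only [Polynomial.eval_add, Polynomial.eval_mul, Polynomial.eval_X, Polynomial.eval_one,
    Polynomial.eval_C]
  refine Nat.add_le_add_right (Nat.mul_le_mul_right _ ?_) 1
  simp only [List.length_singleton] at h1
  omega

theorem hval (h : FreeMonoid α →* M) : Poly fun w : List α => TupleLearner.hval h w := by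
  obtain ⟨k, hk⟩ := exists_size_le (A := M)
  refine (foldr (b := fun _ => (1 : M)) (step := fun _ a m => TupleLearner.hval h [a] * m)
    (mul ((of_finite fun a => TupleLearner.hval h [a]).comp (snd (fst id))) (snd id)) id (const _)
    (Polynomial.C k) fun _ _ _ => (hk _).trans (by simp)).congr fun w => ?_
  rw [hval_eq_prod, List.prod, List.foldr_map]

theorem rawTuple {d : ℕ} (h : FreeMonoid α →* M) :
    Poly fun T : AWord α (Fin d) α => TupleLearner.rawTuple h T :=
  pair (ofFn fun i => collect i)
    (pair (map (F := fun _ i => Fin.val i) names ((recode fun _ => rfl : Poly (Fin.val (n := d))).comp (snd id)))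
      (blockFold.comp (toTrace h)))

theorem compVals {d : ℕ} (h : FreeMonoid α →* M) :
    Poly fun T : AWord α (Fin d) α => TupleLearner.compVals h T :=
  ofFn fun i => (hval h).comp (collect i)

theorem rawBinary {e dB dC : ℕ} (h : FreeMonoid α →* M) :
    Poly fun U : AWord α (Fin e) (α ⊕ (Fin dB ⊕ Fin dC) × List α) =>
      TupleLearner.rawBinary h U :=
  pair ((rawTuple h).comp inner) (pair (ofFn fun i => forget.comp (collect i))
    (pair ((rawTuple h).comp ((restrict _).comp flat))
      ((rawTuple h).comp ((restrict _).comp flat))))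

end Monoid

end Poly
end TupleLearner

/-! ### Reachability by unit rules, and complete lists of nonterminals and rules. -/

namespace TupleLearner

open AWord
open Enc (enc)

noncomputable instance : DecidableEq Val := Classical.decEq _

/-! ## Transitive closure of a finite relation -/

section Closure

variable {A : Type*}

/-- All pairs of elements of a list. -/
def pairsOf (l : List A) : List (A × A) := l.flatMap fun a => l.map fun b => (a, b)

theorem mem_pairsOf {l : List A} {p : A × A} : p ∈ pairsOf l ↔ p.1 ∈ l ∧ p.2 ∈ l := by
  obtain ⟨a, b⟩ := p
  simp [pairsOf]

/-- Warshall's algorithm for the reflexive transitive closure. -/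
def reachList [DecidableEq A] (l : List A) (r : List (A × A)) : List (A × A) :=
  l.foldl (fun R k => (pairsOf l).filter fun p =>
      decide (p ∈ R ∨ ((p.1, k) ∈ R ∧ (k, p.2) ∈ R)))
    ((pairsOf l).filter fun p => decide (p.1 = p.2 ∨ p ∈ r))

/-- Warshall's invariant: `S` holds the pivots already processed, and the current relation is closed
under composition through each of them. -/
theorem foldl_closure_invariant [DecidableEq A] (P R₀ : List (A × A)) (r : A → A → Prop) (ks S : List A)
    (R : List (A × A)) (hP : ∀ i j k l, (i, j) ∈ P → (k, l) ∈ P → (i, l) ∈ P)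
    (h1 : R ⊆ P) (h2 : ∀ p ∈ R, Relation.ReflTransGen r p.1 p.2) (h3 : R₀ ⊆ R)
    (h4 : ∀ k ∈ S, ∀ i j, (i, k) ∈ R → (k, j) ∈ R → (i, j) ∈ R) :
    let R' := ks.foldl (fun R k => P.filter fun p =>
      decide (p ∈ R ∨ ((p.1, k) ∈ R ∧ (k, p.2) ∈ R))) R
    (∀ p ∈ R', Relation.ReflTransGen r p.1 p.2) ∧ R₀ ⊆ R' ∧ R' ⊆ P ∧
      ∀ k ∈ S ++ ks, ∀ i j, (i, k) ∈ R' → (k, j) ∈ R' → (i, j) ∈ R' := by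
  induction ks generalizing R S with
  | nil => exact ⟨h2, h3, h1, by simpa using h4⟩
  | cons k ks ih =>
    have hmem : ∀ p, p ∈ (P.filter fun p => decide (p ∈ R ∨ ((p.1, k) ∈ R ∧ (k, p.2) ∈ R))) ↔
        p ∈ R ∨ ((p.1, k) ∈ R ∧ (k, p.2) ∈ R) := by
      intro p
      simp only [List.mem_filter, decide_eq_true_eq, and_iff_right_iff_imp]
      rintro (h | h)
      · exact h1 h
      · exact hP _ _ _ _ (h1 h.1) (h1 h.2)
    have := ih (S ++ [k]) (P.filter fun p => decide (p ∈ R ∨ ((p.1, k) ∈ R ∧ (k, p.2) ∈ R)))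
      (fun p hp => List.mem_of_mem_filter hp)
      (fun p hp => by
        rcases (hmem p).1 hp with h | h
        · exact h2 p h
        · exact (h2 _ h.1).trans (h2 _ h.2))
      (fun p hp => (hmem p).2 (.inl (h3 hp)))
      -- For an old pivot, each half is either an old pair or passes through the new pivot `k`.
      -- Composing old pairs at `k'` yields an old pair or a path through `k`; if both halves pass
      -- through `k`, the outer legs suffice.
      (fun k' hk' i j => by
        simp only [hmem]
        rcases List.mem_append.1 hk' with hS | hk
        · have := h4 k' hS
          rintro (a | ⟨a, b⟩) (c | ⟨c, d⟩)
          · exact .inl (this _ _ a c)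
          · exact .inr ⟨this _ _ a c, d⟩
          · exact .inr ⟨a, this _ _ b c⟩
          · exact .inr ⟨a, d⟩
        · obtain rfl := List.mem_singleton.1 hk
          rintro (a | ⟨a, -⟩) (c | ⟨-, d⟩)
          · exact .inr ⟨a, c⟩
          · exact .inr ⟨a, d⟩
          · exact .inr ⟨a, c⟩
          · exact .inr ⟨a, d⟩)
    simpa using this

/-- Edges have both endpoints in `l`, so after all pivots a chain can be extended by its last edge
through a processed pivot. -/
theorem mem_reachList [DecidableEq A] {l : List A} {r : List (A × A)} (hr : ∀ p ∈ r, p.1 ∈ l ∧ p.2 ∈ l)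
    {a b : A} : (a, b) ∈ reachList l r ↔
      a ∈ l ∧ b ∈ l ∧ Relation.ReflTransGen (fun x y => (x, y) ∈ r) a b := by
  have h := foldl_closure_invariant (pairsOf l)
    ((pairsOf l).filter fun p => decide (p.1 = p.2 ∨ p ∈ r)) (fun x y => (x, y) ∈ r) l []
    ((pairsOf l).filter fun p => decide (p.1 = p.2 ∨ p ∈ r))
    (by simp only [mem_pairsOf]; tauto) (fun p hp => List.mem_of_mem_filter hp)
    (by
      rintro ⟨x, y⟩ hp
      simp only [List.mem_filter, decide_eq_true_eq] at hp
      rcases hp.2 with rfl | h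
      · exact .refl
      · exact .single h)
    (fun _ h => h) (by simp)
  obtain ⟨h1, h2, h3, h4⟩ := h
  constructor
  · intro hab
    have := mem_pairsOf.1 (h3 hab)
    exact ⟨this.1, this.2, h1 _ hab⟩
  · rintro ⟨ha, -, hab⟩
    induction hab with
    | refl => exact h2 (by simp [mem_pairsOf, ha])
    | tail _ hbc ih =>
      have := hr _ hbc
      exact h4 _ (by simpa using this.1) _ _ ih (h2 (by simp [mem_pairsOf, this, hbc]))

theorem size_filter_le [Enc A] (l : List A) (p : A → Bool) :
    (enc (l.filter p)).size ≤ (enc l).size := by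
  induction l with
  | nil => simp
  | cons a l ih => cases hp : p a <;> simp only [hp, List.filter_cons, Bool.false_eq_true,
      if_true, if_false, enc_listCons, Val.size] <;> omega

theorem Poly.pairsOf {C : Type*} [Enc A] [Enc C] {L : C → List A} (hL : Poly L) :
    Poly fun c => TupleLearner.pairsOf (L c) :=
  flatMap hL (map (hL.comp (fst id)) (pair (snd (fst id)) (snd id)))

/-- Every intermediate relation is a filtered copy of `pairsOf`, which bounds the accumulator. -/
theorem Poly.reachList {C : Type*} [DecidableEq A] [Enc A] [LawfulEnc A] [Enc C]
    {L : C → List A} {r : C → List (A × A)} (hL : Poly L) (hr : Poly r) :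
    Poly fun c => TupleLearner.reachList (L c) (r c) := by
  obtain ⟨P, hP⟩ := hL.pairsOf.size_bound
  refine foldl (step := fun c R k => (TupleLearner.pairsOf (L c)).filter fun p =>
    decide (p ∈ R ∨ ((p.1, k) ∈ R ∧ (k, p.2) ∈ R))) ?_ hL ?_ P fun c l _ => ?_
  · refine filter (p := fun (q : (C × List (A × A)) × A) p =>
      p ∈ q.1.2 ∨ ((p.1, q.2) ∈ q.1.2 ∧ (q.2, p.2) ∈ q.1.2)) (hL.pairsOf.comp (fst (fst id))) ?_
    exact or (mem (snd id) (snd (fst (fst id))))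
      (and (mem (pair (fst (snd id)) (snd (fst id))) (snd (fst (fst id))))
        (mem (pair (snd (fst id)) (snd (snd id))) (snd (fst (fst id)))))
  · exact filter (p := fun (c : C) (p : A × A) => p.1 = p.2 ∨ p ∈ r c) hL.pairsOf
      (or (eq (fst (snd id)) (snd (snd id))) (mem (snd id) (hr.comp (fst id))))
  · refine le_trans ?_ (hP c)
    rcases List.eq_nil_or_concat l with rfl | ⟨l', k, rfl⟩
    · exact size_filter_le _ _
    · rw [List.concat_eq_append, List.foldl_append]
      exact size_filter_le _ _

end Closure

/-! ## Lists of nonterminals and rules -/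

section Lists

variable {α M : Type*}

noncomputable def permList (d : ℕ) : List (Equiv.Perm (Fin d)) :=
  (Finset.univ : Finset (Equiv.Perm (Fin d))).toList

noncomputable def skeletonList (e dB dC : ℕ) : List (Fin e → List (Fin dB ⊕ Fin dC)) :=
  (finite_linearSkeleton (V := Fin dB ⊕ Fin dC) (e := e)).toFinset.toList

theorem mem_skeletonList {e dB dC : ℕ} {s : Fin e → List (Fin dB ⊕ Fin dC)} :
    s ∈ skeletonList e dB dC ↔ LinearSkeleton s := by
  simp [skeletonList]

variable [Monoid M] (f : ℕ) (h : FreeMonoid α →* M)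

/-- The observed typed tuples. -/
noncomputable def observedList (l : List (List α)) : List (RawTuple α M) :=
  (List.range' 1 f).flatMap fun d => (permList d).flatMap fun (σ : Equiv.Perm (Fin d)) =>
    l.flatMap fun w => (annot₁ (List.ofFn σ) w).map fun T => rawTuple h T

/-- The substitution rules. -/
noncomputable def unitList [DecidableEq α] [DecidableEq M] (l : List (List α)) : List (RawTuple α M × RawTuple α M) :=
  (List.range' 1 f).flatMap fun d => (permList d).flatMap fun (σ : Equiv.Perm (Fin d)) =>
    l.flatMap fun w => (annot₁ (List.ofFn σ) w).flatMap fun T =>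
      l.flatMap fun w' => ((annot₁ (List.ofFn σ) w').filter fun T' =>
        decide (forget T = forget T' ∧ compVals h T = compVals h T')).map fun T' =>
          (rawTuple h T, rawTuple h T')

/-- The targets of the start rules. -/
def startList (l : List (List α)) : List (RawTuple α M) :=
  l.map fun w => ([w], [0], [1, 1])

/-- The terminal rules. -/
def termList [DecidableEq α] (l : List (List α)) : List (RawTuple α M × α) :=
  l.flatMap fun w => (annot₁ [(0 : Fin 1)] w).flatMap fun T =>
    -- This gives the letter of a one-letter component, and nothing for any other component.
    ((collect 0 T).filter fun a => decide (collect 0 T = [a])).map fun a => (rawTuple h T, a)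

/-- The binary rules with given fan-outs. -/
noncomputable def binaryList (e dB dC : ℕ) (l : List (List α)) :
    List (RawTuple α M × (List (List (α ⊕ (Fin dB ⊕ Fin dC))) × (RawTuple α M × RawTuple α M))) :=
  (permList e).flatMap fun (σ : Equiv.Perm (Fin e)) => (skeletonList e dB dC).flatMap fun s =>
    l.flatMap fun w => (annot₂ s (List.ofFn σ) w).map fun U => rawBinary h U

variable {f h}

theorem mem_range'_one {d : ℕ} : d ∈ List.range' 1 f ↔ 1 ≤ d ∧ d ≤ f := by
  rw [List.mem_range'_1]
  omega

variable {K : Finset (List α)} {l : List (List α)}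

theorem mem_observedList (hl : ∀ w, w ∈ l ↔ w ∈ K)
    {R : RawTuple α M} :
    R ∈ observedList f h l ↔ ∃ T, Observed f h K T ∧ T.raw = R := by
  simp [observed_iff, observedList, Nat.lt_one_add_iff, permList, hl, and_assoc]

theorem mem_unitList [DecidableEq α] [DecidableEq M] (hl : ∀ w, w ∈ l ↔ w ∈ K)
    {R R' : RawTuple α M} :
    (R, R') ∈ unitList f h l ↔
      ∃ T T', LearnerRule f h K (.unit (some T) (some T')) ∧ T.raw = R ∧ T'.raw = R' := by
  simp [unit_iff, unitList, Nat.lt_one_add_iff, permList, hl, and_assoc]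

theorem mem_startList (hl : ∀ w, w ∈ l ↔ w ∈ K) {R : RawTuple α M} :
    R ∈ startList l ↔ ∃ T, LearnerRule f h K (.start (some T)) ∧ T.raw = R := by
  have hraw : ∀ w : List α, TypedTuple.raw ⟨1, fun _ : Fin 1 => w, startInterface M⟩ =
      ([w], [0], [1, 1]) := fun w => by simp [TypedTuple.raw, startInterface]
  simp only [startList, List.mem_map, hl]
  constructor
  · rintro ⟨w, hw, rfl⟩
    exact ⟨_, .start hw, hraw w⟩
  · rintro ⟨T, hT, rfl⟩
    cases hT with
    | start hw => exact ⟨_, hw, (hraw _).symm⟩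

theorem mem_termList [DecidableEq α] (hl : ∀ w, w ∈ l ↔ w ∈ K)
    (hf : 1 ≤ f) {R : RawTuple α M} {a : α} :
    (R, a) ∈ termList h l ↔ ∃ T, LearnerRule f h K (.term (some T) a) ∧ T.raw = R := by
  simp only [term_iff hf, termList, hl, List.mem_flatMap, List.mem_map, List.mem_filter,
    decide_eq_true_eq, Prod.mk.injEq]
  constructor
  · rintro ⟨w, hw, T, hT, b, ⟨-, hb⟩, rfl, rfl⟩
    exact ⟨w, hw, T, hT, hb, rfl⟩
  · rintro ⟨w, hw, T, hT, ha, rfl⟩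
    exact ⟨w, hw, T, hT, a, ⟨by simp [ha], ha⟩, rfl, rfl⟩

theorem mem_binaryList (hl : ∀ w, w ∈ l ↔ w ∈ K) {e dB dC : ℕ} {R} :
    R ∈ binaryList h e dB dC l ↔ IsRawBinary h K e dB dC R := by
  simp [binaryList, IsRawBinary, permList, mem_skeletonList, hl]

end Lists

namespace Poly

variable {α M : Type*} [Enc α] [LawfulEnc α] [Finite α] [Enc M] [LawfulEnc M] [Finite M]
  [Monoid M] (f : ℕ) (h : FreeMonoid α →* M)

/-- Arities and permutations range over sets depending only on `f` and are hard-wired; only the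
loops over words and their cuts depend on the input. -/
theorem observedList : Poly (TupleLearner.observedList f h) :=
  flatMap_const _ fun _ _ => flatMap_const _ fun _ _ =>
    flatMap id (map ((annot₁ _).comp (snd id)) ((rawTuple h).comp (snd id)))

theorem unitList [DecidableEq α] [DecidableEq M] : Poly (TupleLearner.unitList f h) :=
  flatMap_const _ fun d _ => flatMap_const _ fun σ _ =>
    flatMap id (flatMap ((annot₁ _).comp (snd id)) (flatMap (fst (fst id))
      (map (F := fun (q : ((List (List α) × List α) × AWord α (Fin d) α) × List α) T' =>
          (TupleLearner.rawTuple h q.1.2, TupleLearner.rawTuple h T'))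
        (filter (p := fun (q : ((List (List α) × List α) × AWord α (Fin d) α) × List α) T' =>
          AWord.forget q.1.2 = AWord.forget T' ∧
          TupleLearner.compVals h q.1.2 = TupleLearner.compVals h T')
          ((annot₁ (List.ofFn σ)).comp (snd id))
          (and (eq (forget.comp (snd (fst (fst id)))) (forget.comp (snd id)))
            (eq ((compVals h).comp (snd (fst (fst id)))) ((compVals h).comp (snd id)))))
        (pair ((rawTuple h).comp (snd (fst (fst id)))) ((rawTuple h).comp (snd id))))))

theorem startList {α M : Type*} [Enc α] [Enc M] [Monoid M] :
    Poly (TupleLearner.startList (α := α) (M := M)) :=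
  map (F := fun _ w => ([w], [0], [1, 1])) id
    (pair (cons (snd id) (const [])) (const _))

theorem termList [DecidableEq α] : Poly (TupleLearner.termList h) :=
  flatMap id (flatMap ((annot₁ _).comp (snd id))
    (map (F := fun q a => (TupleLearner.rawTuple h q.2, a))
      (filter (p := fun q a => AWord.collect 0 q.2 = [a]) ((collect 0).comp (snd id))
        (eq ((collect 0).comp (snd (fst id))) (cons (snd id) (const []))))
      (pair ((rawTuple h).comp (snd (fst id))) (snd id))))

theorem binaryList (e dB dC : ℕ) : Poly (TupleLearner.binaryList h e dB dC) :=
  flatMap_const _ fun _ _ => flatMap_const _ fun _ _ =>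
    flatMap id (map ((annot₂ _ _).comp (snd id)) ((rawBinary h).comp (snd id)))

end Poly

end TupleLearner

/-! ### Injectivity of encodings, correctness of unit elimination, and encoded rule lists. -/

namespace TupleLearner

open AWord
open Enc (enc)

/-! ## Encodings of nonterminals and rules -/

section Encoding

variable {α M : Type*} {s m : ℕ} {eα : α ≃ Fin s} {eM : M ≃ Fin m}

theorem encIdx_injective {β : Type*} {n : ℕ} (e : β ≃ Fin n) : Function.Injective (encIdx e) :=
  fun _ _ h => e.injective (Fin.ext (encNat_injective h))

theorem encList_map {β γ : Type*} (φ : β → γ) (g : γ → Val) (l : List β) :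
    encList g (l.map φ) = encList (fun b => g (φ b)) l := by
  induction l with
  | nil => rfl
  | cons b l ih => simp [encList, ih]

/-- The list form has literally the prescribed encoding, so programs that compute raw tuples already
output nonterminals. -/
theorem enc_raw [Enc α] [Enc M] (hα : (enc : α → Val) = encIdx eα)
    (hM : (enc : M → Val) = encIdx eM) (T : TypedTuple α M) :
    enc T.raw = encNonterminal eα eM (some T) := by
  change Val.cons (encList (encList enc) _) (Val.cons (encList encNat _) (encList enc _)) = _
  rw [hα, hM]
  simp only [TypedTuple.raw, encList_map]
  rfl

theorem encNonterminal_injective : Function.Injective (encNonterminal eα eM) := by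
  let : Enc α := ⟨encIdx eα⟩
  let : Enc M := ⟨encIdx eM⟩
  have : LawfulEnc α := ⟨encIdx_injective eα⟩
  have : LawfulEnc M := ⟨encIdx_injective eM⟩
  intro A B h
  rcases A with _ | T <;> rcases B with _ | T'
  · rfl
  · cases h
  · cases h
  · rw [← enc_raw (eα := eα) (eM := eM) rfl rfl, ← enc_raw (eα := eα) (eM := eM) rfl rfl] at h
    rw [raw_injective (LawfulEnc.inj h)]

theorem encSymbol_injective {dB dC : ℕ} :
    Function.Injective (encSymbol (dB := dB) (dC := dC) eα) := by
  rintro (a | i | i) (b | j | j) h <;>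
    simp only [encSymbol, Val.cons.injEq, encNat, reduceCtorEq, true_and, false_and,
      and_false] at h
  · rw [encIdx_injective eα h]
  · rw [Fin.ext (encNat_injective h)]
  · rw [Fin.ext (encNat_injective h)]

theorem encTemplate_injective {e dB dC : ℕ} :
    Function.Injective (encTemplate (e := e) (dB := dB) (dC := dC) eα) := fun _ _ h =>
  List.ofFn_injective (encList_injective (encList_injective encSymbol_injective) h)

/-- The arities of a template are not part of the code of a binary rule. Well-formedness recovers
them as the fan-outs of the three nonterminals, which is why injectivity is claimed only on
well-formed rules. -/
theorem encRule_injOn {ν : Type*} (G : Grammar α ν) {encν : ν → Val}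
    (hν : Function.Injective encν) :
    Set.InjOn (encRule eα encν) {r | G.WellFormedRule r} := by
  intro r hr r' hr' h
  cases r with
  | start A =>
    cases r' <;> simp only [encRule, Val.cons.injEq, encNat, reduceCtorEq, true_and,
      false_and] at h
    rw [hν h]
  | term A a =>
    cases r' <;> simp only [encRule, Val.cons.injEq, encNat, reduceCtorEq, true_and, false_and,
      and_false] at h
    rw [hν h.1, encIdx_injective eα h.2]
  | unit A B =>
    cases r' <;> simp only [encRule, Val.cons.injEq, encNat, reduceCtorEq, true_and, false_and,
      and_false] at h
    rw [hν h.1, hν h.2]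
  | @binary e dB dC A t B C =>
    cases r' with
    | @binary e' dB' dC' A' t' B' C' =>
      simp only [encRule, Val.cons.injEq, true_and] at h
      obtain ⟨h1, h2, h3, h4⟩ := h
      obtain rfl := hν h1
      obtain rfl := hν h3
      obtain rfl := hν h4
      obtain ⟨-, -, -, -, -, -, rfl, rfl, rfl, -⟩ := hr
      obtain ⟨-, -, -, -, -, -, rfl, rfl, rfl, -⟩ := hr'
      rw [encTemplate_injective h2]
    | _ => simp only [encRule, Val.cons.injEq, encNat, reduceCtorEq, false_and, and_false] at h

end Encoding

/-! ## Extended grammars and unit elimination -/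

section UnitElim

variable {α ν : Type*} {G : Grammar α ν}

theorem UnitReach.wellFormed (hG : ∀ r ∈ G.rules, G.WellFormedRule r) {A B : ν}
    (h : G.UnitReach A B) (h1 : B ∈ G.nts) (h2 : B ≠ G.start) :
    A ∈ G.nts ∧ A ≠ G.start ∧ G.fanout A = G.fanout B := by
  induction h using Relation.ReflTransGen.head_induction_on with
  | refl => exact ⟨h1, h2, rfl⟩
  | head hAC _ ih =>
    obtain ⟨a1, -, a3, -, a5⟩ := hG _ hAC
    exact ⟨a1, a3, a5.trans ih.2.2⟩

theorem wellFormedRule_unitElim (hG : ∀ r ∈ G.rules, G.WellFormedRule r) :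
    ∀ r ∈ G.unitElim.rules, G.WellFormedRule r := by
  intro r hr
  cases hr with
  | start h => exact hG _ h
  | term hAB h =>
    obtain ⟨h1, h2, h3⟩ := hG _ h
    obtain ⟨a1, a2, a3⟩ := UnitReach.wellFormed hG hAB h1 h2
    exact ⟨a1, a2, a3.trans h3⟩
  | binary hAB h =>
    obtain ⟨h1, hC, hD, h2, hC', hD', h3, hrest⟩ := hG _ h
    obtain ⟨a1, a2, a3⟩ := UnitReach.wellFormed hG hAB h1 h2
    exact ⟨a1, hC, hD, a2, hC', hD', a3.trans h3, hrest⟩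

theorem unitFree_unitElim : G.unitElim.UnitFree := by
  intro A B h
  cases h

theorem Derives.of_unitReach {A B : ν} (h : G.UnitReach A B) {d : ℕ} {w : Fin d → List α}
    (hB : G.Derives B w) : G.Derives A w := by
  induction h using Relation.ReflTransGen.head_induction_on with
  | refl => exact hB
  | head hAC _ ih => exact .unit hAC ih

theorem Derives.of_unitElim {A : ν} {d : ℕ} {w : Fin d → List α}
    (h : G.unitElim.Derives A w) : G.Derives A w := by
  induction h with
  | start hr _ ih =>
    cases hr with
    | start hr => exact .start hr ih
  | term hr =>
    cases hr with
    | term hAB hr => exact Derives.of_unitReach hAB (.term hr)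
  | binary hr _ _ ih1 ih2 =>
    cases hr with
    | binary hAB hr => exact Derives.of_unitReach hAB (.binary hr ih1 ih2)
  | unit hr => cases hr

/-- The last rule used at `B` already absorbs a chain of unit rules starting at `B`; the new step
lengthens this chain by one. Start rules are not copied along chains, hence `B ≠ G.start`. -/
theorem Derives.unitElim_of_unit {A B : ν} (h1 : B ≠ G.start) (hAB : Rule.unit A B ∈ G.rules)
    {d : ℕ} {w : Fin d → List α} (h : G.unitElim.Derives B w) : G.unitElim.Derives A w := by
  cases h with
  | start => exact absurd rfl h1
  | term hr =>
    cases hr with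
    | term hBC hr => exact .term (.term (.head hAB hBC) hr)
  | binary hr hu hv =>
    cases hr with
    | binary hBC hr => exact .binary (.binary (.head hAB hBC) hr) hu hv
  | unit hr => cases hr

theorem Derives.to_unitElim (hG : ∀ r ∈ G.rules, G.WellFormedRule r) {A : ν} {d : ℕ}
    {w : Fin d → List α} (h : G.Derives A w) : G.unitElim.Derives A w := by
  induction h with
  | start hr _ ih => exact Grammar.Derives.start (G := G.unitElim) (.start hr) ih
  | term hr => exact .term (.term .refl hr)
  | binary hr _ _ ih1 ih2 => exact .binary (.binary .refl hr) ih1 ih2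
  | unit hr _ ih => exact Derives.unitElim_of_unit (hG _ hr).2.2.2.1 hr ih

theorem language_unitElim (hG : ∀ r ∈ G.rules, G.WellFormedRule r) :
    G.unitElim.language = G.language :=
  Set.ext fun _ => ⟨Derives.of_unitElim, Derives.to_unitElim hG⟩

end UnitElim

/-! ### Well-formedness of the learner grammar. -/

section Learner

variable {α M : Type*} [Monoid M] {f : ℕ} {h : FreeMonoid α →* M} {K : Finset (List α)}

theorem some_mem_nts {T : TypedTuple α M} :
    some T ∈ (learner f h K).nts ↔ Observed f h K T := by
  simp [learner]

theorem wellFormedRule_learner (hf : 1 ≤ f) :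
    ∀ r ∈ (learner f h K).rules, (learner f h K).WellFormedRule r := by
  intro r hr
  cases hr with
  | @start w hw =>
    -- The context consisting of a single hole witnesses that the target of a start rule is
    -- observed.
    refine ⟨some_mem_nts.2 ⟨le_rfl, hf, ⟨1, fun _ => []⟩, ?_, ?_⟩, nofun, rfl⟩
    · simpa [SentenceContext.fill] using hw
    · simp only [SentenceContext.type, startInterface]
      congr 1
      funext i
      exact map_one h
  | term ho => exact ⟨some_mem_nts.2 ho, nofun, rfl⟩
  | binary h1 h2 hE hB hC ht =>
    exact ⟨some_mem_nts.2 ⟨h1, h2, _, hE, rfl⟩, some_mem_nts.2 hB, some_mem_nts.2 hC, nofun, nofun,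
      nofun, rfl, rfl, rfl, ht⟩
  | unit h1 h2 _ hx hy =>
    exact ⟨some_mem_nts.2 ⟨h1, h2, _, hx, rfl⟩, some_mem_nts.2 ⟨h1, h2, _, hy, rfl⟩, nofun, nofun,
      rfl⟩

end Learner

/-! ## Lists of encoded rules -/

section Values

variable {α M : Type*} {s m : ℕ} (eα : α ≃ Fin s)

/-- Programs can only deduplicate codes. By injectivity on `S`, a repetition-free list of codes is
the image of a repetition-free list of the coded objects. -/
theorem exists_nodup_preimage {β γ : Type*} [DecidableEq γ] {g : β → γ} {S : Set β}
    (hg : Set.InjOn g S) (L : List γ) (hL : ∀ v, v ∈ L ↔ ∃ b ∈ S, g b = v) :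
    ∃ l : List β, l.Nodup ∧ (∀ b, b ∈ l ↔ b ∈ S) ∧ L.dedup = l.map g := by
  have key : ∀ L' : List γ, L'.Nodup → (∀ v ∈ L', ∃ b ∈ S, g b = v) →
      ∃ l : List β, L' = l.map g ∧ ∀ b ∈ l, b ∈ S := by
    intro L' _ hL'
    induction L' with
    | nil => exact ⟨[], rfl, by simp⟩
    | cons v L' ih =>
      obtain ⟨b, hb, rfl⟩ := hL' v List.mem_cons_self
      obtain ⟨l, rfl, hl⟩ := ih (by simp_all) fun v hv => hL' v (List.mem_cons_of_mem _ hv)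
      exact ⟨b :: l, rfl, by simpa [hb] using hl⟩
  obtain ⟨l, hl, hlS⟩ := key L.dedup (List.nodup_dedup L) fun v hv =>
    (hL v).1 (List.mem_dedup.1 hv)
  refine ⟨l, ?_, fun b => ⟨hlS b, fun hb => ?_⟩, hl⟩
  · have := List.nodup_dedup L
    rw [hl] at this
    exact this.of_map g
  · have : g b ∈ l.map g := by
      rw [← hl, List.mem_dedup, hL]
      exact ⟨b, hb, rfl⟩
    obtain ⟨b', hb', he⟩ := List.mem_map.1 this
    rwa [← hg (hlS b' hb') hb he]

variable [Enc α] [Enc M] [Monoid M] (f : ℕ) (h : FreeMonoid α →* M)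

def startVals (l : List (List α)) : List Val :=
  (startList (M := M) l).map fun R => .cons (encNat 0) (enc R)

def termVals [DecidableEq α] (l : List (List α)) : List Val :=
  (termList h l).map fun p => .cons (encNat 1) (.cons (enc p.1) (enc p.2))

noncomputable def unitVals [DecidableEq α] [DecidableEq M] (l : List (List α)) : List Val :=
  (unitList f h l).map fun p => .cons (encNat 3) (.cons (enc p.1) (enc p.2))

noncomputable def binaryVals (l : List (List α)) : List Val :=
  (List.range' 1 f).flatMap fun e => (List.range' 1 f).flatMap fun dB =>
    (List.range' 1 f).flatMap fun dC => (binaryList h e dB dC l).map fun R =>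
      .cons (encNat 2) (.cons (enc R.1) (.cons (encList (encList (encSymbol eα)) R.2.1)
        (.cons (enc R.2.2.1) (enc R.2.2.2))))

/-- The encoded rules of the learner grammar. -/
noncomputable def learnerVals [DecidableEq α] [DecidableEq M] (l : List (List α)) : List Val :=
  startVals (M := M) l ++ termVals h l ++ unitVals f h l ++ binaryVals eα f h l

/-- The encoded rules after unit elimination. -/
noncomputable def unitElimVals [DecidableEq α] [DecidableEq M] (l : List (List α)) : List Val :=
  startVals (M := M) l ++ (reachList (observedList f h l) (unitList f h l)).flatMap fun p =>
    -- Terminal and binary rules are both coded as a tag, the left-hand side and the rest, so the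
    -- left-hand side is exchanged without decoding the rule.
    ((termVals h l ++ binaryVals eα f h l).filter fun v => decide (v.tl.hd = enc p.2)).map fun v =>
      .cons v.hd (.cons (enc p.1) v.tl.tl)

/-- The encoded description of a grammar with the nonterminals of the learner grammar. -/
noncomputable def describeVal [DecidableEq α] [DecidableEq M] (rules : List (List α) → List Val) (l : List (List α)) : Val :=
  -- The start symbol is coded by `nil` and has fan-out `1`; the fan-out of any other nonterminal is
  -- its number of components.
  .cons .nil (.cons (enc ((Val.nil, 1) ::
    (observedList f h l).dedup.map fun R => (enc R, R.1.length))) (enc (rules l).dedup))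

variable {eα f h} {eM : M ≃ Fin m}

section Mem

variable {K : Finset (List α)} {l : List (List α)}

theorem mem_startVals {v : Val} (hl : ∀ w, w ∈ l ↔ w ∈ K) (hα : (enc : α → Val) = encIdx eα)
    (hM : (enc : M → Val) = encIdx eM) : v ∈ startVals (M := M) l ↔
      ∃ A, LearnerRule f h K (.start A) ∧ encRule eα (encNonterminal eα eM) (.start A) = v := by
  simp only [startVals, List.mem_map, mem_startList (f := f) (h := h) hl]
  constructor
  · rintro ⟨_, ⟨T, hT, rfl⟩, rfl⟩
    exact ⟨some T, hT, by rw [encRule, ← enc_raw hα hM]⟩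
  · rintro ⟨A, hr, rfl⟩
    have hr' := hr
    cases hr with
    | start hw => exact ⟨_, ⟨_, hr', rfl⟩, by rw [encRule, ← enc_raw hα hM]⟩

theorem mem_termVals [DecidableEq α] {v : Val} (hf : 1 ≤ f) (hl : ∀ w, w ∈ l ↔ w ∈ K)
    (hα : (enc : α → Val) = encIdx eα) :
    v ∈ termVals h l ↔ ∃ T a, LearnerRule f h K (.term (some T) a) ∧
      Val.cons (encNat 1) (.cons (enc T.raw) (encIdx eα a)) = v := by
  simp only [termVals, List.mem_map, hα]
  constructor
  · rintro ⟨⟨R, a⟩, hR, rfl⟩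
    obtain ⟨T, hT, rfl⟩ := (mem_termList hl hf).1 hR
    exact ⟨T, a, hT, rfl⟩
  · rintro ⟨T, a, hr, rfl⟩
    exact ⟨(T.raw, a), (mem_termList hl hf).2 ⟨T, hr, rfl⟩, rfl⟩

theorem mem_unitVals [DecidableEq α] [DecidableEq M] {v : Val} (hl : ∀ w, w ∈ l ↔ w ∈ K) :
    v ∈ unitVals f h l ↔ ∃ T T', LearnerRule f h K (.unit (some T) (some T')) ∧
      Val.cons (encNat 3) (.cons (enc T.raw) (enc T'.raw)) = v := by
  simp only [unitVals, List.mem_map]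
  constructor
  · rintro ⟨⟨R, R'⟩, hR, rfl⟩
    obtain ⟨T, T', hT, rfl, rfl⟩ := (mem_unitList hl).1 hR
    exact ⟨T, T', hT, rfl⟩
  · rintro ⟨T, T', hr, rfl⟩
    exact ⟨(T.raw, T'.raw), (mem_unitList hl).2 ⟨T, T', hr, rfl, rfl⟩, rfl⟩

theorem mem_binaryVals {v : Val} (hl : ∀ w, w ∈ l ↔ w ∈ K) :
    v ∈ binaryVals eα f h l ↔ ∃ (e dB dC : ℕ) (TA TB TC : TypedTuple α M)
      (t : Template α e dB dC), LearnerRule f h K (.binary (some TA) t (some TB) (some TC)) ∧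
      Val.cons (encNat 2) (.cons (enc TA.raw) (.cons (encTemplate eα t)
        (.cons (enc TB.raw) (enc TC.raw)))) = v := by
  simp only [binaryVals, List.mem_flatMap, List.mem_map, mem_range'_one, mem_binaryList hl]
  constructor
  · rintro ⟨e, he, dB, hB, dC, hC, R, hR, rfl⟩
    obtain ⟨TA, TB, TC, t, hr, rfl⟩ := exists_rule_of_isRawBinary he hB hC hR
    exact ⟨e, dB, dC, TA, TB, TC, t, hr, rfl⟩
  · rintro ⟨e, dB, dC, TA, TB, TC, t, hr, rfl⟩
    obtain ⟨he, hB, hC, TA', TB', TC', hA', hB', hC', hR⟩ := isRawBinary_of_rule hr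
    cases hA'
    cases hB'
    cases hC'
    exact ⟨e, he, dB, hB, dC, hC, _, hR, rfl⟩

theorem mem_learnerVals [DecidableEq α] [DecidableEq M] {v : Val} (hf : 1 ≤ f) (hl : ∀ w, w ∈ l ↔ w ∈ K)
    (hα : (enc : α → Val) = encIdx eα) (hM : (enc : M → Val) = encIdx eM) :
    v ∈ learnerVals eα f h l ↔ ∃ r ∈ (learner f h K).rules,
      encRule eα (encNonterminal eα eM) r = v := by
  simp only [learnerVals, List.mem_append, mem_startVals hl hα hM (f := f) (h := h),
    mem_termVals hf hl hα, mem_unitVals hl, mem_binaryVals hl]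
  constructor
  · rintro (((⟨A, hr, rfl⟩ | ⟨T, a, hr, rfl⟩) | ⟨T, T', hr, rfl⟩) |
      ⟨e, dB, dC, TA, TB, TC, t, hr, rfl⟩)
    · exact ⟨_, hr, rfl⟩
    · exact ⟨_, hr, by simp only [encRule, ← enc_raw hα hM]⟩
    · exact ⟨_, hr, by simp only [encRule, ← enc_raw hα hM]⟩
    · exact ⟨_, hr, by simp only [encRule, ← enc_raw hα hM]⟩
  · rintro ⟨r, hr, rfl⟩
    have hr' := hr
    cases hr with
    | start => exact .inl (.inl (.inl ⟨_, hr', rfl⟩))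
    | term => exact .inl (.inl (.inr ⟨_, _, hr', by simp only [encRule, ← enc_raw hα hM]⟩))
    | unit => exact .inl (.inr ⟨_, _, hr', by simp only [encRule, ← enc_raw hα hM]⟩)
    | binary => exact .inr ⟨_, _, _, _, _, _, _, hr', by simp only [encRule, ← enc_raw hα hM]⟩

/-- Chains of raw tuples and chains of nonterminals correspond because `TypedTuple.raw` is injective
and unit rules never involve the start symbol. -/
theorem mem_reachList_observedList {α M : Type*} [Monoid M] [DecidableEq α] [DecidableEq M]
    {f : ℕ} {h : FreeMonoid α →* M} {K : Finset (List α)} {l : List (List α)}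
    (hl : ∀ w, w ∈ l ↔ w ∈ K) {R R' : RawTuple α M} :
    (R, R') ∈ reachList (observedList f h l) (unitList f h l) ↔
      ∃ T T', Observed f h K T ∧ Observed f h K T' ∧
        (learner f h K).UnitReach (some T) (some T') ∧ T.raw = R ∧ T'.raw = R' := by
  have hunit : ∀ T T' : TypedTuple α M, LearnerRule f h K (.unit (some T) (some T')) →
      Observed f h K T ∧ Observed f h K T' := by
    intro T T' hr
    cases hr with
    | unit h1 h2 _ hx hy => exact ⟨⟨h1, h2, _, hx, rfl⟩, ⟨h1, h2, _, hy, rfl⟩⟩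
  rw [mem_reachList]
  · simp only [mem_observedList hl]
    constructor
    · rintro ⟨⟨T, hT, rfl⟩, ⟨T', hT', rfl⟩, hreach⟩
      refine ⟨T, T', hT, hT', ?_, rfl, rfl⟩
      have key : ∀ S, Relation.ReflTransGen (fun x y => (x, y) ∈ unitList f h l) T.raw S →
          ∀ T', S = T'.raw → (learner f h K).UnitReach (some T) (some T') := by
        intro S hS
        induction hS with
        | refl => intro T' hT'; rw [raw_injective hT']; exact .refl
        | tail _ hbc ih =>
          intro T' hT'
          obtain ⟨T₁, T₂, hr, rfl, h2⟩ := (mem_unitList hl).1 hbc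
          rw [hT'] at h2
          obtain rfl := raw_injective h2
          exact .tail (ih T₁ rfl) hr
      exact key _ hreach _ rfl
    · rintro ⟨T, T', hT, hT', hreach, rfl, rfl⟩
      refine ⟨⟨T, hT, rfl⟩, ⟨T', hT', rfl⟩, ?_⟩
      have key : ∀ B, (learner f h K).UnitReach (some T) B → ∃ T', B = some T' ∧
          Relation.ReflTransGen (fun x y => (x, y) ∈ unitList f h l) T.raw T'.raw := by
        intro B hB
        induction hB with
        | refl => exact ⟨T, rfl, .refl⟩
        | tail _ hbc ih =>
          obtain ⟨T₁, rfl, ih⟩ := ih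
          have hbc' : LearnerRule f h K _ := hbc
          cases hbc' with
          | unit => exact ⟨_, rfl, .tail ih ((mem_unitList hl).2 ⟨_, _, hbc, rfl, rfl⟩)⟩
      obtain ⟨T₂, hT₂, hr⟩ := key _ hreach
      cases hT₂
      exact hr
  · rintro ⟨R, R'⟩ hp
    obtain ⟨T, T', hr, rfl, rfl⟩ := (mem_unitList hl).1 hp
    obtain ⟨h1, h2⟩ := hunit _ _ hr
    exact ⟨(mem_observedList hl).2 ⟨T, h1, rfl⟩, (mem_observedList hl).2 ⟨T', h2, rfl⟩⟩

theorem mem_unitElimVals [DecidableEq α] [DecidableEq M] {v : Val} (hf : 1 ≤ f) (hl : ∀ w, w ∈ l ↔ w ∈ K)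
    (hα : (enc : α → Val) = encIdx eα) (hM : (enc : M → Val) = encIdx eM) :
    v ∈ unitElimVals eα f h l ↔ ∃ r ∈ (learner f h K).unitElim.rules,
      encRule eα (encNonterminal eα eM) r = v := by
  have : LawfulEnc α := ⟨by rw [hα]; exact encIdx_injective eα⟩
  have : LawfulEnc M := ⟨by rw [hM]; exact encIdx_injective eM⟩
  -- Well-formedness travels backwards along a chain. This places its left end among the observed
  -- tuples, as membership in `reachList` requires even for the empty chain.
  have hobs : ∀ {T T' : TypedTuple α M}, (learner f h K).UnitReach (some T) (some T') →
      Observed f h K T' → Observed f h K T := fun hr hT' =>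
    some_mem_nts.1 (UnitReach.wellFormed (wellFormedRule_learner hf) hr
      (some_mem_nts.2 hT') nofun).1
  have hsome : ∀ {A : Option (TypedTuple α M)} {T' : TypedTuple α M},
      (learner f h K).UnitReach A (some T') → Observed f h K T' → ∃ T, A = some T := by
    intro A T' hr hT'
    cases A with
    | some T => exact ⟨T, rfl⟩
    | none => exact absurd rfl (UnitReach.wellFormed (wellFormedRule_learner hf) hr
        (some_mem_nts.2 hT') nofun).2.1
  simp only [unitElimVals, List.mem_append, mem_startVals hl hα hM (f := f) (h := h),
    List.mem_flatMap, List.mem_map, List.mem_filter, decide_eq_true_eq,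
    mem_termVals hf hl hα, mem_binaryVals hl]
  constructor
  · rintro (⟨A, hr, rfl⟩ | ⟨⟨R, R'⟩, hp, _, ⟨hv, he⟩, rfl⟩)
    · exact ⟨_, .start hr, rfl⟩
    · obtain ⟨T, T', hT, hT', hreach, rfl, rfl⟩ := (mem_reachList_observedList hl).1 hp
      rcases hv with ⟨T₁, a, hr, rfl⟩ | ⟨e, dB, dC, TA, TB, TC, t, hr, rfl⟩
      · obtain rfl := raw_injective (LawfulEnc.inj he)
        exact ⟨_, .term hreach hr, by simp only [encRule, ← enc_raw hα hM]; rfl⟩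
      · obtain rfl := raw_injective (LawfulEnc.inj he)
        exact ⟨_, .binary hreach hr, by simp only [encRule, ← enc_raw hα hM]; rfl⟩
  · rintro ⟨r, hr, rfl⟩
    cases hr with
    | start hr => exact .inl ⟨_, hr, rfl⟩
    | term hreach hr =>
      have hr' : LearnerRule f h K _ := hr
      cases hr' with
      | term ho =>
        obtain ⟨T, rfl⟩ := hsome hreach ho
        exact .inr ⟨(T.raw, _), (mem_reachList_observedList hl).2
          ⟨T, _, hobs hreach ho, ho, hreach, rfl, rfl⟩, _,
          ⟨.inl ⟨_, _, hr, rfl⟩, rfl⟩, by simp only [encRule, ← enc_raw hα hM]; rfl⟩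
    | binary hreach hr =>
      have hr' : LearnerRule f h K _ := hr
      cases hr' with
      | binary h1 h2 hE hB hC =>
        have ho : Observed f h K ⟨_, _, SentenceContext.type h _⟩ := ⟨h1, h2, _, hE, rfl⟩
        obtain ⟨T, rfl⟩ := hsome hreach ho
        exact .inr ⟨(T.raw, _), (mem_reachList_observedList hl).2
          ⟨T, _, hobs hreach ho, ho, hreach, rfl, rfl⟩, _,
          ⟨.inr ⟨_, _, _, _, _, _, _, hr, rfl⟩, rfl⟩,
          by simp only [encRule, ← enc_raw hα hM]; rfl⟩

end Mem

end Values

end TupleLearner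

/-! ### Explicit programs, and bounds on the number of nonterminals and rules. -/

namespace TupleLearner

open AWord
open Enc (enc)

/-! ## The grammars are constructible in polynomial time -/

namespace Poly

variable {A B C : Type*} [Enc A] [Enc B] [Enc C]

theorem of_enc_eq {F : A → B} {G : A → C} (hF : Poly F) (h : ∀ a, enc (G a) = enc (F a)) :
    Poly G := by
  obtain ⟨p, P, hp⟩ := hF
  refine ⟨p, P, fun a ρ => ?_⟩
  rw [h]
  exact hp a ρ

theorem encVal {F : A → B} (hF : Poly F) : Poly fun a => enc (F a) := of_enc_eq hF fun _ => rfl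

/-- A unary numeral is a list of `nil`s, so computing the length means overwriting all entries. -/
theorem length {L : A → List B} (hL : Poly L) : Poly fun a => (L a).length :=
  of_enc_eq (map (F := fun _ _ => Val.nil) hL (const _)) fun a => by
    induction L a with
    | nil => rfl
    | cons b l ih => exact congrArg (Val.cons Val.nil) ih

theorem encList₂ {L : A → List (List B)} {g : B → Val} (hL : Poly L) (hg : Poly g) :
    Poly fun a => encList (encList g) (L a) :=
  of_enc_eq (map (F := fun _ w => w.map g) hL
    (map (F := fun _ b => g b) (snd id) (hg.comp (snd id)))) fun a => by
      change _ = encList (encList enc) _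
      rw [encList_map]
      simp only [encList_map]
      rfl

section Rules

variable {α M : Type*} {s : ℕ} {eα : α ≃ Fin s} [Enc α] [LawfulEnc α] [Finite α] [Enc M]
  [LawfulEnc M] [Finite M] [Monoid M] [DecidableEq α] [DecidableEq M] {f : ℕ}
  {h : FreeMonoid α →* M}

theorem startVals {α M : Type*} [Enc α] [Enc M] [Monoid M] :
    Poly (TupleLearner.startVals (α := α) (M := M)) :=
  map (F := fun _ R => Val.cons (encNat 0) (enc R)) startList
    (valCons (const _) (encVal (snd id)))

theorem termVals {α M : Type*} [Enc α] [LawfulEnc α] [Finite α] [Enc M]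
    [LawfulEnc M] [Finite M] [Monoid M] [DecidableEq α] {h : FreeMonoid α →* M} :
    Poly (TupleLearner.termVals h) :=
  map (F := fun _ (p : RawTuple α M × α) => Val.cons (encNat 1) (.cons (enc p.1) (enc p.2))) (termList h)
    (valCons (const _) (valCons (encVal (fst (snd id))) (encVal (snd (snd id)))))

theorem unitVals : Poly (TupleLearner.unitVals f h) :=
  map (F := fun _ (p : RawTuple α M × RawTuple α M) => Val.cons (encNat 3) (.cons (enc p.1) (enc p.2))) (unitList f h)
    (valCons (const _) (valCons (encVal (fst (snd id))) (encVal (snd (snd id)))))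

theorem binaryVals {α M : Type*} {s : ℕ} {eα : α ≃ Fin s} [Enc α] [LawfulEnc α] [Finite α] [Enc M]
    [LawfulEnc M] [Finite M] [Monoid M] {f : ℕ} {h : FreeMonoid α →* M} :
    Poly (TupleLearner.binaryVals eα f h) :=
  flatMap_const _ fun e _ => flatMap_const _ fun dB _ => flatMap_const _ fun dC _ =>
    map (F := fun _ R => Val.cons (encNat 2) (.cons (enc R.1)
      (.cons (encList (encList (encSymbol eα)) R.2.1) (.cons (enc R.2.2.1) (enc R.2.2.2)))))
      (binaryList h e dB dC)
      (valCons (const _) (valCons (encVal (fst (snd id)))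
        (valCons (encList₂ (fst (snd (snd id))) (of_finite _))
          (valCons (encVal (fst (snd (snd (snd id))))) (encVal (snd (snd (snd (snd id)))))))))

theorem learnerVals : Poly (TupleLearner.learnerVals eα f h) :=
  append (append (append startVals termVals) unitVals) binaryVals

theorem unitElimVals : Poly (TupleLearner.unitElimVals eα f h) := by
  have hb : Poly fun l => TupleLearner.termVals h l ++ TupleLearner.binaryVals eα f h l :=
    append termVals binaryVals
  have hs : Poly (TupleLearner.startVals (α := α) (M := M)) := startVals
  refine append hs (flatMap (reachList (observedList f h) (unitList f h)) ?_)
  have hd : Poly fun v : Val => v.hd := hdEnc id fun _ => rfl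
  have tl : Poly fun v : Val => v.tl := tlEnc id fun _ => rfl
  exact map (F := fun (q : List (List α) × (RawTuple α M × RawTuple α M)) v =>
      Val.cons v.hd (.cons (enc q.2.1) v.tl.tl))
    (filter (p := fun (q : List (List α) × (RawTuple α M × RawTuple α M)) v =>
        v.tl.hd = enc q.2.2)
      (hb.comp (fst id))
      (eq (hd.comp (tl.comp (snd id))) (encVal (snd (snd (fst id))))))
    (valCons (hd.comp (snd id))
      (valCons (encVal (fst (snd (fst id)))) (tl.comp (tl.comp (snd id)))))

theorem describeVal {rules : List (List α) → List Val} (hr : Poly rules) :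
    Poly (TupleLearner.describeVal f h rules) :=
  valCons (const _) (valCons (encVal (cons (const _)
    (map (F := fun _ R => (enc R, R.1.length)) (dedup (observedList f h))
      (pair (encVal (snd id)) (length (fst (snd id))))))) (encVal (dedup hr)))

end Rules

end Poly

section Construct

/-- For `x ≥ 1` every power is at most the top one, so the sum of the coefficients serves as the
constant. -/
theorem eval_le_mul_pow (P : Polynomial ℕ) {x : ℕ} (hx : 1 ≤ x) :
    P.eval x ≤ P.eval 1 * x ^ P.natDegree := by
  rw [Polynomial.eval_eq_sum_range, Polynomial.eval_eq_sum_range, Finset.sum_mul]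
  refine Finset.sum_le_sum fun i hi => ?_
  rw [one_pow, mul_one]
  exact Nat.mul_le_mul_left _ (Nat.pow_le_pow_right hx (by simpa [Nat.lt_succ_iff] using hi))

/-- The positive size of a list of words. -/
def wordSum {α : Type*} (l : List (List α)) : ℕ := (l.map fun w => max 1 w.length).sum

theorem sampleSize_eq_wordSum {α : Type*} {K : Finset (List α)} {l : List (List α)}
    (hnd : l.Nodup) (hl : ∀ w, w ∈ l ↔ w ∈ K) : sampleSize K = wordSum l := by
  classical
  have : K = l.toFinset := by ext w; simp [hl]
  rw [sampleSize, this, List.sum_toFinset _ hnd]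
  rfl

/-- Each letter costs at most `k + 1` nodes and each word two more; charging at least one letter to
every word covers the empty word too. -/
theorem size_enc_words_le {α : Type*} [Enc α] {k : ℕ} (hk : ∀ a : α, (enc a).size ≤ k)
    (l : List (List α)) : (enc l).size ≤ (k + 3) * wordSum l + 1 := by
  induction l with
  | nil => simp [Val.size]
  | cons w l ih =>
    have h1 := size_list_le w k fun a _ => hk a
    have h2 : w.length * (k + 1) ≤ max 1 w.length * (k + 1) :=
      Nat.mul_le_mul_right _ (le_max_right _ _)
    have h3 : 1 ≤ max 1 w.length := le_max_left _ _
    have h4 : wordSum (w :: l) = max 1 w.length + wordSum l := by simp [wordSum]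
    rw [enc_listCons, Val.size, h4]
    nlinarith

variable {α M : Type*} {s m : ℕ} {eα : α ≃ Fin s} {eM : M ≃ Fin m} [Monoid M] {f : ℕ}
  {h : FreeMonoid α →* M}

theorem describes_describeVal [Enc α] [Enc M] [DecidableEq α] [DecidableEq M]
    (hα : (enc : α → Val) = encIdx eα) (hM : (enc : M → Val) = encIdx eM)
    {K : Finset (List α)} {l : List (List α)} (hl : ∀ w, w ∈ l ↔ w ∈ K)
    {G : Grammar α (Option (TypedTuple α M))} (h1 : G.nts = (learner f h K).nts)
    (h2 : G.start = none) (h3 : G.fanout = (learner f h K).fanout)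
    (hwf : ∀ r ∈ G.rules, G.WellFormedRule r) {rules : List (List α) → List Val}
    (hrules : ∀ v, v ∈ rules l ↔ ∃ r ∈ G.rules, encRule eα (encNonterminal eα eM) r = v) :
    Describes eα (encNonterminal eα eM) (describeVal f h rules l) G := by
  obtain ⟨rs, hnd, hmem, hrs⟩ := exists_nodup_preimage
    ((encRule_injOn G encNonterminal_injective).mono hwf) (rules l) hrules
  obtain ⟨ts, tnd, tmem, hts⟩ := exists_nodup_preimage (S := {T | Observed f h K T})
    raw_injective.injOn (observedList f h l) fun R => mem_observedList hl
  refine ⟨none :: ts.map some, rs, ?_, fun A => ?_, hnd, hmem, ?_⟩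
  · exact List.nodup_cons.2 ⟨by simp, tnd.map (Option.some_injective _)⟩
  · rw [h1]
    cases A with
    | none => simp [learner]
    | some T => simpa [some_mem_nts] using tmem T
  · rw [describeVal, hrs, hts, h2, h3]
    change Val.cons _ (.cons (.cons (.cons _ _) (encList enc _)) (encList enc _)) = _
    rw [encList_map, encList_map, encList_map]
    congr 2
    simp only [encList, encList_map]
    congr 2
    funext T
    rw [enc_pair, enc_val, enc_raw hα hM]
    simp only [TypedTuple.raw, List.length_ofFn]
    rfl

theorem polyConstructible_of_poly {G : Finset (List α) → Grammar α (Option (TypedTuple α M))}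
    (h1 : ∀ K, (G K).nts = (learner f h K).nts) (h2 : ∀ K, (G K).start = none)
    (h3 : ∀ K, (G K).fanout = (learner f h K).fanout)
    (hwf : ∀ K, ∀ r ∈ (G K).rules, (G K).WellFormedRule r) [Enc α] [Enc M] [DecidableEq α]
    [DecidableEq M] (hα : (enc : α → Val) = encIdx eα) (hM : (enc : M → Val) = encIdx eM)
    {rules : List (List α) → List Val} (hr : Poly rules)
    (hrules : ∀ K l, (∀ w, w ∈ l ↔ w ∈ K) →
      ∀ v, v ∈ rules l ↔ ∃ r ∈ (G K).rules, encRule eα (encNonterminal eα eM) r = v) :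
    PolyConstructible eα (encNonterminal eα eM) G := by
  have : LawfulEnc α := ⟨by rw [hα]; exact encIdx_injective eα⟩
  have : LawfulEnc M := ⟨by rw [hM]; exact encIdx_injective eM⟩
  have : Finite α := .intro eα
  have : Finite M := .intro eM
  obtain ⟨p, P, hp⟩ := Poly.describeVal (f := f) (h := h) hr
  obtain ⟨k, hk⟩ := Poly.exists_size_le (A := α)
  let Q := P.comp (Polynomial.C (k + 3) * Polynomial.X + 1)
  refine ⟨p, Q.eval 1, Q.natDegree, fun K l hnd hl => ?_⟩
  obtain ⟨n, hev, hn, hs⟩ := hp l []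
  have hsize : (enc l).size ≤ (k + 3) * max 1 (sampleSize K) + 1 := by
    rw [sampleSize_eq_wordSum hnd hl]
    exact (size_enc_words_le hk l).trans
      (Nat.add_le_add_right (Nat.mul_le_mul_left _ (le_max_right _ _)) 1)
  have hP : P.eval (enc l).size ≤ Q.eval 1 * max 1 (sampleSize K) ^ Q.natDegree := by
    refine (eval_mono P hsize).trans (le_trans (le_of_eq ?_)
      (eval_le_mul_pow Q (le_max_left 1 (sampleSize K))))
    simp [Q]
  have henc : enc l = encSample eα l := by
    change encList (encList enc) l = _
    rw [hα]
    rfl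
  rw [henc] at hev
  exact ⟨_, n, hev, describes_describeVal hα hM hl (h1 K) (h2 K) (h3 K) (hwf K) (hrules K l hl),
    hn.trans hP, hs.trans hP⟩

theorem polyConstructible_learner (hf : 1 ≤ f) :
    PolyConstructible eα (encNonterminal eα eM) (learner f h) := by
  classical
  let : Enc α := ⟨encIdx eα⟩
  let : Enc M := ⟨encIdx eM⟩
  have : LawfulEnc α := ⟨encIdx_injective eα⟩
  have : LawfulEnc M := ⟨encIdx_injective eM⟩
  have : Finite α := .intro eα
  have : Finite M := .intro eM
  exact polyConstructible_of_poly (f := f) (h := h) (fun _ => rfl) (fun _ => rfl) (fun _ => rfl)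
    (fun _ => wellFormedRule_learner hf) rfl rfl (Poly.learnerVals (eα := eα) (f := f) (h := h))
    fun _ _ hl _ => mem_learnerVals hf hl rfl rfl

theorem polyConstructible_unitElim (hf : 1 ≤ f) :
    PolyConstructible eα (encNonterminal eα eM) fun K => (learner f h K).unitElim := by
  classical
  let : Enc α := ⟨encIdx eα⟩
  let : Enc M := ⟨encIdx eM⟩
  have : LawfulEnc α := ⟨encIdx_injective eα⟩
  have : LawfulEnc M := ⟨encIdx_injective eM⟩
  have : Finite α := .intro eα
  have : Finite M := .intro eM
  exact polyConstructible_of_poly (f := f) (h := h) (fun _ => rfl) (fun _ => rfl) (fun _ => rfl)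
    (fun _ => wellFormedRule_unitElim (wellFormedRule_learner hf)) rfl rfl
    (Poly.unitElimVals (eα := eα) (f := f) (h := h))
    fun _ _ hl _ => mem_unitElimVals hf hl rfl rfl

/-- Finiteness is read off from constructibility: an explicit description lists all nonterminals and
all rules. -/
theorem isExtended_unitElim (eα : α ≃ Fin s) (eM : M ≃ Fin m) (hf : 1 ≤ f)
    (K : Finset (List α)) : (learner f h K).unitElim.IsExtended := by
  obtain ⟨p, c, k, H⟩ := polyConstructible_unitElim (eα := eα) (eM := eM) (h := h) hf
  obtain ⟨v, n, -, ⟨nts, rules, -, hn, -, hr, -⟩, -⟩ := H K K.toList K.nodup_toList (by simp)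
  refine ⟨nts.finite_toSet.subset fun A hA => (hn A).2 hA,
    rules.finite_toSet.subset fun A hA => (hr A).2 hA, ?_, rfl, fun A hA => ?_,
    wellFormedRule_unitElim (wellFormedRule_learner hf)⟩
  · intro T hT
    cases hT
  · cases A with
    | none => exact one_pos
    | some T => exact (hA T rfl).1

end Construct

/-! ## The number of nonterminals and rules -/

section Count

variable {α M : Type*}

/-- Superadditivity of powers keeps the exponent unchanged when bounds for single words are summed
over the sample. -/
theorem pow_add_pow_le_add_pow (a b : ℕ) {k : ℕ} (hk : 1 ≤ k) : a ^ k + b ^ k ≤ (a + b) ^ k := by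
  obtain ⟨j, rfl⟩ := Nat.exists_eq_add_of_le' hk
  have h1 : a ^ j ≤ (a + b) ^ j := Nat.pow_le_pow_left (by omega) _
  have h2 : b ^ j ≤ (a + b) ^ j := Nat.pow_le_pow_left (by omega) _
  calc a ^ (j + 1) + b ^ (j + 1) = a ^ j * a + b ^ j * b := by ring
    _ ≤ (a + b) ^ j * a + (a + b) ^ j * b :=
      Nat.add_le_add (Nat.mul_le_mul_right _ h1) (Nat.mul_le_mul_right _ h2)
    _ = (a + b) ^ (j + 1) := by ring

theorem length_flatMap_words_le {B : Type*} (l : List (List α)) (F : List α → List B) {k c : ℕ}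
    (hk : 1 ≤ k) (h : ∀ w ∈ l, (F w).length ≤ c * max 1 w.length ^ k) :
    (l.flatMap F).length ≤ c * wordSum l ^ k := by
  induction l with
  | nil => simp
  | cons w l ih =>
    have h1 := ih fun v hv => h v (List.mem_cons_of_mem _ hv)
    have h2 := h w List.mem_cons_self
    have h3 : wordSum (w :: l) = max 1 w.length + wordSum l := by simp [wordSum]
    rw [List.flatMap_cons, List.length_append, h3]
    refine (Nat.add_le_add h2 h1).trans ?_
    rw [← Nat.mul_add]
    exact Nat.mul_le_mul_left _ (pow_add_pow_le_add_pow _ _ hk)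

theorem succ_length_pow_le (w : List α) {j k : ℕ} (hjk : j ≤ k) :
    (w.length + 1) ^ j ≤ 2 ^ k * max 1 w.length ^ k := by
  rw [← mul_pow]
  refine (Nat.pow_le_pow_left (m := 2 * max 1 w.length) ?_ j).trans (Nat.pow_le_pow_right ?_ hjk)
  · omega
  · omega

theorem length_permList_le {d f : ℕ} (h : d ≤ f) : (permList d).length ≤ f.factorial := by
  rw [permList, Finset.length_toList, Finset.card_univ, Fintype.card_perm, Fintype.card_fin]
  exact Nat.factorial_le h

variable [Monoid M] {f : ℕ} {h : FreeMonoid α →* M} (l : List (List α))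

theorem length_annot₁_perm_le {d : ℕ} (hd : d ≤ f) (σ : Equiv.Perm (Fin d)) (w : List α) :
    (annot₁ (List.ofFn σ) w).length ≤ 2 ^ (2 * f) * max 1 w.length ^ (2 * f) := by
  refine (length_annot₁_le _ w).trans ?_
  rw [List.length_ofFn]
  exact succ_length_pow_le w (by omega)

theorem length_observedList_le (hf : 1 ≤ f) : (observedList f h l).length ≤
    f * (f.factorial * (2 ^ (2 * f) * wordSum l ^ (2 * f))) := by
  refine (length_flatMap_le _ _ _ fun d hd => ?_).trans_eq (by rw [List.length_range'])
  have hd := (mem_range'_one.1 hd).2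
  refine (length_flatMap_le _ _ _ fun σ _ => ?_).trans
    (Nat.mul_le_mul_right _ (length_permList_le hd))
  refine length_flatMap_words_le _ _ (by omega) fun w _ => ?_
  rw [List.length_map]
  exact length_annot₁_perm_le hd σ w

theorem length_unitList_le [DecidableEq α] [DecidableEq M] (hf : 1 ≤ f) :
    (unitList f h l).length ≤
      f * (f.factorial * (2 ^ (4 * f) * wordSum l ^ (4 * f))) := by
  refine (length_flatMap_le _ _ _ fun d hd => ?_).trans_eq (by rw [List.length_range'])
  have hd := (mem_range'_one.1 hd).2
  refine (length_flatMap_le _ _ _ fun σ _ => ?_).trans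
    (Nat.mul_le_mul_right _ (length_permList_le hd))
  -- One factor of exponent `2f` counts the marked words `T`, the other the marked words `T'`. The
  -- two sums over the sample are taken separately.
  have key : 2 ^ (4 * f) * wordSum l ^ (4 * f) =
      2 ^ (2 * f) * (2 ^ (2 * f) * wordSum l ^ (2 * f)) * wordSum l ^ (2 * f) := by ring
  rw [key]
  refine length_flatMap_words_le _ _ (by omega) fun w _ => ?_
  refine (length_flatMap_le _ _ (2 ^ (2 * f) * wordSum l ^ (2 * f)) fun T _ => ?_).trans
    ((Nat.mul_le_mul_right _ (length_annot₁_perm_le hd σ w)).trans_eq (by ring))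
  refine length_flatMap_words_le _ _ (by omega) fun w' _ => ?_
  rw [List.length_map]
  exact (List.length_filter_le _ _).trans (length_annot₁_perm_le hd σ w')

theorem length_startList_le : (startList (M := M) l).length ≤ wordSum l := by
  rw [startList, List.length_map]
  induction l with
  | nil => simp
  | cons w l ih =>
    have h3 : wordSum (w :: l) = max 1 w.length + wordSum l := by simp [wordSum]
    rw [h3, List.length_cons]
    omega

/-- A single marked factor has two cuts, whence the exponent `2` and the constant `2 ^ 2`; each
marked word yields at most one letter. -/
theorem length_termList_le [DecidableEq α] : (termList h l).length ≤ 4 * wordSum l ^ 2 := by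
  refine length_flatMap_words_le _ _ (by omega) fun w _ => ?_
  refine (length_flatMap_le _ _ 1 fun T _ => ?_).trans ?_
  · rw [List.length_map]
    rcases hc : collect 0 T with _ | ⟨a, _ | ⟨b, v⟩⟩
    · simp
    · simp
    · simp
  · rw [mul_one]
    exact (length_annot₁_le _ w).trans (succ_length_pow_le w le_rfl)

theorem exists_skeletonList_length_le (f : ℕ) : ∃ c, ∀ e ≤ f, ∀ dB ≤ f, ∀ dC ≤ f,
    (skeletonList e dB dC).length ≤ c := by
  let g : ℕ × ℕ × ℕ → ℕ := fun p => (skeletonList p.1 p.2.1 p.2.2).length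
  let S := Finset.range (f + 1) ×ˢ Finset.range (f + 1) ×ˢ Finset.range (f + 1)
  refine ⟨S.sup g, fun e he dB hB dC hC => ?_⟩
  refine Finset.le_sup (f := g) (b := (e, dB, dC)) ?_
  simp only [S, Finset.mem_product, Finset.mem_range]
  omega

/-- There are `e` outer names and, by linearity, `dB + dC` inner names in total, each with two cuts.
The exponent is `2 * (e + dB + dC) ≤ 6 * f`. -/
theorem length_binaryList_le {e dB dC c : ℕ} (he : 1 ≤ e ∧ e ≤ f) (hB : dB ≤ f) (hC : dC ≤ f)
    (hc : (skeletonList e dB dC).length ≤ c) : (binaryList h e dB dC l).length ≤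
      f.factorial * (c * (2 ^ (6 * f) * wordSum l ^ (6 * f))) := by
  refine (length_flatMap_le _ _ _ fun σ _ => ?_).trans
    (Nat.mul_le_mul_right _ (length_permList_le he.2))
  refine (length_flatMap_le _ _ _ fun s hs => ?_).trans (Nat.mul_le_mul_right _ hc)
  refine length_flatMap_words_le _ _ (by omega) fun w _ => ?_
  rw [List.length_map]
  refine (length_annot₂_le _ _ w).trans (succ_length_pow_le w ?_)
  have hsum := sum_length_linearSkeleton (mem_skeletonList.1 hs)
  rw [List.length_flatten, List.map_ofFn, List.sum_ofFn, Fintype.card_sum, Fintype.card_fin,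
    Fintype.card_fin] at hsum
  have hperm : ((List.ofFn σ).map fun i => 2 * (s i).length).sum =
      2 * ∑ i, (s i).length := by
    rw [List.map_ofFn, List.sum_ofFn, Finset.mul_sum]
    exact Equiv.sum_comp σ fun i => 2 * (s i).length
  simp only [Function.comp_apply] at hsum
  rw [hperm, List.length_ofFn, hsum]
  omega

theorem length_binaryVals_le [Enc α] [Enc M] {s c : ℕ} (eα : α ≃ Fin s)
    (hc : ∀ e ≤ f, ∀ dB ≤ f, ∀ dC ≤ f, (skeletonList e dB dC).length ≤ c) :
    (binaryVals eα f h l).length ≤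
      f * (f * (f * (f.factorial * (c * (2 ^ (6 * f) * wordSum l ^ (6 * f)))))) := by
  refine (length_flatMap_le _ _ _ fun e he => ?_).trans_eq (by rw [List.length_range'])
  have he := mem_range'_one.1 he
  refine (length_flatMap_le _ _ _ fun dB hB => ?_).trans_eq (by rw [List.length_range'])
  have hB := (mem_range'_one.1 hB).2
  refine (length_flatMap_le _ _ _ fun dC hC => ?_).trans_eq (by rw [List.length_range'])
  have hC := (mem_range'_one.1 hC).2
  rw [List.length_map]
  exact length_binaryList_le l he hB hC (hc e he.2 dB hB dC hC)

theorem encard_le_length {A B : Type*} {S : Set A} {g : A → B} (hg : Set.InjOn g S) {L : List B}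
    (hL : ∀ a ∈ S, g a ∈ L) : S.encard ≤ L.length := by
  classical
  rw [← hg.encard_image]
  have h1 : g '' S ⊆ (L.toFinset : Set B) := by
    rintro _ ⟨a, ha, rfl⟩
    simpa using hL a ha
  refine (Set.encard_le_encard h1).trans ?_
  rw [Set.encard_coe_eq_coe_finsetCard]
  exact_mod_cast List.toFinset_card_le L

theorem exists_learner_bounds (hf : 1 ≤ f) : ∃ C : ℕ, ∀ (α M : Type*) [Monoid M]
    (h : FreeMonoid α →* M) (s m : ℕ) (_ : α ≃ Fin s) (_ : M ≃ Fin m) (K : Finset (List α)),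
      (learner f h K).nts.encard ≤ ((C * (max 1 (sampleSize K)) ^ (2 * f) : ℕ) : ℕ∞) ∧
      {r ∈ (learner f h K).rules | ∀ (e dB dC : ℕ) (A B B' : Option (TypedTuple α M))
          (t : Template α e dB dC), r ≠ .binary A t B B'}.encard ≤
        ((C * (max 1 (sampleSize K)) ^ (4 * f + 2) : ℕ) : ℕ∞) ∧
      (learner f h K).rules.encard ≤ ((C * (max 1 (sampleSize K)) ^ (6 * f) : ℕ) : ℕ∞) := by
  obtain ⟨c, hc⟩ := exists_skeletonList_length_le f
  -- One constant for all three bounds: `6` covers the start symbol, and also the start rules (`1`)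
  -- together with the terminal rules (`4`). The other summands come from the nonterminals, the
  -- substitution rules and the binary rules.
  refine ⟨6 + f * (f.factorial * 2 ^ (2 * f)) + f * (f.factorial * 2 ^ (4 * f)) +
    f * (f * (f * (f.factorial * (c * 2 ^ (6 * f))))), ?_⟩
  intro α M _ h s m eα eM K
  classical
  let : Enc α := ⟨encIdx eα⟩
  let : Enc M := ⟨encIdx eM⟩
  have hl : ∀ w, w ∈ K.toList ↔ w ∈ K := by simp
  have hN : wordSum K.toList ≤ max 1 (sampleSize K) :=
    (sampleSize_eq_wordSum K.nodup_toList hl).symm.trans_le (le_max_right _ _)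
  have hN1 : 1 ≤ max 1 (sampleSize K) := le_max_left _ _
  generalize max 1 (sampleSize K) = N at hN hN1 ⊢
  have hpow : ∀ k, wordSum K.toList ^ k ≤ N ^ k := fun k => Nat.pow_le_pow_left hN k
  have hmono : ∀ {j k}, j ≤ k → N ^ j ≤ N ^ k := fun hjk => Nat.pow_le_pow_right hN1 hjk
  have hobs : (observedList f h K.toList).length ≤
      f * (f.factorial * 2 ^ (2 * f)) * N ^ (2 * f) := by
    refine (length_observedList_le K.toList hf).trans ?_
    rw [mul_assoc, mul_assoc]
    gcongr
  have hinj := (encRule_injOn (eα := eα) (learner f h K)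
    (encNonterminal_injective (eα := eα) (eM := eM))).mono (wellFormedRule_learner hf)
  have hother : (startVals (M := M) K.toList ++ termVals h K.toList ++
      unitVals f h K.toList).length ≤
      (5 + f * (f.factorial * 2 ^ (4 * f))) * N ^ (4 * f + 2) := by
    simp only [List.length_append, startVals, termVals, unitVals, List.length_map]
    have h1 : (startList (M := M) K.toList).length ≤ N ^ (4 * f + 2) :=
      (length_startList_le K.toList).trans (hN.trans (Nat.le_self_pow (by omega) N))
    have h2 : (termList h K.toList).length ≤ 4 * N ^ (4 * f + 2) :=
      (length_termList_le K.toList).trans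
        (Nat.mul_le_mul_left _ ((hpow 2).trans (hmono (by omega))))
    have h3 : (unitList f h K.toList).length ≤
        f * (f.factorial * 2 ^ (4 * f)) * N ^ (4 * f + 2) := by
      refine (length_unitList_le K.toList hf).trans ?_
      rw [mul_assoc, mul_assoc]
      have := (hpow (4 * f)).trans (hmono (show 4 * f ≤ 4 * f + 2 by omega))
      gcongr
    rw [Nat.add_mul]
    omega
  have hbin : (binaryVals eα f h K.toList).length ≤
      f * (f * (f * (f.factorial * (c * 2 ^ (6 * f))))) * N ^ (6 * f) := by
    refine (length_binaryVals_le K.toList eα hc).trans ?_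
    simp only [mul_assoc]
    gcongr
  have hcast : ∀ {a b : ℕ}, a ≤ b → ((a : ℕ) : ℕ∞) ≤ ((b : ℕ) : ℕ∞) := fun hab => by
    exact_mod_cast hab
  refine ⟨?_, ?_, ?_⟩
  · refine (encard_le_length (g := Option.map TypedTuple.raw)
      (L := none :: (observedList f h K.toList).map some)
      (Option.map_injective raw_injective).injOn fun A hA => ?_).trans (hcast ?_)
    · cases A with
      | none => simp
      | some T => simpa using (mem_observedList hl).2 ⟨T, some_mem_nts.1 hA, rfl⟩
    · have : 1 ≤ N ^ (2 * f) := Nat.one_le_pow _ _ hN1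
      simp only [List.length_cons, List.length_map, Nat.add_mul] at hobs ⊢
      omega
  · refine (encard_le_length (hinj.mono fun r hr => hr.1) (L := startVals (M := M) K.toList ++
      termVals h K.toList ++ unitVals f h K.toList) fun r hr => ?_).trans (hcast (hother.trans ?_))
    · have hm := (mem_learnerVals (eα := eα) (eM := eM) hf hl rfl rfl).2 ⟨r, hr.1, rfl⟩
      refine (List.mem_append.1 hm).resolve_right fun hb => ?_
      obtain ⟨e, dB, dC, TA, TB, TC, t, -, he⟩ := (mem_binaryVals hl).1 hb
      obtain ⟨hr1, hr2⟩ := hr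
      cases r with
      | binary A t B C => exact hr2 _ _ _ _ _ _ _ rfl
      | _ => simp [encRule, encNat] at he
    · exact Nat.mul_le_mul_right _ (by omega)
  · refine (encard_le_length hinj (L := learnerVals eα f h K.toList) fun r hr =>
      (mem_learnerVals hf hl rfl rfl).2 ⟨r, hr, rfl⟩).trans (hcast ?_)
    rw [learnerVals, List.length_append]
    refine (Nat.add_le_add (hother.trans
      -- Here `1 ≤ f` lets the bound for binary rules absorb the exponent `4 * f + 2`.
      (Nat.mul_le_mul_left _ (hmono (show 4 * f + 2 ≤ 6 * f by omega)))) hbin).trans ?_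
    rw [← Nat.add_mul]
    exact Nat.mul_le_mul_right _ (by omega)

end Count

end TupleLearner

theorem theorem9p5 (f : ℕ) (hf : 1 ≤ f) :
    ∃ C : ℕ, ∀ (α M : Type*) [Monoid M] (h : FreeMonoid α →* M) (s m : ℕ)
      (eα : α ≃ Fin s) (eM : M ≃ Fin m),
      (∀ K : Finset (List α),
        (TupleLearner.learner f h K).nts.encard ≤
          ((C * (max 1 (TupleLearner.sampleSize K)) ^ (2 * f) : ℕ) : ℕ∞) ∧
        {r ∈ (TupleLearner.learner f h K).rules |
            ∀ (e dB dC : ℕ) (A B B' : Option (TupleLearner.TypedTuple α M))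
              (t : TupleLearner.Template α e dB dC), r ≠ .binary A t B B'}.encard ≤
          ((C * (max 1 (TupleLearner.sampleSize K)) ^ (4 * f + 2) : ℕ) : ℕ∞) ∧
        (TupleLearner.learner f h K).rules.encard ≤
          ((C * (max 1 (TupleLearner.sampleSize K)) ^ (6 * f) : ℕ) : ℕ∞)) ∧
      TupleLearner.PolyConstructible eα (TupleLearner.encNonterminal eα eM)
        (TupleLearner.learner f h) ∧
      TupleLearner.PolyConstructible eα (TupleLearner.encNonterminal eα eM)
        (fun K => (TupleLearner.learner f h K).unitElim) ∧
      ∀ K : Finset (List α),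
        (TupleLearner.learner f h K).unitElim.IsExtended ∧
        (TupleLearner.learner f h K).unitElim.UnitFree ∧
        (TupleLearner.learner f h K).unitElim.language =
          (TupleLearner.learner f h K).language := by
  obtain ⟨C, hC⟩ := TupleLearner.exists_learner_bounds hf
  exact ⟨C, fun α M _ h s m eα eM => ⟨hC α M h s m eα eM,
    TupleLearner.polyConstructible_learner hf, TupleLearner.polyConstructible_unitElim hf,
    fun K => ⟨TupleLearner.isExtended_unitElim eα eM hf K, TupleLearner.unitFree_unitElim,
      TupleLearner.language_unitElim (TupleLearner.wellFormedRule_learner hf)⟩⟩⟩
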